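/- Let $\mathbb{A}=\mathbb{C}[q]_{(q-1)}$ be the localization of $\mathbb{C}[q]$ at the prime ideal $(q-1)$, let $m\ge 1$ be an integer, and let $\mathbf{R}$ be a commutative $\mathbb{A}$-algebra (for instance $\mathbb{C}(q)$, $\mathbb{A}$ itself, or $\mathbb{C}=\mathbb{A}/(q-1)$). Write $[n]=\frac{q^n-q^{-n}}{q-q^{-1}}$; a ratio $[2n]/[n]$ is read as $q^n+q^{-n}$, also for $n=0$. Expressions in quantum integers below lie in $\mathbb{A}$ and are mapped to $\mathbf{R}$. The web category $\mathbf{Web}_{\mathbf{R}}$ (for $O(m)$) is the $\mathbf{R}$-linear pivotal category whose objects are the tensor products of self-dual objects $k\in\mathbb{Z}_{\ge 0}$ (with cups $\mathbb 1\to k\otimes k$ and caps $k\otimes k\to \mathbb 1$), whose morphisms are generated by trivalent vertices $1\otimes k\to k+1$ and $k\otimes 1\to k+1$ ($k\ge 0$), and by their rotations, modulo the tensor ideal generated by $\mathrm{id}_k$ for $k>m$, the convention that strands labelled $0$ are erased (so the object $0$ is the unit $\mathbb 1$), and the relations: (a) a circle labelled $1$ equals $\frac{[2m-4][m]}{[m-2][2]}$;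 (b) the composite $2\to 1\otimes 1\to\mathbb 1$ of a split and a cap is $0$; (c) for $k\ge 1$, the bigon $k\to 1\otimes (k-1)\to k$ equals $\frac{[2k]}{[2]}\,\mathrm{id}_k$; (d) for $k\ge 0$, the two composites $1\otimes k\otimes 1\to 1\otimes (k+1)\to k+2$ and $1\otimes k\otimes 1\to (k+1)\otimes 1\to k+2$ are equal; (e) for $k\ge 1$, as morphisms $k\otimes k\to 1\otimes 1$, $$H_{k+1} = D\circ H_{k-1}-\frac{[2m-4k-4][m-2k]}{[m-2k-2][2m-4k]}\,H_{k-1}+\frac{[2m-4k-4][m-2]}{[m-2k-2][2m-4]}\,(\mathrm{cup}_1\circ\mathrm{cap}_k),$$ where $H_l$ is the H-shaped diagram whose vertical sides run from $k$ at the bottom to $1$ at the top and whose horizontal bar is labelled $l$, and $D$ is the composite $1\otimes 1\to 2\to 1\otimes 1$ of a merge and a split. The braiding is $$\beta_{1,1}=q^2\,\mathrm{id}_{1\otimes 1}-D-\frac{[m-2]}{[2m-4]}(q^2-q^{-2})q^{2-m}\,(\mathrm{cup}_1\circ\mathrm{cap}_1)\in\mathrm{End}_{\mathbf{Web}_{\mathbf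 R}}(1\otimes 1).$$ Let $\mathbf{StdWeb}_{\mathbf R}$ be the full monoidal subcategory of $\mathbf{Web}_{\mathbf R}$ generated by the object $1$, and let $\mathbf{Web}^{\beta}_{\mathbf R}$ be the smallest $\mathbf{R}$-linear pivotal subcategory whose objects are the tensor products of the object $1$ and whose morphisms contain $\beta_{1,1}$; that is, its morphisms are the $\mathbf{R}$-linear combinations of composites and tensor products of identities (and structure isomorphisms), $\beta_{1,1}$, $\mathrm{cup}_1$ and $\mathrm{cap}_1$. Let $\mathbf{BMW}_{\mathbf R}$ be the free $\mathbf{R}$-linear braided pivotal category on one self-dual object $\bullet$ of dimension $\frac{[2m-4][m]}{[m-2][2]}$ subject to $\beta_{\bullet,\bullet}-\beta_{\bullet,\bullet}^{-1}=(q^2-q^{-2})(\mathrm{id}_{\bullet\otimes\bullet}-\mathrm{cup}\circ\mathrm{cap})$ and to the relation that the partial closure on the right of $\beta_{\bullet,\bullet}$ is $q^{2m-2}\,\mathrm{id}_\bullet$. **Proposition.** $\mathbf{StdWeb}_{\mathbf R}=\mathbf{Web}^{\beta}_{\mathbf R}$: a morphism of $\mathbf{Web}_{\mathbf R}$ lies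 in $\mathbf{Web}^{\beta}_{\mathbf R}$ if and only if its source and target are tensor products of the object $1$. Consequently, $\mathbf{StdWeb}_{\mathbf R}$ carries a braided structure whose braiding of $1$ with itself is $\beta_{1,1}$, and there is an $\mathbf{R}$-linear braided monoidal functor $\mathbf{BMW}_{\mathbf R}\to\mathbf{StdWeb}_{\mathbf R}$ that sends $\bullet$ to $1$, the cup to $\mathrm{cup}_1$ and the cap to $\mathrm{cap}_1$ (hence $\beta_{\bullet,\bullet}$ to $\beta_{1,1}$), is full, and is surjective on objects. -/

import Mathlib

open CategoryTheory MonoidalCategory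

universe u

/-! ### `R`-linear monoidal categories given by generators and relations -/

/-- Objects: formal tensor products of the generating objects `G`. -/
inductive TensorWord (G : Type) : Type
  | unit : TensorWord G
  | of : G → TensorWord G
  | tensor : TensorWord G → TensorWord G → TensorWord G

/-- Formal `R`-linear combinations of formal compositions and tensor products of generating
morphisms and the structure morphisms of a monoidal category. -/
inductive MorTerm (R : Type u) {G : Type} (gen : TensorWord G → TensorWord G → Type) :
    TensorWord G → TensorWord G → Type u
  | gen {X Y : TensorWord G} (g : gen X Y) : MorTerm R gen X Y
  | id (X : TensorWord G) : MorTerm R gen X X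
  | comp {X Y Z : TensorWord G} (f : MorTerm R gen X Y) (g : MorTerm R gen Y Z) :
      MorTerm R gen X Z
  | tens {X Y X' Y' : TensorWord G} (f : MorTerm R gen X Y) (g : MorTerm R gen X' Y') :
      MorTerm R gen (X.tensor X') (Y.tensor Y')
  | assocHom (X Y Z : TensorWord G) :
      MorTerm R gen ((X.tensor Y).tensor Z) (X.tensor (Y.tensor Z))
  | assocInv (X Y Z : TensorWord G) :
      MorTerm R gen (X.tensor (Y.tensor Z)) ((X.tensor Y).tensor Z)
  | leftHom (X : TensorWord G) : MorTerm R gen (TensorWord.unit.tensor X) X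
  | leftInv (X : TensorWord G) : MorTerm R gen X (TensorWord.unit.tensor X)
  | rightHom (X : TensorWord G) : MorTerm R gen (X.tensor TensorWord.unit) X
  | rightInv (X : TensorWord G) : MorTerm R gen X (X.tensor TensorWord.unit)
  | zero (X Y : TensorWord G) : MorTerm R gen X Y
  | add {X Y : TensorWord G} (f g : MorTerm R gen X Y) : MorTerm R gen X Y
  | smul {X Y : TensorWord G} (r : R) (f : MorTerm R gen X Y) : MorTerm R gen X Y

/-- The congruence generated by the axioms of an `R`-linear monoidal category (with `R`-bilinear
composition and tensor product) and by the family `rel` of defining relations. -/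
inductive MorRel (R : Type u) [CommRing R] {G : Type} (gen : TensorWord G → TensorWord G → Type)
    (rel : ∀ X Y : TensorWord G, MorTerm R gen X Y → MorTerm R gen X Y → Prop) :
    ∀ X Y : TensorWord G, MorTerm R gen X Y → MorTerm R gen X Y → Prop
  -- the defining relations
  | rel {X Y} (f g : MorTerm R gen X Y) : rel X Y f g → MorRel R gen rel X Y f g
  -- equivalence relation, congruence
  | refl {X Y} (f : MorTerm R gen X Y) : MorRel R gen rel X Y f f
  | symm {X Y} (f g : MorTerm R gen X Y) : MorRel R gen rel X Y f g → MorRel R gen rel X Y g f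
  | trans {X Y} (f g h : MorTerm R gen X Y) :
      MorRel R gen rel X Y f g → MorRel R gen rel X Y g h → MorRel R gen rel X Y f h
  | comp_congr {X Y Z} (f f' : MorTerm R gen X Y) (g g' : MorTerm R gen Y Z) :
      MorRel R gen rel X Y f f' → MorRel R gen rel Y Z g g' →
      MorRel R gen rel X Z (.comp f g) (.comp f' g')
  | tens_congr {X Y X' Y'} (f f' : MorTerm R gen X Y) (g g' : MorTerm R gen X' Y') :
      MorRel R gen rel X Y f f' → MorRel R gen rel X' Y' g g' →
      MorRel R gen rel (X.tensor X') (Y.tensor Y') (.tens f g) (.tens f' g')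
  | add_congr {X Y} (f f' g g' : MorTerm R gen X Y) :
      MorRel R gen rel X Y f f' → MorRel R gen rel X Y g g' →
      MorRel R gen rel X Y (.add f g) (.add f' g')
  | smul_congr {X Y} (r : R) (f f' : MorTerm R gen X Y) :
      MorRel R gen rel X Y f f' → MorRel R gen rel X Y (.smul r f) (.smul r f')
  -- module axioms
  | add_assoc {X Y} (f g h : MorTerm R gen X Y) :
      MorRel R gen rel X Y (.add (.add f g) h) (.add f (.add g h))
  | add_comm {X Y} (f g : MorTerm R gen X Y) : MorRel R gen rel X Y (.add f g) (.add g f)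
  | zero_add {X Y} (f : MorTerm R gen X Y) : MorRel R gen rel X Y (.add (.zero X Y) f) f
  | one_smul {X Y} (f : MorTerm R gen X Y) : MorRel R gen rel X Y (.smul 1 f) f
  | mul_smul {X Y} (r s : R) (f : MorTerm R gen X Y) :
      MorRel R gen rel X Y (.smul (r * s) f) (.smul r (.smul s f))
  | smul_add {X Y} (r : R) (f g : MorTerm R gen X Y) :
      MorRel R gen rel X Y (.smul r (.add f g)) (.add (.smul r f) (.smul r g))
  | add_smul {X Y} (r s : R) (f : MorTerm R gen X Y) :
      MorRel R gen rel X Y (.smul (r + s) f) (.add (.smul r f) (.smul s f))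
  | zero_smul {X Y} (f : MorTerm R gen X Y) : MorRel R gen rel X Y (.smul 0 f) (.zero X Y)
  -- bilinearity
  | comp_add {X Y Z} (f : MorTerm R gen X Y) (g h : MorTerm R gen Y Z) :
      MorRel R gen rel X Z (.comp f (.add g h)) (.add (.comp f g) (.comp f h))
  | add_comp {X Y Z} (f g : MorTerm R gen X Y) (h : MorTerm R gen Y Z) :
      MorRel R gen rel X Z (.comp (.add f g) h) (.add (.comp f h) (.comp g h))
  | comp_smul {X Y Z} (f : MorTerm R gen X Y) (r : R) (g : MorTerm R gen Y Z) :
      MorRel R gen rel X Z (.comp f (.smul r g)) (.smul r (.comp f g))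
  | smul_comp {X Y Z} (r : R) (f : MorTerm R gen X Y) (g : MorTerm R gen Y Z) :
      MorRel R gen rel X Z (.comp (.smul r f) g) (.smul r (.comp f g))
  | tens_add {X Y X' Y'} (f : MorTerm R gen X Y) (g h : MorTerm R gen X' Y') :
      MorRel R gen rel (X.tensor X') (Y.tensor Y')
        (.tens f (.add g h)) (.add (.tens f g) (.tens f h))
  | add_tens {X Y X' Y'} (f g : MorTerm R gen X Y) (h : MorTerm R gen X' Y') :
      MorRel R gen rel (X.tensor X') (Y.tensor Y')
        (.tens (.add f g) h) (.add (.tens f h) (.tens g h))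
  | tens_smul {X Y X' Y'} (f : MorTerm R gen X Y) (r : R) (g : MorTerm R gen X' Y') :
      MorRel R gen rel (X.tensor X') (Y.tensor Y') (.tens f (.smul r g)) (.smul r (.tens f g))
  | smul_tens {X Y X' Y'} (r : R) (f : MorTerm R gen X Y) (g : MorTerm R gen X' Y') :
      MorRel R gen rel (X.tensor X') (Y.tensor Y') (.tens (.smul r f) g) (.smul r (.tens f g))
  -- category axioms
  | id_comp {X Y} (f : MorTerm R gen X Y) : MorRel R gen rel X Y (.comp (.id X) f) f
  | comp_id {X Y} (f : MorTerm R gen X Y) : MorRel R gen rel X Y (.comp f (.id Y)) f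
  | comp_assoc {X Y Z W} (f : MorTerm R gen X Y) (g : MorTerm R gen Y Z) (h : MorTerm R gen Z W) :
      MorRel R gen rel X W (.comp (.comp f g) h) (.comp f (.comp g h))
  -- monoidal category axioms
  | id_tens_id (X Y : TensorWord G) :
      MorRel R gen rel (X.tensor Y) (X.tensor Y) (.tens (.id X) (.id Y)) (.id (X.tensor Y))
  | tens_comp {X Y Z X' Y' Z'} (f : MorTerm R gen X Y) (f' : MorTerm R gen X' Y')
      (g : MorTerm R gen Y Z) (g' : MorTerm R gen Y' Z') :
      MorRel R gen rel (X.tensor X') (Z.tensor Z')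
        (.comp (.tens f f') (.tens g g')) (.tens (.comp f g) (.comp f' g'))
  | assoc_hom_inv (X Y Z : TensorWord G) :
      MorRel R gen rel _ _ (.comp (.assocHom X Y Z) (.assocInv X Y Z)) (.id _)
  | assoc_inv_hom (X Y Z : TensorWord G) :
      MorRel R gen rel _ _ (.comp (.assocInv X Y Z) (.assocHom X Y Z)) (.id _)
  | left_hom_inv (X : TensorWord G) :
      MorRel R gen rel _ _ (.comp (.leftHom X) (.leftInv X)) (.id _)
  | left_inv_hom (X : TensorWord G) :
      MorRel R gen rel _ _ (.comp (.leftInv X) (.leftHom X)) (.id _)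
  | right_hom_inv (X : TensorWord G) :
      MorRel R gen rel _ _ (.comp (.rightHom X) (.rightInv X)) (.id _)
  | right_inv_hom (X : TensorWord G) :
      MorRel R gen rel _ _ (.comp (.rightInv X) (.rightHom X)) (.id _)
  | assoc_natural {X X' X'' Y Y' Y''} (f : MorTerm R gen X Y) (f' : MorTerm R gen X' Y')
      (f'' : MorTerm R gen X'' Y'') :
      MorRel R gen rel _ _ (.comp (.tens (.tens f f') f'') (.assocHom Y Y' Y''))
        (.comp (.assocHom X X' X'') (.tens f (.tens f' f'')))
  | left_natural {X Y} (f : MorTerm R gen X Y) :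
      MorRel R gen rel _ _ (.comp (.tens (.id .unit) f) (.leftHom Y)) (.comp (.leftHom X) f)
  | right_natural {X Y} (f : MorTerm R gen X Y) :
      MorRel R gen rel _ _ (.comp (.tens f (.id .unit)) (.rightHom Y)) (.comp (.rightHom X) f)
  | pentagon (W X Y Z : TensorWord G) :
      MorRel R gen rel _ _
        (.comp (.tens (.assocHom W X Y) (.id Z))
          (.comp (.assocHom W (X.tensor Y) Z) (.tens (.id W) (.assocHom X Y Z))))
        (.comp (.assocHom (W.tensor X) Y Z) (.assocHom W X (Y.tensor Z)))
  | triangle (X Y : TensorWord G) :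
      MorRel R gen rel _ _ (.comp (.assocHom X .unit Y) (.tens (.id X) (.leftHom Y)))
        (.tens (.rightHom X) (.id Y))

/-- The `R`-linear monoidal category with generating objects `G`, generating morphisms `gen` and
defining relations `rel`. -/
def Presented (R : Type u) [CommRing R] {G : Type} (gen : TensorWord G → TensorWord G → Type)
    (_rel : ∀ X Y : TensorWord G, MorTerm R gen X Y → MorTerm R gen X Y → Prop) : Type :=
  TensorWord G

namespace Presented

variable {R : Type u} [CommRing R] {G : Type} {gen : TensorWord G → TensorWord G → Type}
  {rel : ∀ X Y : TensorWord G, MorTerm R gen X Y → MorTerm R gen X Y → Prop}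

/-- Morphisms: terms modulo the congruence. -/
abbrev Mor (R : Type u) [CommRing R] {G : Type} (gen : TensorWord G → TensorWord G → Type)
    (rel : ∀ X Y : TensorWord G, MorTerm R gen X Y → MorTerm R gen X Y → Prop)
    (X Y : TensorWord G) : Type u :=
  Quot (MorRel R gen rel X Y)

/-- The class of a term. -/
abbrev mk (rel : ∀ X Y : TensorWord G, MorTerm R gen X Y → MorTerm R gen X Y → Prop)
    {X Y : TensorWord G} (f : MorTerm R gen X Y) : Mor R gen rel X Y :=
  Quot.mk _ f

/-- Composition of classes of terms. -/
def comp' {X Y Z : TensorWord G} (f : Mor R gen rel X Y) (g : Mor R gen rel Y Z) :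
    Mor R gen rel X Z :=
  Quot.map₂ MorTerm.comp (fun f _ _ h => .comp_congr _ _ _ _ (.refl f) h)
    (fun _ _ g h => .comp_congr _ _ _ _ h (.refl g)) f g

/-- Tensor product of classes of terms. -/
def tens' {X Y X' Y' : TensorWord G} (f : Mor R gen rel X Y) (g : Mor R gen rel X' Y') :
    Mor R gen rel (X.tensor X') (Y.tensor Y') :=
  Quot.map₂ MorTerm.tens (fun f _ _ h => .tens_congr _ _ _ _ (.refl f) h)
    (fun _ _ g h => .tens_congr _ _ _ _ h (.refl g)) f g

instance : Category.{u} (Presented R gen rel) where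
  Hom X Y := Mor R gen rel X Y
  id X := mk rel (.id X)
  comp f g := comp' f g
  id_comp := by rintro X Y ⟨f⟩; exact Quot.sound (.id_comp f)
  comp_id := by rintro X Y ⟨f⟩; exact Quot.sound (.comp_id f)
  assoc := by rintro X Y Z W ⟨f⟩ ⟨g⟩ ⟨h⟩; exact Quot.sound (.comp_assoc f g h)

/-- Addition of classes of terms. -/
def add' {X Y : TensorWord G} (f g : Mor R gen rel X Y) : Mor R gen rel X Y :=
  Quot.map₂ MorTerm.add (fun f _ _ h => .add_congr _ _ _ _ (.refl f) h)
    (fun _ _ g h => .add_congr _ _ _ _ h (.refl g)) f g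

/-- Scalar multiples of classes of terms. -/
def smul' {X Y : TensorWord G} (r : R) (f : Mor R gen rel X Y) : Mor R gen rel X Y :=
  Quot.map (MorTerm.smul r) (fun _ _ h => .smul_congr r _ _ h) f

theorem zero_add' {X Y : TensorWord G} (f : Mor R gen rel X Y) :
    add' (mk rel (.zero X Y)) f = f := by
  rcases f with ⟨f⟩; exact Quot.sound (.zero_add f)

theorem add_comm' {X Y : TensorWord G} (f g : Mor R gen rel X Y) : add' f g = add' g f := by
  rcases f with ⟨f⟩; rcases g with ⟨g⟩; exact Quot.sound (.add_comm f g)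

theorem neg_add' {X Y : TensorWord G} (f : Mor R gen rel X Y) :
    add' (smul' (-1) f) f = mk rel (.zero X Y) := by
  rcases f with ⟨f⟩
  refine Quot.sound (.trans _ _ _ (.add_congr _ _ _ _ (.refl _) (.symm _ _ (.one_smul f))) ?_)
  refine .trans _ _ _ (.symm _ _ (.add_smul _ _ _)) ?_
  rw [neg_add_cancel]
  exact .zero_smul f

instance : Preadditive (Presented R gen rel) where
  homGroup X Y :=
    { zero := mk rel (.zero X Y)
      add := add'
      neg := smul' (-1)
      add_assoc := by rintro ⟨f⟩ ⟨g⟩ ⟨h⟩; exact Quot.sound (.add_assoc f g h)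
      add_comm := add_comm'
      zero_add := zero_add'
      add_zero := fun f => (add_comm' _ _).trans (zero_add' f)
      neg_add_cancel := neg_add'
      nsmul := @nsmulRec _ ⟨mk rel (.zero X Y)⟩ ⟨add'⟩
      zsmul := @zsmulRec _ ⟨mk rel (.zero X Y)⟩ ⟨add'⟩ ⟨smul' (-1)⟩
        (@nsmulRec _ ⟨mk rel (.zero X Y)⟩ ⟨add'⟩) }
  add_comp := by rintro X Y Z ⟨f⟩ ⟨g⟩ ⟨h⟩; exact Quot.sound (.add_comp f g h)
  comp_add := by rintro X Y Z ⟨f⟩ ⟨g⟩ ⟨h⟩; exact Quot.sound (.comp_add f g h)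

instance : Linear R (Presented R gen rel) where
  homModule X Y :=
    { smul := smul'
      one_smul := by rintro ⟨f⟩; exact Quot.sound (.one_smul f)
      mul_smul := by rintro r s ⟨f⟩; exact Quot.sound (.mul_smul r s f)
      smul_add := by rintro r ⟨f⟩ ⟨g⟩; exact Quot.sound (.smul_add r f g)
      add_smul := by rintro r s ⟨f⟩; exact Quot.sound (.add_smul r s f)
      zero_smul := by rintro ⟨f⟩; exact Quot.sound (.zero_smul f)
      smul_zero := by
        intro r
        refine Quot.sound
          (.trans _ _ _ (.smul_congr r _ _ (.symm _ _ (.zero_smul (.zero X Y)))) ?_)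
        refine .trans _ _ _ (.symm _ _ (.mul_smul r 0 _)) ?_
        rw [mul_zero]
        exact .zero_smul _ }
  smul_comp := by rintro X Y Z r ⟨f⟩ ⟨g⟩; exact Quot.sound (.smul_comp r f g)
  comp_smul := by rintro X Y Z ⟨f⟩ r ⟨g⟩; exact Quot.sound (.comp_smul f r g)

instance : MonoidalCategoryStruct (Presented R gen rel) where
  tensorObj X Y := TensorWord.tensor X Y
  tensorHom f g := tens' f g
  whiskerLeft X _ _ f := tens' (mk rel (.id X)) f
  whiskerRight f Y := tens' f (mk rel (.id Y))
  tensorUnit := TensorWord.unit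
  associator X Y Z :=
    { hom := mk rel (.assocHom X Y Z)
      inv := mk rel (.assocInv X Y Z)
      hom_inv_id := Quot.sound (.assoc_hom_inv X Y Z)
      inv_hom_id := Quot.sound (.assoc_inv_hom X Y Z) }
  leftUnitor X :=
    { hom := mk rel (.leftHom X)
      inv := mk rel (.leftInv X)
      hom_inv_id := Quot.sound (.left_hom_inv X)
      inv_hom_id := Quot.sound (.left_inv_hom X) }
  rightUnitor X :=
    { hom := mk rel (.rightHom X)
      inv := mk rel (.rightInv X)
      hom_inv_id := Quot.sound (.right_hom_inv X)
      inv_hom_id := Quot.sound (.right_inv_hom X) }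

instance : MonoidalCategory (Presented R gen rel) :=
  MonoidalCategory.ofTensorHom
    (id_tensorHom_id := fun X Y => Quot.sound (.id_tens_id X Y))
    (id_tensorHom := fun _ _ _ _ => rfl)
    (tensorHom_id := fun _ _ => rfl)
    (tensorHom_comp_tensorHom := by
      rintro _ _ _ _ _ _ ⟨f⟩ ⟨f'⟩ ⟨g⟩ ⟨g'⟩; exact Quot.sound (.tens_comp f f' g g'))
    (associator_naturality := by
      rintro _ _ _ _ _ _ ⟨f⟩ ⟨g⟩ ⟨h⟩; exact Quot.sound (.assoc_natural f g h))
    (leftUnitor_naturality := by rintro _ _ ⟨f⟩; exact Quot.sound (.left_natural f))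
    (rightUnitor_naturality := by rintro _ _ ⟨f⟩; exact Quot.sound (.right_natural f))
    (pentagon := fun W X Y Z => Quot.sound (.pentagon W X Y Z))
    (triangle := fun X Y => Quot.sound (.triangle X Y))

/-- A generating morphism, as a morphism of the category. -/
def ofGen {X Y : Presented R gen rel} (g : gen X Y) : X ⟶ Y := mk rel (.gen g)

instance : MonoidalPreadditive (Presented R gen rel) where
  whiskerLeft_add := by rintro X Y Z ⟨f⟩ ⟨g⟩; exact Quot.sound (.tens_add _ f g)
  add_whiskerRight := by rintro X Y Z ⟨f⟩ ⟨g⟩; exact Quot.sound (.add_tens f g _)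
  whiskerLeft_zero := by
    intro X Y Z
    refine Quot.sound (.trans _ _ _ (.tens_congr _ _ _ _ (.refl _)
      (.symm _ _ (.zero_smul (.zero Y Z)))) ?_)
    exact .trans _ _ _ (.tens_smul _ _ _) (.zero_smul _)
  zero_whiskerRight := by
    intro X Y Z
    refine Quot.sound (.trans _ _ _ (.tens_congr _ _ _ _
      (.symm _ _ (.zero_smul (.zero Y Z))) (.refl _)) ?_)
    exact .trans _ _ _ (.smul_tens _ _ _) (.zero_smul _)

instance : MonoidalLinear R (Presented R gen rel) where
  whiskerLeft_smul := by rintro X Y Z r ⟨f⟩; exact Quot.sound (.tens_smul _ r f)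
  smul_whiskerRight := by rintro r Y Z ⟨f⟩ X; exact Quot.sound (.smul_tens r f _)

end Presented

/-- The free `R`-linear monoidal category on the given generators (no relations). -/
abbrev FreeMon (R : Type u) [CommRing R] {G : Type}
    (gen : TensorWord G → TensorWord G → Type) : Type :=
  Presented R gen (fun _ _ _ _ => False)

/-- The category obtained from the free one by imposing a family `rel` of relations between
morphisms of the free category, that is, its quotient by the tensor ideal they generate. -/
abbrev FreeMonMod (R : Type u) [CommRing R] {G : Type}
    (gen : TensorWord G → TensorWord G → Type)
    (rel : ∀ X Y : FreeMon R gen, (X ⟶ Y) → (X ⟶ Y) → Prop) : Type :=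
  Presented R gen (fun X Y f g => rel X Y (Presented.mk _ f) (Presented.mk _ g))

/-! ### The ground ring and the quantum integers -/

section GroundRing

open Polynomial

/-- The prime ideal `(q - 1)` of `ℂ[q]`. -/
noncomputable def qIdeal : Ideal ℂ[X] := Ideal.span {X - C 1}

instance : qIdeal.IsPrime :=
  (Ideal.span_singleton_prime (X_sub_C_ne_zero 1)).2 (prime_X_sub_C 1)

/-- The ring `𝔸`: the localization of `ℂ[q]` at the prime ideal `(q - 1)`. -/
abbrev QRing : Type := Localization.AtPrime qIdeal

theorem qIdeal_eval {p : ℂ[X]} : p ∈ qIdeal ↔ p.eval 1 = 0 := by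
  rw [qIdeal, Ideal.mem_span_singleton, dvd_iff_isRoot, IsRoot.def]

theorem isUnit_of_eval {p : ℂ[X]} (hp : p.eval 1 ≠ 0) : IsUnit (algebraMap ℂ[X] QRing p) :=
  IsLocalization.map_units QRing
    (⟨p, fun h => hp (qIdeal_eval.1 h)⟩ : qIdeal.primeCompl)

/-- The indeterminate `q`, a unit of `𝔸`. -/
noncomputable def qq : QRingˣ := (isUnit_of_eval (p := X) (by simp)).unit

theorem isUnit_qq_nat (n : ℕ) : IsUnit ((↑(qq ^ n) : QRing) + ↑(qq ^ n)⁻¹) := by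
  have h : IsUnit (((qq ^ n : QRingˣ) : QRing) * (((qq ^ n : QRingˣ) : QRing) + ↑(qq ^ n)⁻¹)) := by
    have e : (((qq ^ n : QRingˣ) : QRing) * (((qq ^ n : QRingˣ) : QRing) + ↑(qq ^ n)⁻¹)) =
        algebraMap ℂ[X] QRing (X ^ n * X ^ n + 1) := by
      rw [mul_add, Units.mul_inv]
      simp [qq]
    rw [e]
    refine isUnit_of_eval ?_
    simp
  exact (IsUnit.mul_iff.1 h).2

theorem isUnit_qq (n : ℤ) : IsUnit ((↑(qq ^ n) : QRing) + ↑(qq ^ (-n))) := by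
  obtain ⟨k, rfl | rfl⟩ := n.eq_nat_or_neg
  · simpa using isUnit_qq_nat k
  · rw [add_comm]; simpa using isUnit_qq_nat k

/-- The unit `[2n] / [n] = q ^ n + q ^ (-n)` of `𝔸`, for an integer `n`. -/
noncomputable def qDbl (n : ℤ) : QRingˣ := (isUnit_qq n).unit

/-- The quantum integer `[n] = (q ^ n - q ^ (-n)) / (q - q⁻¹) = ∑ i < n, q ^ (n - 1 - 2 i)`. -/
noncomputable def qInt (n : ℕ) : QRing :=
  ∑ i ∈ Finset.range n, (↑(qq ^ ((n : ℤ) - 1 - 2 * i)) : QRing)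

theorem qInt_mul (n : ℕ) :
    qInt n * ((qq : QRing) - ↑qq⁻¹) = ↑(qq ^ (n : ℤ)) - ↑(qq ^ (-(n : ℤ))) := by
  have key : ∀ k : ℕ, (∑ i ∈ Finset.range k, (↑(qq ^ ((n : ℤ) - 1 - 2 * i)) : QRing)) *
      ((qq : QRing) - ↑qq⁻¹) = ↑(qq ^ (n : ℤ)) - ↑(qq ^ ((n : ℤ) - 2 * k)) := by
    intro k
    induction k with
    | zero => simp
    | succ k ih =>
      rw [Finset.sum_range_succ, add_mul, ih, mul_sub, ← Units.val_mul, ← Units.val_mul,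
        ← zpow_add_one, ← zpow_sub_one]
      have h1 : (n : ℤ) - 1 - 2 * k + 1 = n - 2 * k := by ring
      have h2 : (n : ℤ) - 1 - 2 * k - 1 = n - 2 * ((k + 1 : ℕ) : ℤ) := by push_cast; ring
      rw [h1, h2]
      ring
  have := key n
  rw [qInt, this]
  congr 4
  ring

/-- The value `[2m-4][m] / ([m-2][2])` of a circle labelled `1`. -/
noncomputable def circleCoeff (m : ℕ) : QRing :=
  ↑(qDbl ((m : ℤ) - 2)) * qInt m * ↑(qDbl 1)⁻¹

/-- The value `[2k] / [2]` of a bigon. -/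
noncomputable def bigonCoeff (k : ℕ) : QRing := qInt (2 * k) * ↑(qDbl 1)⁻¹

/-- `[2m-4k-4][m-2k] / ([m-2k-2][2m-4k])`. -/
noncomputable def ladderCoeff (m k : ℕ) : QRing :=
  ↑(qDbl ((m : ℤ) - 2 * k - 2)) * ↑(qDbl ((m : ℤ) - 2 * k))⁻¹

/-- `[2m-4k-4][m-2] / ([m-2k-2][2m-4])`. -/
noncomputable def cupcapCoeff (m k : ℕ) : QRing :=
  ↑(qDbl ((m : ℤ) - 2 * k - 2)) * ↑(qDbl ((m : ℤ) - 2))⁻¹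

/-- `q ^ 2 - q ^ (-2)`. -/
noncomputable def skeinCoeff : QRing := ↑(qq ^ (2 : ℤ)) - ↑(qq ^ (-2 : ℤ))

/-- `([m-2] / [2m-4]) (q ^ 2 - q ^ (-2)) q ^ (2-m)`. -/
noncomputable def braidCoeff (m : ℕ) : QRing :=
  ↑(qDbl ((m : ℤ) - 2))⁻¹ * skeinCoeff * ↑(qq ^ (2 - (m : ℤ)))

end GroundRing

/-! ### Planar diagrams in a monoidal category -/

section Diagrams

variable {C : Type*} [Category C] [MonoidalCategory C]

/-- The morphism `Z ⟶ Y ⊗ X` obtained from `f : X ⊗ Y ⟶ Z` by rotating it by 180 degrees, the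
legs `X`, `Y` being bent around the left side. -/
def rotLeft {X Y Z : C} (cupX : 𝟙_ C ⟶ X ⊗ X) (cupY : 𝟙_ C ⟶ Y ⊗ Y) (capZ : Z ⊗ Z ⟶ 𝟙_ C)
    (f : X ⊗ Y ⟶ Z) : Z ⟶ Y ⊗ X :=
  𝟙 Z ⊗≫ cupY ▷ Z ⊗≫ Y ◁ cupX ▷ (Y ⊗ Z) ⊗≫ (Y ⊗ X) ◁ f ▷ Z ⊗≫ (Y ⊗ X) ◁ capZ ⊗≫ 𝟙 (Y ⊗ X)

/-- The same with the legs bent around the right side. -/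
def rotRight {X Y Z : C} (cupX : 𝟙_ C ⟶ X ⊗ X) (cupY : 𝟙_ C ⟶ Y ⊗ Y) (capZ : Z ⊗ Z ⟶ 𝟙_ C)
    (f : X ⊗ Y ⟶ Z) : Z ⟶ Y ⊗ X :=
  𝟙 Z ⊗≫ Z ◁ cupX ⊗≫ (Z ⊗ X) ◁ cupY ▷ X ⊗≫ Z ◁ f ▷ (Y ⊗ X) ⊗≫ capZ ▷ (Y ⊗ X) ⊗≫ 𝟙 (Y ⊗ X)

/-- One of the two snakes (zigzags) on a self-dual object. -/
def snakeLeft {X : C} (cup : 𝟙_ C ⟶ X ⊗ X) (cap : X ⊗ X ⟶ 𝟙_ C) : X ⟶ X :=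
  𝟙 X ⊗≫ cup ▷ X ⊗≫ X ◁ cap ⊗≫ 𝟙 X

/-- The other snake. -/
def snakeRight {X : C} (cup : 𝟙_ C ⟶ X ⊗ X) (cap : X ⊗ X ⟶ 𝟙_ C) : X ⟶ X :=
  𝟙 X ⊗≫ X ◁ cup ⊗≫ cap ▷ X ⊗≫ 𝟙 X

/-- The partial closure on the right of an endomorphism of `X ⊗ X`. -/
def closeRight {X : C} (cup : 𝟙_ C ⟶ X ⊗ X) (cap : X ⊗ X ⟶ 𝟙_ C) (f : X ⊗ X ⟶ X ⊗ X) : X ⟶ X :=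
  𝟙 X ⊗≫ X ◁ cup ⊗≫ f ▷ X ⊗≫ X ◁ cap ⊗≫ 𝟙 X

/-- Strands labelled by `k ≥ 0`, cups, caps and trivalent vertices in a monoidal category. -/
structure WebData (C : Type*) [Category C] [MonoidalCategory C] where
  obj : ℕ → C
  cup : ∀ k, 𝟙_ C ⟶ obj k ⊗ obj k
  cap : ∀ k, obj k ⊗ obj k ⟶ 𝟙_ C
  mergeL : ∀ k, obj 1 ⊗ obj k ⟶ obj (k + 1)
  mergeR : ∀ k, obj k ⊗ obj 1 ⟶ obj (k + 1)

namespace WebData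

variable (D : WebData C)

/-- The splitting vertex `k + 1 → 1 ⊗ k`. -/
def splitL (k : ℕ) : D.obj (k + 1) ⟶ D.obj 1 ⊗ D.obj k :=
  rotLeft (D.cup k) (D.cup 1) (D.cap (k + 1)) (D.mergeR k)

/-- The splitting vertex `k + 1 → k ⊗ 1`. -/
def splitR (k : ℕ) : D.obj (k + 1) ⟶ D.obj k ⊗ D.obj 1 :=
  rotLeft (D.cup 1) (D.cup k) (D.cap (k + 1)) (D.mergeL k)

/-- The endomorphism `1 ⊗ 1 → 2 → 1 ⊗ 1`. -/
def dumbbell : D.obj 1 ⊗ D.obj 1 ⟶ D.obj 1 ⊗ D.obj 1 :=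
  D.mergeL 1 ≫ D.splitL 1

/-- The diagram `k ⊗ k → 1 ⊗ 1` in the shape of the letter H, whose two vertical sides run from
`k` at the bottom to `1` at the top, with horizontal bar labelled `k + 1`. -/
def barUp (k : ℕ) : D.obj k ⊗ D.obj k ⟶ D.obj 1 ⊗ D.obj 1 :=
  𝟙 _ ⊗≫ D.cup 1 ▷ (D.obj k ⊗ D.obj k) ⊗≫ D.obj 1 ◁ D.mergeL k ▷ D.obj k ⊗≫
    D.obj 1 ◁ D.splitL k ▷ D.obj k ⊗≫ (D.obj 1 ⊗ D.obj 1) ◁ D.cap k ⊗≫ 𝟙 _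

/-- The diagram `k ⊗ k → 1 ⊗ 1` of the same shape, for `k = j + 1`, with horizontal bar
labelled `k - 1 = j`. -/
def barDown (j : ℕ) : D.obj (j + 1) ⊗ D.obj (j + 1) ⟶ D.obj 1 ⊗ D.obj 1 :=
  (D.splitL j ⊗ₘ D.splitR j) ⊗≫ D.obj 1 ◁ D.cap j ▷ D.obj 1 ⊗≫ 𝟙 _

end WebData

end Diagrams

/-! ### The web category -/

/-- The object labelled `k`; a strand labelled `0` is the unit object. -/
def label : ℕ → TensorWord ℕ+
  | 0 => .unit
  | k + 1 => .of k.succPNat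

/-- Generating morphisms: cups and caps (self-duality) and the trivalent vertices. -/
inductive WebGen : TensorWord ℕ+ → TensorWord ℕ+ → Type
  | cup (k : ℕ) : WebGen .unit ((label k).tensor (label k))
  | cap (k : ℕ) : WebGen ((label k).tensor (label k)) .unit
  | mergeL (k : ℕ) : WebGen ((label 1).tensor (label k)) (label (k + 1))
  | mergeR (k : ℕ) : WebGen ((label k).tensor (label 1)) (label (k + 1))

/-- The generators, as web data in any category presented by them. -/
def webData (R : Type u) [CommRing R]
    (rel : ∀ X Y : TensorWord ℕ+, MorTerm R WebGen X Y → MorTerm R WebGen X Y → Prop) :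
    WebData (Presented R WebGen rel) where
  obj k := label k
  cup k := Presented.ofGen (WebGen.cup k)
  cap k := Presented.ofGen (WebGen.cap k)
  mergeL k := Presented.ofGen (WebGen.mergeL k)
  mergeR k := Presented.ofGen (WebGen.mergeR k)

section Web

variable (R : Type u) [CommRing R] [Algebra QRing R] (m : ℕ)

/-- The generators in the free category, before relations are imposed. -/
abbrev freeWebData : WebData (FreeMon R WebGen) := webData R _

/-- The defining relations of the web category. -/
inductive WebRel : ∀ X Y : FreeMon R WebGen, (X ⟶ Y) → (X ⟶ Y) → Prop
  -- strands labelled zero are erased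
  | erase_cup : WebRel _ _ ((freeWebData R).cup 0) (λ_ (𝟙_ (FreeMon R WebGen))).inv
  | erase_cap : WebRel _ _ ((freeWebData R).cap 0) (λ_ (𝟙_ (FreeMon R WebGen))).hom
  | erase_mergeL : WebRel _ _ ((freeWebData R).mergeL 0) (ρ_ ((freeWebData R).obj 1)).hom
  | erase_mergeR : WebRel _ _ ((freeWebData R).mergeR 0) (λ_ ((freeWebData R).obj 1)).hom
  -- the objects `k` are self-dual
  | snakeLeft (k : ℕ) :
      WebRel _ _ (snakeLeft ((freeWebData R).cup k) ((freeWebData R).cap k)) (𝟙 _)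
  | snakeRight (k : ℕ) :
      WebRel _ _ (snakeRight ((freeWebData R).cup k) ((freeWebData R).cap k)) (𝟙 _)
  -- the category is pivotal: left and right rotations of the generating vertices agree
  | pivotalL (k : ℕ) :
      WebRel _ _
        (rotLeft ((freeWebData R).cup 1) ((freeWebData R).cup k) ((freeWebData R).cap (k + 1))
          ((freeWebData R).mergeL k))
        (rotRight ((freeWebData R).cup 1) ((freeWebData R).cup k) ((freeWebData R).cap (k + 1))
          ((freeWebData R).mergeL k))
  | pivotalR (k : ℕ) :
      WebRel _ _
        (rotLeft ((freeWebData R).cup k) ((freeWebData R).cup 1) ((freeWebData R).cap (k + 1))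
          ((freeWebData R).mergeR k))
        (rotRight ((freeWebData R).cup k) ((freeWebData R).cup 1) ((freeWebData R).cap (k + 1))
          ((freeWebData R).mergeR k))
  -- labels larger than `m` vanish
  | vanish (k : ℕ) (hk : m < k) : WebRel _ _ (𝟙 ((freeWebData R).obj k)) 0
  -- circle
  | circle :
      WebRel _ _ ((freeWebData R).cup 1 ≫ (freeWebData R).cap 1)
        (algebraMap QRing R (circleCoeff m) • 𝟙 _)
  -- lollipop
  | lollipop : WebRel _ _ ((freeWebData R).splitL 1 ≫ (freeWebData R).cap 1) 0
  -- bigon `k + 1 → 1 ⊗ k → k + 1`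
  | bigon (k : ℕ) :
      WebRel _ _ ((freeWebData R).splitL k ≫ (freeWebData R).mergeL k)
        (algebraMap QRing R (bigonCoeff (k + 1)) • 𝟙 _)
  -- associativity `1 ⊗ k ⊗ 1 → k + 2`
  | assoc (k : ℕ) :
      WebRel _ _
        ((freeWebData R).obj 1 ◁ (freeWebData R).mergeR k ≫ (freeWebData R).mergeL (k + 1))
        ((α_ _ _ _).inv ≫
          (freeWebData R).mergeL k ▷ (freeWebData R).obj 1 ≫ (freeWebData R).mergeR (k + 1))
  -- the exchange relation for `k = j + 1`
  | exchange (j : ℕ) :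
      WebRel _ _ ((freeWebData R).barUp (j + 1))
        ((freeWebData R).barDown j ≫ (freeWebData R).dumbbell
          - algebraMap QRing R (ladderCoeff m (j + 1)) • (freeWebData R).barDown j
          + algebraMap QRing R (cupcapCoeff m (j + 1)) •
              ((freeWebData R).cap (j + 1) ≫ (freeWebData R).cup 1))

/-- The web category of `O(m)` over the `𝔸`-algebra `R`. -/
abbrev Web : Type := FreeMonMod R WebGen (WebRel R m)

/-- The generating diagrams in the web category. -/
abbrev web : WebData (Web R m) := webData R _

/-- The braiding `1 ⊗ 1 → 1 ⊗ 1`. -/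
noncomputable def webBraiding : (web R m).obj 1 ⊗ (web R m).obj 1 ⟶ (web R m).obj 1 ⊗ (web R m).obj 1 :=
  algebraMap QRing R ↑(qq ^ (2 : ℤ)) • 𝟙 _ - (web R m).dumbbell
    - algebraMap QRing R (braidCoeff m) • ((web R m).cap 1 ≫ (web R m).cup 1)

/-- Tensor products of copies of the object `1` (including the empty one). -/
inductive IsStd : ObjectProperty (Web R m)
  | unit : IsStd (𝟙_ (Web R m))
  | one : IsStd ((web R m).obj 1)
  | tensor (X Y : Web R m) : IsStd X → IsStd Y → IsStd (X ⊗ Y)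

instance : (IsStd R m).IsMonoidal where
  prop_unit := IsStd.unit
  prop_tensor _ _ hX hY := IsStd.tensor _ _ hX hY

/-- The standard web category: the full monoidal subcategory generated by the object `1`. -/
abbrev StdWeb : Type := (IsStd R m).FullSubcategory

/-- The morphisms of the braiding standard web category: the smallest `R`-linear pivotal (closed
under composition, tensor product, cups and caps) subcategory, on the tensor products of the
object `1`, that contains the braiding. -/
inductive IsBraidWeb : ∀ X Y : Web R m, (X ⟶ Y) → Prop
  | braiding : IsBraidWeb _ _ (webBraiding R m)
  | cup : IsBraidWeb _ _ ((web R m).cup 1)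
  | cap : IsBraidWeb _ _ ((web R m).cap 1)
  | id (X : Web R m) : IsStd R m X → IsBraidWeb X X (𝟙 X)
  | associator_hom (X Y Z : Web R m) : IsStd R m X → IsStd R m Y → IsStd R m Z →
      IsBraidWeb _ _ (α_ X Y Z).hom
  | associator_inv (X Y Z : Web R m) : IsStd R m X → IsStd R m Y → IsStd R m Z →
      IsBraidWeb _ _ (α_ X Y Z).inv
  | leftUnitor_hom (X : Web R m) : IsStd R m X → IsBraidWeb _ _ (λ_ X).hom
  | leftUnitor_inv (X : Web R m) : IsStd R m X → IsBraidWeb _ _ (λ_ X).inv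
  | rightUnitor_hom (X : Web R m) : IsStd R m X → IsBraidWeb _ _ (ρ_ X).hom
  | rightUnitor_inv (X : Web R m) : IsStd R m X → IsBraidWeb _ _ (ρ_ X).inv
  | comp {X Y Z : Web R m} (f : X ⟶ Y) (g : Y ⟶ Z) :
      IsBraidWeb X Y f → IsBraidWeb Y Z g → IsBraidWeb X Z (f ≫ g)
  | tensor {X Y X' Y' : Web R m} (f : X ⟶ Y) (g : X' ⟶ Y') :
      IsBraidWeb X Y f → IsBraidWeb X' Y' g → IsBraidWeb (X ⊗ X') (Y ⊗ Y') (f ⊗ₘ g)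
  | zero (X Y : Web R m) : IsStd R m X → IsStd R m Y → IsBraidWeb X Y 0
  | add {X Y : Web R m} (f g : X ⟶ Y) :
      IsBraidWeb X Y f → IsBraidWeb X Y g → IsBraidWeb X Y (f + g)
  | smul {X Y : Web R m} (r : R) (f : X ⟶ Y) : IsBraidWeb X Y f → IsBraidWeb X Y (r • f)

/-- The object `1` of the standard web category. -/
def stdOne : StdWeb R m := ⟨(web R m).obj 1, IsStd.one⟩

/-- The cup on `1` in the standard web category. -/
def stdCup : 𝟙_ (StdWeb R m) ⟶ stdOne R m ⊗ stdOne R m :=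
  ObjectProperty.homMk ((web R m).cup 1)

/-- The cap on `1` in the standard web category. -/
def stdCap : stdOne R m ⊗ stdOne R m ⟶ 𝟙_ (StdWeb R m) :=
  ObjectProperty.homMk ((web R m).cap 1)

/-- The braiding of `1` with itself in the standard web category. -/
noncomputable def stdBraiding : stdOne R m ⊗ stdOne R m ⟶ stdOne R m ⊗ stdOne R m :=
  ObjectProperty.homMk (webBraiding R m)

end Web

/-! ### The BMW category -/

/-- The generating object. -/
abbrev bulletWord : TensorWord Unit := .of ()

/-- Generating morphisms: a cup and a cap on the generating object, and a braiding
`X ⊗ Y → Y ⊗ X` with its inverse for all objects `X`, `Y`. -/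
inductive BMWGen : TensorWord Unit → TensorWord Unit → Type
  | cup : BMWGen .unit (bulletWord.tensor bulletWord)
  | cap : BMWGen (bulletWord.tensor bulletWord) .unit
  | braid (X Y : TensorWord Unit) : BMWGen (X.tensor Y) (Y.tensor X)
  | braidInv (X Y : TensorWord Unit) : BMWGen (Y.tensor X) (X.tensor Y)

section BMW

/-- The generating object, in any category presented by these generators. -/
def bullet (R : Type u) [CommRing R]
    (rel : ∀ X Y : TensorWord Unit, MorTerm R BMWGen X Y → MorTerm R BMWGen X Y → Prop) :
    Presented R BMWGen rel :=
  bulletWord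

/-- The cup. -/
def bmwCup (R : Type u) [CommRing R]
    (rel : ∀ X Y : TensorWord Unit, MorTerm R BMWGen X Y → MorTerm R BMWGen X Y → Prop) :
    𝟙_ (Presented R BMWGen rel) ⟶ bullet R rel ⊗ bullet R rel :=
  Presented.ofGen BMWGen.cup

/-- The cap. -/
def bmwCap (R : Type u) [CommRing R]
    (rel : ∀ X Y : TensorWord Unit, MorTerm R BMWGen X Y → MorTerm R BMWGen X Y → Prop) :
    bullet R rel ⊗ bullet R rel ⟶ 𝟙_ (Presented R BMWGen rel) :=
  Presented.ofGen BMWGen.cap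

/-- The braiding morphisms. -/
def bmwBraid {R : Type u} [CommRing R]
    {rel : ∀ X Y : TensorWord Unit, MorTerm R BMWGen X Y → MorTerm R BMWGen X Y → Prop}
    (X Y : Presented R BMWGen rel) : X ⊗ Y ⟶ Y ⊗ X :=
  Presented.ofGen (BMWGen.braid X Y)

/-- The inverse braiding morphisms. -/
def bmwBraidInv {R : Type u} [CommRing R]
    {rel : ∀ X Y : TensorWord Unit, MorTerm R BMWGen X Y → MorTerm R BMWGen X Y → Prop}
    (X Y : Presented R BMWGen rel) : Y ⊗ X ⟶ X ⊗ Y :=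
  Presented.ofGen (BMWGen.braidInv X Y)

variable (R : Type u) [CommRing R] [Algebra QRing R] (m : ℕ)

/-- The generating object in the free category. -/
abbrev freeBullet : FreeMon R BMWGen := bullet R _

/-- The defining relations of the BMW category: the axioms of a braided category, self-duality of
the generating object, its dimension, the skein relation and the value of a curl. The left and
right rotations of every generator agree as a consequence of the zigzag relations and the
naturality of the braiding, so that no further pivotality relation is needed. -/
inductive BMWRel : ∀ X Y : FreeMon R BMWGen, (X ⟶ Y) → (X ⟶ Y) → Prop
  -- the braiding is invertible, natural, and satisfies the hexagon axioms
  | braid_hom_inv (X Y : FreeMon R BMWGen) :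
      BMWRel _ _ (bmwBraid X Y ≫ bmwBraidInv X Y) (𝟙 _)
  | braid_inv_hom (X Y : FreeMon R BMWGen) :
      BMWRel _ _ (bmwBraidInv X Y ≫ bmwBraid X Y) (𝟙 _)
  | natural_right (X : FreeMon R BMWGen) {Y Z : FreeMon R BMWGen} (f : Y ⟶ Z) :
      BMWRel _ _ (X ◁ f ≫ bmwBraid X Z) (bmwBraid X Y ≫ f ▷ X)
  | natural_left {X Y : FreeMon R BMWGen} (f : X ⟶ Y) (Z : FreeMon R BMWGen) :
      BMWRel _ _ (f ▷ Z ≫ bmwBraid Y Z) (bmwBraid X Z ≫ Z ◁ f)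
  | hexagon_forward (X Y Z : FreeMon R BMWGen) :
      BMWRel _ _ ((α_ X Y Z).hom ≫ bmwBraid X (Y ⊗ Z) ≫ (α_ Y Z X).hom)
        (bmwBraid X Y ▷ Z ≫ (α_ Y X Z).hom ≫ Y ◁ bmwBraid X Z)
  | hexagon_reverse (X Y Z : FreeMon R BMWGen) :
      BMWRel _ _ ((α_ X Y Z).inv ≫ bmwBraid (X ⊗ Y) Z ≫ (α_ Z X Y).inv)
        (X ◁ bmwBraid Y Z ≫ (α_ X Z Y).inv ≫ bmwBraid X Z ▷ Y)
  -- the generating object is self-dual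
  | snakeLeft : BMWRel _ _ (snakeLeft (bmwCup R _) (bmwCap R _)) (𝟙 (freeBullet R))
  | snakeRight : BMWRel _ _ (snakeRight (bmwCup R _) (bmwCap R _)) (𝟙 (freeBullet R))
  -- its dimension
  | dimension :
      BMWRel _ _ (bmwCup R _ ≫ bmwCap R _) (algebraMap QRing R (circleCoeff m) • 𝟙 _)
  -- the skein relation
  | skein :
      BMWRel _ _
        (bmwBraid (freeBullet R) (freeBullet R) - bmwBraidInv (freeBullet R) (freeBullet R))
        (algebraMap QRing R skeinCoeff • (𝟙 _ - bmwCap R _ ≫ bmwCup R _))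
  -- the curl
  | curl :
      BMWRel _ _
        (closeRight (bmwCup R _) (bmwCap R _) (bmwBraid (freeBullet R) (freeBullet R)))
        (algebraMap QRing R ↑(qq ^ (2 * (m : ℤ) - 2)) • 𝟙 (freeBullet R))

/-- The BMW category over the `𝔸`-algebra `R`, with parameter `m`. -/
abbrev BMW : Type := FreeMonMod R BMWGen (BMWRel R m)

instance : BraidedCategory (BMW R m) where
  braiding X Y :=
    { hom := bmwBraid X Y
      inv := bmwBraidInv X Y
      hom_inv_id := Quot.sound (.rel _ _ (BMWRel.braid_hom_inv (R := R) (m := m) X Y))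
      inv_hom_id := Quot.sound (.rel _ _ (BMWRel.braid_inv_hom (R := R) (m := m) X Y)) }
  braiding_naturality_right := by
    rintro X Y Z ⟨f⟩
    exact Quot.sound (.rel _ _ (BMWRel.natural_right (R := R) (m := m) X (Quot.mk _ f)))
  braiding_naturality_left := by
    rintro X Y ⟨f⟩ Z
    exact Quot.sound (.rel _ _ (BMWRel.natural_left (R := R) (m := m) (Quot.mk _ f) Z))
  hexagon_forward X Y Z :=
    Quot.sound (.rel _ _ (BMWRel.hexagon_forward (R := R) (m := m) X Y Z))
  hexagon_reverse X Y Z :=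
    Quot.sound (.rel _ _ (BMWRel.hexagon_reverse (R := R) (m := m) X Y Z))

/-- The generating object of the BMW category. -/
abbrev bmwBullet : BMW R m := bullet R _

end BMW

/-! The proof has two halves, generation and braiding, both driven by the exchange relation (e)
after its H-diagrams are unbent into ladders.

Generation. The bigon value [2k]/[2] is a unit of 𝔸 because it does not vanish at q = 1. Hence a
strand labelled k is, up to an invertible scalar, a retract of k strands labelled 1, and any web can
be rewritten by inserting "split completely, merge completely" on each intermediate object. It then
suffices that every generator, conjugated by complete splits and merges, is a combination of
crossings, cups and caps. For the trivalent vertices this reduces to the projector "merge k strands,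
split again". The ladder form of (e), `WebAction.mL_sL`, expresses that projector recursively
through the dumbbell D and the cap-cup e (`WebAction.IsStdClass.P_I`), and D = q² - β - c e. Cups
and caps follow by nesting (`cu_I`, `P_ca`). The bookkeeping is `Regroup.Sees`, and the outcome is
`isBraidWeb_of_isStd`.

Braiding. The case k = 1 of (e) says that a quarter turn sends D to D + a(e - 1), while it exchanges
1 and e. Therefore a quarter turn sends the crossing q² - D - c e to q⁻² - D - c' e, which is its
inverse (`WebAction.rotL_br`, `WebAction.br_br`); this lets crossings pass over cups and caps.
Associativity of merges gives two ladder expressions for the projector on three strands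
(`WebAction.ladder_three`), and their equality is the Yang–Baxter equation once lower words are
reduced (`yangBaxter_of_ladder`).

By generation, naturality of a braiding need only be tested on the crossing, the cup and the cap.
The crossing extends over words to a half braiding on the object 1, and tensor products of half
braidings give the rest (`braidedOfHalfBraiding`). The BMW relations then hold in the standard web
category, and the resulting functor is full because the crossing, cup and cap generate. -/

/-! ### Webs acting on a category

A web category acts on itself by tensoring on the left. Replacing a morphism `f : X ⊗ Y ⟶ Z` by the
natural family `X ⊗ (Y ⊗ W) ⟶ Z ⊗ W` removes all associators from planar computations. -/

/-- Strands, cups, caps and trivalent vertices acting by endofunctors on a linear category, with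
circle value `δ`, bigon values `u` and exchange coefficients `a`, `b`. -/
structure WebAction (R : Type*) [CommRing R] (C : Type*) [Category C] [Preadditive C] [Linear R C]
    (δ : R) (u a b : ℕ → R) where
  A : ℕ → C ⥤ C
  additive (k : ℕ) : (A k).Additive
  linear (k : ℕ) : (A k).Linear R
  z (W : C) : (A 0).obj W ≅ W
  z_nat {W V : C} (f : W ⟶ V) : (A 0).map f ≫ (z V).hom = (z W).hom ≫ f
  cu (k : ℕ) (W : C) : W ⟶ (A k).obj ((A k).obj W)
  cu_nat (k : ℕ) {W V : C} (f : W ⟶ V) : f ≫ cu k V = cu k W ≫ (A k).map ((A k).map f)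
  ca (k : ℕ) (W : C) : (A k).obj ((A k).obj W) ⟶ W
  ca_nat (k : ℕ) {W V : C} (f : W ⟶ V) : (A k).map ((A k).map f) ≫ ca k V = ca k W ≫ f
  mL (k : ℕ) (W : C) : (A 1).obj ((A k).obj W) ⟶ (A (k + 1)).obj W
  mL_nat (k : ℕ) {W V : C} (f : W ⟶ V) :
    (A 1).map ((A k).map f) ≫ mL k V = mL k W ≫ (A (k + 1)).map f
  mR (k : ℕ) (W : C) : (A k).obj ((A 1).obj W) ⟶ (A (k + 1)).obj W
  mR_nat (k : ℕ) {W V : C} (f : W ⟶ V) :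
    (A k).map ((A 1).map f) ≫ mR k V = mR k W ≫ (A (k + 1)).map f
  sL (k : ℕ) (W : C) : (A (k + 1)).obj W ⟶ (A 1).obj ((A k).obj W)
  sL_nat (k : ℕ) {W V : C} (f : W ⟶ V) :
    (A (k + 1)).map f ≫ sL k V = sL k W ≫ (A 1).map ((A k).map f)
  sR (k : ℕ) (W : C) : (A (k + 1)).obj W ⟶ (A k).obj ((A 1).obj W)
  sR_nat (k : ℕ) {W V : C} (f : W ⟶ V) :
    (A (k + 1)).map f ≫ sR k V = sR k W ≫ (A k).map ((A 1).map f)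
  cu_zero (W : C) : cu 0 W = (z W).inv ≫ (z _).inv
  ca_zero (W : C) : ca 0 W = (z _).hom ≫ (z W).hom
  mL_zero (W : C) : mL 0 W = (A 1).map (z W).hom
  mR_zero (W : C) : mR 0 W = (z _).hom
  snakeL (k : ℕ) (W : C) : cu k ((A k).obj W) ≫ (A k).map (ca k W) = 𝟙 _
  snakeR (k : ℕ) (W : C) : (A k).map (cu k W) ≫ ca k ((A k).obj W) = 𝟙 _
  sL_left (k : ℕ) (W : C) :
    sL k W = cu 1 _ ≫ (A 1).map (cu k _) ≫ (A 1).map ((A k).map (mR k _)) ≫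
      (A 1).map ((A k).map (ca (k + 1) W))
  sL_right (k : ℕ) (W : C) :
    sL k W = (A (k + 1)).map (cu k W) ≫ (A (k + 1)).map ((A k).map (cu 1 _)) ≫
      (A (k + 1)).map (mR k _) ≫ ca (k + 1) _
  sR_left (k : ℕ) (W : C) :
    sR k W = cu k _ ≫ (A k).map (cu 1 _) ≫ (A k).map ((A 1).map (mL k _)) ≫
      (A k).map ((A 1).map (ca (k + 1) W))
  sR_right (k : ℕ) (W : C) :
    sR k W = (A (k + 1)).map (cu 1 W) ≫ (A (k + 1)).map ((A 1).map (cu k _)) ≫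
      (A (k + 1)).map (mL k _) ≫ ca (k + 1) _
  circle (W : C) : cu 1 W ≫ ca 1 W = δ • 𝟙 W
  lollipop (W : C) : sL 1 W ≫ ca 1 W = 0
  bigon (k : ℕ) (W : C) : sL k W ≫ mL k W = u k • 𝟙 _
  assoc (k : ℕ) (W : C) : (A 1).map (mR k W) ≫ mL (k + 1) W = mL k _ ≫ mR (k + 1) W
  exchange (j : ℕ) (W : C) :
    cu 1 _ ≫ (A 1).map (mL (j + 1) _) ≫ (A 1).map (sL (j + 1) _) ≫
        (A 1).map ((A 1).map (ca (j + 1) W)) =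
      (sL j _ ≫ (A 1).map ((A j).map (sR j W)) ≫ (A 1).map (ca j _)) ≫ mL 1 W ≫ sL 1 W
        - a j • (sL j _ ≫ (A 1).map ((A j).map (sR j W)) ≫ (A 1).map (ca j _))
        + b j • (ca (j + 1) W ≫ cu 1 W)

namespace WebAction

variable {R : Type*} [CommRing R] {C : Type*} [Category C] [Preadditive C] [Linear R C]
  {δ : R} {u a b : ℕ → R} (E : WebAction R C δ u a b)

attribute [instance] additive linear

local notation:max k:max " ◂ " f:max => CategoryTheory.Functor.map (WebAction.A E k) f

theorem z_nat_assoc {W V Z : C} (f : W ⟶ V) (h : V ⟶ Z) :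
    0 ◂ f ≫ (E.z V).hom ≫ h = (E.z W).hom ≫ f ≫ h := by
  simpa only [Category.assoc] using eq_whisker (E.z_nat f) h

theorem cu_nat_assoc (k : ℕ) {W V Z : C} (f : W ⟶ V) (h : (E.A k).obj ((E.A k).obj V) ⟶ Z) :
    f ≫ E.cu k V ≫ h = E.cu k W ≫ k ◂ (k ◂ f) ≫ h := by
  simpa only [Category.assoc] using eq_whisker (E.cu_nat k f) h

theorem ca_nat_assoc (k : ℕ) {W V Z : C} (f : W ⟶ V) (h : V ⟶ Z) :
    k ◂ (k ◂ f) ≫ E.ca k V ≫ h = E.ca k W ≫ f ≫ h := by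
  simpa only [Category.assoc] using eq_whisker (E.ca_nat k f) h

theorem mL_nat_assoc (k : ℕ) {W V Z : C} (f : W ⟶ V) (h : (E.A (k + 1)).obj V ⟶ Z) :
    1 ◂ (k ◂ f) ≫ E.mL k V ≫ h = E.mL k W ≫ (k + 1) ◂ f ≫ h := by
  simpa only [Category.assoc] using eq_whisker (E.mL_nat k f) h

theorem mR_nat_assoc (k : ℕ) {W V Z : C} (f : W ⟶ V) (h : (E.A (k + 1)).obj V ⟶ Z) :
    k ◂ (1 ◂ f) ≫ E.mR k V ≫ h = E.mR k W ≫ (k + 1) ◂ f ≫ h := by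
  simpa only [Category.assoc] using eq_whisker (E.mR_nat k f) h

theorem sL_nat_assoc (k : ℕ) {W V Z : C} (f : W ⟶ V) (h : (E.A 1).obj ((E.A k).obj V) ⟶ Z) :
    (k + 1) ◂ f ≫ E.sL k V ≫ h = E.sL k W ≫ 1 ◂ (k ◂ f) ≫ h := by
  simpa only [Category.assoc] using eq_whisker (E.sL_nat k f) h

theorem sR_nat_assoc (k : ℕ) {W V Z : C} (f : W ⟶ V) (h : (E.A k).obj ((E.A 1).obj V) ⟶ Z) :
    (k + 1) ◂ f ≫ E.sR k V ≫ h = E.sR k W ≫ k ◂ (1 ◂ f) ≫ h := by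
  simpa only [Category.assoc] using eq_whisker (E.sR_nat k f) h

theorem snakeL_assoc (k : ℕ) {W Z : C} (h : (E.A k).obj W ⟶ Z) :
    E.cu k _ ≫ k ◂ (E.ca k W) ≫ h = h := by
  simpa only [Category.assoc, Category.id_comp] using eq_whisker (E.snakeL k W) h

theorem snakeR_assoc (k : ℕ) {W Z : C} (h : (E.A k).obj W ⟶ Z) :
    k ◂ (E.cu k W) ≫ E.ca k _ ≫ h = h := by
  simpa only [Category.assoc, Category.id_comp] using eq_whisker (E.snakeR k W) h

theorem bigon_assoc (k : ℕ) {W Z : C} (h : (E.A (k + 1)).obj W ⟶ Z) :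
    E.sL k W ≫ E.mL k W ≫ h = (u k • 𝟙 _) ≫ h := by
  simpa only [Category.assoc] using eq_whisker (E.bigon k W) h

/-- The snakes make `E.A k` adjoint to itself, with unit `cu` and counit `ca`. This and `cu_map_ca`
say that transposing twice does nothing. -/
theorem map_cu_ca (k : ℕ) {V W : C} (g : (E.A k).obj V ⟶ W) :
    k ◂ (E.cu k V ≫ k ◂ g) ≫ E.ca k W = g := by
  rw [Functor.map_comp, Category.assoc, E.ca_nat, E.snakeR_assoc]

theorem cu_map_ca (k : ℕ) {V W : C} (g : V ⟶ (E.A k).obj W) :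
    E.cu k V ≫ k ◂ (k ◂ g ≫ E.ca k W) = g := by
  rw [Functor.map_comp, ← E.cu_nat_assoc, E.snakeL, Category.comp_id]

/-! #### Bending the legs of a splitting vertex -/

/-- In its left form the split contains a cap labelled k + 1, which the cup cancels by a snake; only
the merge with bent legs survives. -/
theorem cu_sL (k : ℕ) (W : C) :
    E.cu (k + 1) W ≫ E.sL k _ = E.cu 1 W ≫ 1 ◂ (E.cu k _) ≫ 1 ◂ (k ◂ (E.mR k W)) := by
  rw [sL_left, E.cu_nat_assoc]
  simp only [← Functor.map_comp]
  rw [E.cu_nat_assoc]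
  simp only [← Functor.map_comp]
  rw [E.mR_nat_assoc, E.snakeR, Category.comp_id]

theorem cu_sL_assoc (k : ℕ) {W Z : C}
    (h : (E.A 1).obj ((E.A k).obj ((E.A (k + 1)).obj W)) ⟶ Z) :
    E.cu (k + 1) W ≫ E.sL k _ ≫ h =
      E.cu 1 W ≫ 1 ◂ (E.cu k _) ≫ 1 ◂ (k ◂ (E.mR k W)) ≫ h := by
  simpa only [Category.assoc] using eq_whisker (E.cu_sL k W) h

/-- The split now sits on the other leg of the cup, so its right form is needed. That one split has
both forms is where pivotality enters. -/
theorem cu_map_sL (k : ℕ) (W : C) :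
    E.cu (k + 1) W ≫ (k + 1) ◂ (E.sL k W) = E.cu k W ≫ k ◂ (E.cu 1 _) ≫ E.mR k _ := by
  rw [sL_right]
  simp only [Functor.map_comp, ← E.cu_nat_assoc]
  rw [E.snakeL, Category.comp_id]

theorem cu_map_sL_assoc (k : ℕ) {W Z : C}
    (h : (E.A (k + 1)).obj ((E.A 1).obj ((E.A k).obj W)) ⟶ Z) :
    E.cu (k + 1) W ≫ (k + 1) ◂ (E.sL k W) ≫ h =
      E.cu k W ≫ k ◂ (E.cu 1 _) ≫ E.mR k _ ≫ h := by
  simpa only [Category.assoc] using eq_whisker (E.cu_map_sL k W) h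

theorem cu_sR (k : ℕ) (W : C) :
    E.cu (k + 1) W ≫ E.sR k _ = E.cu k W ≫ k ◂ (E.cu 1 _) ≫ k ◂ (1 ◂ (E.mL k W)) := by
  rw [sR_left, E.cu_nat_assoc]
  simp only [← Functor.map_comp]
  rw [E.cu_nat_assoc]
  simp only [← Functor.map_comp]
  rw [E.mL_nat_assoc, E.snakeR, Category.comp_id]

theorem cu_sR_assoc (k : ℕ) {W Z : C}
    (h : (E.A k).obj ((E.A 1).obj ((E.A (k + 1)).obj W)) ⟶ Z) :
    E.cu (k + 1) W ≫ E.sR k _ ≫ h =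
      E.cu k W ≫ k ◂ (E.cu 1 _) ≫ k ◂ (1 ◂ (E.mL k W)) ≫ h := by
  simpa only [Category.assoc] using eq_whisker (E.cu_sR k W) h

/-- Writing the split in its right form, its two bent legs meet the caps labelled k and 1 and
straighten. -/
theorem map_mR_ca (k : ℕ) (W : C) :
    (k + 1) ◂ (E.mR k W) ≫ E.ca (k + 1) W = E.sL k _ ≫ 1 ◂ (E.ca k _) ≫ E.ca 1 W := by
  symm
  rw [sL_right]
  simp only [Category.assoc]
  rw [← E.ca_nat_assoc, ← E.ca_nat]
  simp only [← Category.assoc]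
  congr 1
  simp only [← Functor.map_comp, Category.assoc]
  congr 1
  rw [← E.mR_nat]
  simp only [← Functor.map_comp_assoc]
  rw [E.cu_map_ca, E.snakeL_assoc]

theorem mL_ca (k : ℕ) (W : C) :
    E.mL k _ ≫ E.ca (k + 1) W = 1 ◂ (k ◂ (E.sR k W)) ≫ 1 ◂ (E.ca k _) ≫ E.ca 1 W := by
  rw [sR_left]
  simp only [← Functor.map_comp, ← Functor.map_comp_assoc]
  rw [E.map_cu_ca, E.map_cu_ca]

/-! #### Endomorphisms of two strands and their rotations -/

/-- Merge and split. -/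
def D (W : C) : (E.A 1).obj ((E.A 1).obj W) ⟶ (E.A 1).obj ((E.A 1).obj W) :=
  E.mL 1 W ≫ E.sL 1 W

/-- Cap followed by cup. -/
def e (W : C) : (E.A 1).obj ((E.A 1).obj W) ⟶ (E.A 1).obj ((E.A 1).obj W) :=
  E.ca 1 W ≫ E.cu 1 W

/-- Families of endomorphisms of two strands. -/
abbrev Fam := ∀ W : C, (E.A 1).obj ((E.A 1).obj W) ⟶ (E.A 1).obj ((E.A 1).obj W)

/-- Naturality of a family of endomorphisms. -/
def IsNat (X : E.Fam) : Prop :=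
  ∀ {W V : C} (f : W ⟶ V), 1 ◂ (1 ◂ f) ≫ X V = X W ≫ 1 ◂ (1 ◂ f)

variable {E}

theorem IsNat.eq {X : E.Fam} (hX : E.IsNat X) {W V : C} (f : W ⟶ V) :
    1 ◂ (1 ◂ f) ≫ X V = X W ≫ 1 ◂ (1 ◂ f) := hX f

theorem IsNat.eq_assoc {X : E.Fam} (hX : E.IsNat X) {W V Z : C} (f : W ⟶ V) (h : _ ⟶ Z) :
    1 ◂ (1 ◂ f) ≫ X V ≫ h = X W ≫ 1 ◂ (1 ◂ f) ≫ h := by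
  rw [← Category.assoc, hX f, Category.assoc]

variable (E)

theorem isNat_D : E.IsNat E.D := fun f => by simp [D, E.mL_nat_assoc, E.sL_nat]

theorem isNat_e : E.IsNat E.e := fun f => by
  rw [e, E.ca_nat_assoc, E.cu_nat, e, Category.assoc]

theorem isNat_one : E.IsNat (fun _ => 𝟙 _) := fun f => by simp

/-- Quarter rotation, bending around the right. -/
def rotR (X : E.Fam) : E.Fam := fun V => 1 ◂ (1 ◂ (E.cu 1 V)) ≫ 1 ◂ (X _) ≫ E.ca 1 _

/-- Quarter rotation, bending around the left. -/
def rotL (X : E.Fam) : E.Fam := fun V => E.cu 1 _ ≫ 1 ◂ (X _) ≫ 1 ◂ (1 ◂ (E.ca 1 V))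

theorem rotR_one (W : C) : E.rotR (fun _ => 𝟙 _) W = E.e W := by
  simp [rotR, e, E.ca_nat]

theorem rotL_one (W : C) : E.rotL (fun _ => 𝟙 _) W = E.e W := by
  simp [rotL, e, E.cu_nat]

theorem isNat_rotR {X : E.Fam} (hX : E.IsNat X) : E.IsNat (E.rotR X) := fun f => by
  simp only [rotR, Category.assoc, ← E.ca_nat]
  simp only [← Functor.map_comp_assoc]
  rw [← hX.eq, E.cu_nat]
  simp only [Functor.map_comp, Category.assoc]

/-! #### The exchange relation, unbent -/

/-- The diagram `k ⊗ k ⟶ 1 ⊗ 1` in the shape of the letter H with bar `k - 1`. -/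
def hD (j : ℕ) (W : C) :
    (E.A (j + 1)).obj ((E.A (j + 1)).obj W) ⟶ (E.A 1).obj ((E.A 1).obj W) :=
  E.sL j _ ≫ 1 ◂ (j ◂ (E.sR j W)) ≫ 1 ◂ (E.ca j _)

/-- The diagram `k ⊗ k ⟶ 1 ⊗ 1` in the shape of the letter H with bar `k + 1`. -/
def hU (k : ℕ) (W : C) : (E.A k).obj ((E.A k).obj W) ⟶ (E.A 1).obj ((E.A 1).obj W) :=
  E.cu 1 _ ≫ 1 ◂ (E.mL k _) ≫ 1 ◂ (E.sL k _) ≫ 1 ◂ (1 ◂ (E.ca k W))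

theorem hU_eq (j : ℕ) (W : C) : E.hU (j + 1) W =
    E.hD j W ≫ E.D W - a j • E.hD j W + b j • (E.ca (j + 1) W ≫ E.cu 1 W) :=
  E.exchange j W

/-- Unbending an H to a ladder `1 ⊗ k ⟶ 1 ⊗ k`. -/
def unR (k : ℕ) (W : C)
    (h : (E.A k).obj ((E.A k).obj ((E.A k).obj W)) ⟶ (E.A 1).obj ((E.A 1).obj ((E.A k).obj W))) :
    (E.A 1).obj ((E.A k).obj W) ⟶ (E.A 1).obj ((E.A k).obj W) :=
  1 ◂ (k ◂ (E.cu k W)) ≫ 1 ◂ h ≫ E.ca 1 _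

/-- Unbending an H to a ladder `k ⊗ 1 ⟶ k ⊗ 1`. -/
def unL (k : ℕ) (W : C)
    (h : (E.A k).obj ((E.A k).obj ((E.A 1).obj W)) ⟶ (E.A 1).obj ((E.A 1).obj ((E.A 1).obj W))) :
    (E.A k).obj ((E.A 1).obj W) ⟶ (E.A k).obj ((E.A 1).obj W) :=
  E.cu k _ ≫ k ◂ h ≫ k ◂ (1 ◂ (E.ca 1 W))

/-- Two snakes, one labelled 1 and one labelled k, straighten the sides of the H, leaving its bar as
the rung. -/
theorem unR_hU (k : ℕ) (W : C) : E.unR k W (E.hU k _) = E.mL k W ≫ E.sL k W := by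
  simp only [unR, hU, Functor.map_comp, Category.assoc]
  rw [E.ca_nat, E.ca_nat_assoc, E.ca_nat_assoc, E.snakeR_assoc, E.mL_nat_assoc, E.sL_nat_assoc,
    ← Functor.map_comp, E.snakeR, CategoryTheory.Functor.map_id, Category.comp_id]

theorem unR_cup (k : ℕ) (W : C) : E.unR k W (E.ca k _ ≫ E.cu 1 _) = 𝟙 _ := by
  simp only [unR, Functor.map_comp, Category.assoc]
  rw [E.snakeR, ← Functor.map_comp_assoc, E.snakeR]
  simp

/-- Bending turns the right-hand split into a merge (`cu_sR`), and the endomorphism sitting on the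
two top ends is carried along by a quarter turn. -/
theorem unR_hD (j : ℕ) (W : C) {X : E.Fam} (hX : E.IsNat X) :
    E.unR (j + 1) W (E.hD j _ ≫ X _) =
      1 ◂ (E.sL j W) ≫ E.rotR X _ ≫ 1 ◂ (E.mL j W) := by
  simp only [unR, hD, rotR, Functor.map_comp, Category.assoc]
  rw [← E.ca_nat]
  simp only [← Functor.map_comp_assoc]
  congr 2
  rw [← hX.eq, E.sL_nat_assoc]
  congr 1
  simp only [← Functor.map_comp_assoc]
  congr 2
  rw [E.cu_sR, ← Functor.map_comp, E.map_cu_ca]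

theorem unL_hU (k : ℕ) (W : C) : E.unL k W (E.hU k _) = E.mR k W ≫ E.sR k W := by
  simp only [unL, hU, sR_left, Functor.map_comp, Category.assoc]
  rw [E.cu_nat_assoc]
  simp only [← Functor.map_comp]
  congr 2
  rw [E.cu_nat_assoc]
  simp only [← Functor.map_comp]
  rw [E.mL_nat_assoc, E.map_mR_ca]

theorem unL_cup (k : ℕ) (W : C) : E.unL k W (E.ca k _ ≫ E.cu 1 _) = 𝟙 _ := by
  simp only [unL, Functor.map_comp, Category.assoc]
  rw [E.snakeL_assoc, ← Functor.map_comp, E.snakeL]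
  simp

/-- The mirror image: here the left-hand split is the one that becomes a merge (`cu_map_sL`). -/
theorem unL_hD (j : ℕ) (W : C) (X : E.Fam) :
    E.unL (j + 1) W (E.hD j _ ≫ X _) =
      E.sR j _ ≫ j ◂ (E.rotL X W) ≫ E.mR j _ := by
  simp only [unL, hD, rotL, Functor.map_comp, Category.assoc]
  rw [E.cu_map_sL_assoc]
  simp only [← Functor.map_comp, ← E.mR_nat]
  simp only [← Functor.map_comp, ← Category.assoc]
  congr 1
  simp only [Category.assoc]
  rw [(E.A 1).map_comp ((E.A 1).map _), ← E.cu_nat_assoc, Category.assoc, ← Category.assoc,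
    (E.A j).map_comp (_ ≫ _), ← Category.assoc, E.cu_map_ca]

/-- The ladder `1 ⊗ k ⟶ 1 ⊗ k` with rung `k + 1`. -/
theorem mL_sL (j : ℕ) (W : C) : E.mL (j + 1) W ≫ E.sL (j + 1) W =
    1 ◂ (E.sL j W) ≫ (E.rotR E.D _ - a j • E.e _) ≫ 1 ◂ (E.mL j W) + b j • 𝟙 _ := by
  have h1 := E.unR_hD j W E.isNat_D
  have h2 := E.unR_hD j W E.isNat_one
  have h3 := E.unR_cup (j + 1) W
  -- Unbending is linear, so the exchange relation is transported term by term: its three terms give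
  -- the rotated dumbbell, the rotated identity (which is e) and the identity.
  rw [← unR_hU, hU_eq]
  rw [rotR_one, Category.comp_id] at h2
  rw [Preadditive.sub_comp, Preadditive.comp_sub, ← h1, Linear.smul_comp, Linear.comp_smul, ← h2,
    ← h3]
  simp [unR]

/-- The ladder `k ⊗ 1 ⟶ k ⊗ 1` with rung `k + 1`. -/
theorem mR_sR (j : ℕ) (W : C) : E.mR (j + 1) W ≫ E.sR (j + 1) W =
    E.sR j _ ≫ j ◂ (E.rotL E.D _ - a j • E.e _) ≫ E.mR j _ + b j • 𝟙 _ := by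
  have h1 := E.unL_hD j W E.D
  have h2 := E.unL_hD j W (fun _ => 𝟙 _)
  have h3 := E.unL_cup (j + 1) W
  rw [← unL_hU, hU_eq]
  rw [rotL_one, Category.comp_id] at h2
  rw [Functor.map_sub, Preadditive.sub_comp, Preadditive.comp_sub, ← h1, Functor.map_smul,
    Linear.smul_comp, Linear.comp_smul, ← h2, ← h3]
  simp [unL]

/-! #### Rotating the dumbbell -/

/-- Associativity with a middle strand labelled 0: the inner vertices are the same invertible
erasure, which cancels. -/
theorem mL_one (W : C) : E.mL 1 W = E.mR 1 W := by
  have := E.assoc 0 W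
  rw [mR_zero, mL_zero] at this
  exact (cancel_epi _).1 this

theorem sL_one (W : C) : E.sL 1 W = E.sR 1 W := by
  rw [sL_left, sR_left]
  simp only [mL_one]

theorem z_inv_nat {W V : C} (f : W ⟶ V) : f ≫ (E.z V).inv = (E.z W).inv ≫ 0 ◂ f := by
  rw [Iso.comp_inv_eq, Category.assoc, E.z_nat, Iso.inv_hom_id_assoc]

theorem cu_zero' (W : C) : E.cu 0 W = (E.z W).inv ≫ 0 ◂ (E.z W).inv := by
  rw [cu_zero, z_inv_nat]

theorem sL_zero (W : C) : E.sL 0 W = 1 ◂ (E.z W).inv := by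
  rw [sL_left, cu_zero', mR_zero]
  simp only [← Functor.map_comp, Category.assoc, Iso.inv_hom_id_assoc]
  rw [← E.z_inv_nat, Functor.map_comp, ← Category.assoc, E.snakeL, Category.id_comp]

theorem sR_zero (W : C) : E.sR 0 W = (E.z _).inv := by
  rw [sR_left, cu_zero', mL_zero]
  simp only [← Functor.map_comp, Category.assoc]
  rw [E.cu_map_ca, Iso.inv_hom_id, CategoryTheory.Functor.map_id, Category.comp_id]

/-- The rotation of the dumbbell. -/
def D' (W : C) : (E.A 1).obj ((E.A 1).obj W) ⟶ (E.A 1).obj ((E.A 1).obj W) :=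
  E.D W + a 0 • E.e W - b 0 • 𝟙 _

/-- This is the ladder for k = 1. Its outer vertices involve a strand labelled 0 and disappear, so
it reads D = rot(D) - a₀ e + b₀. -/
theorem rotR_D (W : C) : E.rotR E.D W = E.D' W := by
  have h := E.mL_sL 0 W
  have h1 := E.isNat_rotR E.isNat_D (E.z W).inv
  have h2 := E.isNat_e (E.z W).inv
  rw [sL_zero, mL_zero, Preadditive.sub_comp, Preadditive.comp_sub, reassoc_of% h1,
    Linear.smul_comp, Linear.comp_smul, reassoc_of% h2] at h
  simp only [← Functor.map_comp, Iso.inv_hom_id, CategoryTheory.Functor.map_id,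
    Category.comp_id] at h
  rw [D', D, h]
  abel

theorem rotL_D (W : C) : E.rotL E.D W = E.D' W := by
  have h := E.mR_sR 0 W
  rw [sR_zero, mR_zero, E.z_nat] at h
  rw [D', D, mL_one, sL_one, h, Iso.inv_hom_id_assoc]
  abel

/-! #### The two expressions of the projector on three strands -/

/-- Bending the strand labelled 3 with a cup turns both sides into composites of merges, equal by
`assoc`; a snake then undoes the bending. -/
theorem coassoc (W : C) : E.sL 2 W ≫ 1 ◂ (E.sL 1 W) = E.sR 2 W ≫ E.sL 1 _ := by
  have key (V : C) : E.cu 3 V ≫ E.sL 2 _ ≫ 1 ◂ (E.sL 1 _) = E.cu 3 V ≫ E.sR 2 _ ≫ E.sL 1 _ := by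
    rw [E.cu_sL_assoc 2, E.cu_sR_assoc 2]
    simp only [← Functor.map_comp, ← Functor.map_comp_assoc]
    rw [E.sL_nat, E.sL_nat, E.cu_sL_assoc 1, E.cu_sL_assoc 1]
    simp only [← Functor.map_comp]
    rw [E.cu_nat_assoc 1 (E.mR 1 V), ← Functor.map_comp, E.assoc 1 V, mL_one]
  have h (V : C) : E.sL 2 V ≫ 1 ◂ (E.sL 1 V) = E.cu 3 _ ≫ E.sL 2 _ ≫ 1 ◂ (E.sL 1 _) ≫
      1 ◂ (1 ◂ (1 ◂ (E.ca 3 V))) := by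
    rw [← Functor.map_comp, ← E.sL_nat, Functor.map_comp, ← E.sL_nat_assoc, E.snakeL_assoc]
  rw [h, ← Category.assoc (E.sL 2 _), ← Category.assoc (E.cu 3 _), key, Category.assoc,
    Category.assoc, ← E.sL_nat, ← E.sR_nat_assoc, E.snakeL_assoc]

/-- Merging three strands into one labelled 3 and splitting again can be bracketed from either side.
The k = 2 ladder applied in the middle of each bracketing gives the two sides. This cubic relation
is the source of the Yang–Baxter equation. -/
theorem ladder_three (W : C) :
    1 ◂ (E.D W) ≫ (E.D' _ - a 1 • E.e _) ≫ 1 ◂ (E.D W) + b 1 • 1 ◂ (E.D W) =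
      E.D _ ≫ 1 ◂ (E.D' W - a 1 • E.e W) ≫ E.D _ + b 1 • E.D _ := by
  have h : (1 ◂ (E.mL 1 W) ≫ E.mL 2 W) ≫ E.sL 2 W ≫ 1 ◂ (E.sL 1 W) =
      (E.mL 1 _ ≫ E.mR 2 W) ≫ E.sR 2 W ≫ E.sL 1 _ := by
    rw [coassoc, ← E.assoc, mL_one]
  have h1 := E.mL_sL 1 W
  have h2 := E.mR_sR 1 W
  rw [Category.assoc, Category.assoc, reassoc_of% h1, reassoc_of% h2, rotR_D, rotL_D] at h
  rw [← mL_one, ← sL_one] at h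
  simp only [D, Functor.map_comp, Category.assoc]
  simpa using h

/-! #### Sliding through cups and caps -/

variable {E}

/-- Each of the four slides moves an endomorphism to the other side of a cup or cap at the price of
a quarter turn; snakes absorb the bent strands. -/
theorem cu_slide {X : E.Fam} (hX : E.IsNat X) (W : C) :
    E.cu 1 _ ≫ 1 ◂ (X W) = 1 ◂ (E.cu 1 W) ≫ E.rotL X _ := by
  rw [rotL, E.cu_nat_assoc]
  simp only [← Functor.map_comp]
  rw [hX.eq_assoc, ← Functor.map_comp, E.snakeR]
  simp

theorem map_cu_slide (X : E.Fam) (W : C) :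
    1 ◂ (E.cu 1 W) ≫ X _ = E.cu 1 _ ≫ 1 ◂ (E.rotR X W) := by
  rw [rotR]
  simp only [← Functor.map_comp_assoc]
  rw [E.cu_map_ca]

theorem map_ca_slide (X : E.Fam) (W : C) :
    X _ ≫ 1 ◂ (E.ca 1 W) = 1 ◂ (E.rotL X W) ≫ E.ca 1 _ := by
  rw [rotL]
  simp only [← Functor.map_comp]
  rw [E.map_cu_ca]

theorem ca_slide {X : E.Fam} (hX : E.IsNat X) (W : C) :
    1 ◂ (X W) ≫ E.ca 1 _ = E.rotR X _ ≫ 1 ◂ (E.ca 1 W) := by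
  rw [rotR]
  simp only [Category.assoc]
  rw [← E.ca_nat]
  simp only [← Functor.map_comp_assoc]
  rw [← hX.eq, ← Functor.map_comp_assoc, E.snakeL]
  simp

/-! ### Quadratic relations between the dumbbell and the cap-cup -/

variable (E)

theorem D_sq (W : C) : E.D W ≫ E.D W = u 1 • E.D W := by
  simp [D, E.bigon_assoc]

theorem D_ca (W : C) : E.D W ≫ E.ca 1 W = 0 := by
  simp [D, E.lollipop]

/-- The lollipop upside down: capping off the strand labelled 2 turns the merge into a split, the
lollipop relation applies, and a snake restores the strand. -/
theorem cu_mL (W : C) : E.cu 1 W ≫ E.mL 1 W = 0 := by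
  have h (V : C) : E.cu 1 _ ≫ E.mL 1 _ ≫ E.ca 2 V = 0 := by
    rw [E.mL_ca 1, ← E.cu_nat_assoc, E.snakeL_assoc, ← sL_one, E.lollipop]
  rw [← Category.comp_id (E.mL 1 W), ← E.snakeR 2, ← E.mL_nat_assoc, ← E.cu_nat_assoc, h]
  simp

theorem cu_D (W : C) : E.cu 1 W ≫ E.D W = 0 := by
  rw [D, ← Category.assoc, cu_mL, Limits.zero_comp]

theorem e_sq (W : C) : E.e W ≫ E.e W = δ • E.e W := by
  have h := E.circle W
  simp only [e, Category.assoc]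
  rw [reassoc_of% h]
  simp

end WebAction

/-! ### The Yang-Baxter equation in an algebra -/

/-- The indices 1 and 2 stand for adjacent pairs of strands. The slides `s₁` to `s₄` reduce words
containing some eᵢ to a short list, and `hl` controls the difference of D₂D₁D₂ and D₁D₂D₁. The
coefficients that then remain vanish by the scalar identities. -/
theorem yangBaxter_of_ladder {R : Type*} [CommRing R] {B : Type*} [Ring B] [Algebra R B]
    {D₁ D₂ e₁ e₂ : B} {q q' a a' b c c' t δ : R}
    (hD₁ : D₁ * D₁ = t • D₁) (hD₂ : D₂ * D₂ = t • D₂)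
    (hDe₁ : D₁ * e₁ = 0) (heD₁ : e₁ * D₁ = 0) (hDe₂ : D₂ * e₂ = 0) (heD₂ : e₂ * D₂ = 0)
    (he₁ : e₁ * e₁ = δ • e₁) (he₂ : e₂ * e₂ = δ • e₂)
    (h121 : e₁ * e₂ * e₁ = e₁) (h212 : e₂ * e₁ * e₂ = e₂)
    (s₁ : e₁ * D₂ = e₁ * e₂ * (D₁ + a • e₁ - a • 1))
    (s₂ : e₂ * D₁ = e₂ * e₁ * (D₂ + a • e₂ - a • 1))
    (s₃ : D₁ * e₂ = (D₂ + a • e₂ - a • 1) * (e₁ * e₂))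
    (s₄ : D₂ * e₁ = (D₁ + a • e₁ - a • 1) * (e₂ * e₁))
    (hl : D₂ * (D₁ + a • e₁ - a • 1 - a' • e₁) * D₂ + b • D₂ =
      D₁ * (D₂ + a • e₂ - a • 1 - a' • e₂) * D₁ + b • D₁)
    (hq : q * q' = 1) (ht : t = q + q') (hb : b - a * t = -1) (hac : q' = a - c)
    (haq : c' = a - q) (hcc : c * c' = a * (a - a')) (hδ : q * c' + q' * c = c * c' * δ) :
    (q • 1 - D₁ - c • e₁) * (q • 1 - D₂ - c • e₂) * (q • 1 - D₁ - c • e₁) =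
      (q • 1 - D₂ - c • e₂) * (q • 1 - D₁ - c • e₁) * (q • 1 - D₂ - c • e₂) := by
  have r₄ : D₁ * e₂ * e₁ = D₂ * e₁ - a • e₁ + a • (e₂ * e₁) := by
    rw [s₄, sub_mul, add_mul, ← mul_assoc, smul_mul_assoc, ← mul_assoc, h121, smul_mul_assoc,
      one_mul]
    abel
  have r₁ : e₁ * e₂ * D₁ = e₁ * D₂ - a • e₁ + a • (e₁ * e₂) := by
    rw [s₁, mul_sub, mul_add, mul_smul_comm, h121, mul_smul_comm, mul_one]
    abel
  have r₃ : D₂ * e₁ * e₂ = D₁ * e₂ - a • e₂ + a • (e₁ * e₂) := by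
    rw [s₃, sub_mul, add_mul, ← mul_assoc, smul_mul_assoc, ← mul_assoc, h212, smul_mul_assoc,
      one_mul]
    abel
  have r₂ : e₂ * e₁ * D₂ = e₂ * D₁ - a • e₂ + a • (e₂ * e₁) := by
    rw [s₂, mul_sub, mul_add, mul_smul_comm, h212, mul_smul_comm, mul_one]
    abel
  have f₁ : D₁ * D₂ * e₁ = (t - a) • (D₁ * e₂ * e₁) := by
    rw [mul_assoc, s₄, mul_assoc D₁ e₂, ← mul_assoc, mul_sub, mul_add, hD₁, mul_smul_comm, hDe₁,
      mul_smul_comm, mul_one, smul_zero, add_zero, ← sub_smul, smul_mul_assoc]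
  have f₂ : D₂ * D₁ * e₂ = (t - a) • (D₂ * e₁ * e₂) := by
    rw [mul_assoc, s₃, mul_assoc D₂ e₁, ← mul_assoc, mul_sub, mul_add, hD₂, mul_smul_comm, hDe₂,
      mul_smul_comm, mul_one, smul_zero, add_zero, ← sub_smul, smul_mul_assoc]
  have g₁ : e₁ * D₂ * D₁ = (t - a) • (e₁ * e₂ * D₁) := by
    rw [s₁, mul_assoc, sub_mul, add_mul, hD₁, smul_mul_assoc, heD₁, smul_mul_assoc, one_mul,
      smul_zero, add_zero, ← sub_smul, mul_smul_comm]
  have g₂ : e₂ * D₁ * D₂ = (t - a) • (e₂ * e₁ * D₂) := by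
    rw [s₂, mul_assoc, sub_mul, add_mul, hD₂, smul_mul_assoc, heD₂, smul_mul_assoc, one_mul,
      smul_zero, add_zero, ← sub_smul, mul_smul_comm]
  have k₁ : e₁ * D₂ * e₁ = (a * δ - a) • e₁ := by
    rw [s₁, mul_assoc, sub_mul, add_mul, hDe₁, smul_mul_assoc, he₁, smul_mul_assoc, one_mul,
      zero_add, smul_smul, ← sub_smul, mul_smul_comm, h121]
  have k₂ : e₂ * D₁ * e₂ = (a * δ - a) • e₂ := by
    rw [s₂, mul_assoc, sub_mul, add_mul, hDe₂, smul_mul_assoc, he₂, smul_mul_assoc, one_mul,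
      zero_add, smul_smul, ← sub_smul, mul_smul_comm, h212]
  -- The two words of shape DeD are not independent; this eliminates one in favour of the other.
  have l : D₂ * e₁ * D₂ = D₁ * e₂ * D₁ - a • (D₁ * e₂) + a • (D₁ * e₂ * e₁) + a • (e₁ * D₂)
      - a • (e₂ * e₁ * D₂) := by
    rw [s₄, mul_assoc, sub_mul, add_mul, r₂]
    simp only [mul_add, mul_sub, ← mul_assoc, mul_smul_comm, smul_mul_assoc, h121, one_mul,
      smul_add, smul_sub, s₁, mul_one]
    module
  obtain rfl : b = a * t - 1 := by linear_combination hb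
  subst ht haq hac
  simp only [mul_add, mul_sub, add_mul, sub_mul, smul_mul_assoc, mul_smul_comm, mul_one, one_mul,
    h121, h212, smul_add, smul_sub, hD₁, hD₂, hDe₁, hDe₂, heD₁, heD₂, he₁, he₂, f₁, f₂,
    g₁, g₂, k₁, k₂, l, r₁, r₂, r₃, r₄, smul_zero, sub_zero] at hl ⊢
  -- Subtracting the ladder relation once cancels the words D₁D₂D₁ and D₂D₁D₂; afterwards
  -- coefficients are compared word by word.
  linear_combination (norm := skip) hl
  clear hl l f₁ f₂ g₁ g₂ k₁ k₂ r₁ r₂ r₃ r₄ s₁ s₂ s₃ s₄ hD₁ hD₂ he₁ he₂ h121 h212 hDe₁ hDe₂ heD₁ heD₂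
  match_scalars <;>
    first
      | ring1
      | linear_combination hq
      | linear_combination -hq
      | linear_combination hcc
      | linear_combination -hcc
      | linear_combination -a * hcc + c * hδ
      | linear_combination a * hcc - c * hδ

/-- The conditions on the coefficients of a web action and of `q - D - c e` that make the latter a
braiding with inverse `q' - D - c' e`. -/
structure IsBraidCoeff {R : Type*} [CommRing R] (δ : R) (u a b : ℕ → R) (q q' c c' : R) :
    Prop where
  inv : q * q' = 1
  bigon : u 1 = q + q'
  cupcap : b 0 = a 0
  ladder : b 1 - a 0 * u 1 = -1
  left : a 0 - c = q'
  right : a 0 - c' = q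
  mul : c * c' = a 0 * (a 0 - a 1)
  circle : q * c' + q' * c = c * c' * δ

/-- The crossing and its inverse play symmetric roles, so each result about one applies to the
other. -/
theorem IsBraidCoeff.symm {R : Type*} [CommRing R] {δ : R} {u a b : ℕ → R} {q q' c c' : R}
    (h : IsBraidCoeff δ u a b q q' c c') : IsBraidCoeff δ u a b q' q c' c where
  inv := by rw [mul_comm, h.inv]
  bigon := by rw [add_comm, h.bigon]
  cupcap := h.cupcap
  ladder := h.ladder
  left := h.right
  right := h.left
  mul := by rw [mul_comm, h.mul]
  circle := by rw [add_comm, h.circle, mul_comm c']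

/-! ### The crossing on two strands -/

namespace WebAction

variable {R : Type*} [CommRing R] {C : Type*} [Category C] [Preadditive C] [Linear R C]
  {δ : R} {u a b : ℕ → R} (E : WebAction R C δ u a b)

local notation:max k:max " ◂ " f:max => CategoryTheory.Functor.map (WebAction.A E k) f

/-- The endomorphism `q - D - c e` of two strands. -/
def br (q c : R) : E.Fam := fun W => q • 𝟙 _ - E.D W - c • E.e W

theorem isNat_br (q c : R) : E.IsNat (E.br q c) := fun f => by
  simp only [br, Preadditive.comp_sub, Preadditive.sub_comp, Linear.comp_smul, Linear.smul_comp,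
    Category.comp_id, Category.id_comp, IsNat.eq E.isNat_D, IsNat.eq E.isNat_e]

theorem rotL_e (W : C) : E.rotL E.e W = 𝟙 _ := by
  simp only [rotL, e, Functor.map_comp, Category.assoc]
  rw [E.snakeL_assoc, ← Functor.map_comp, E.snakeL, CategoryTheory.Functor.map_id]

theorem rotR_e (W : C) : E.rotR E.e W = 𝟙 _ := by
  simp only [rotR, e, Functor.map_comp, Category.assoc]
  rw [E.snakeR, ← Functor.map_comp_assoc, E.snakeR, CategoryTheory.Functor.map_id,
    Category.id_comp]

theorem e_ca (W : C) : E.e W ≫ E.ca 1 W = δ • E.ca 1 W := by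
  simp [e, E.circle]

theorem D_e (W : C) : E.D W ≫ E.e W = 0 := by
  rw [e, ← Category.assoc, D_ca, Limits.zero_comp]

theorem e_D (W : C) : E.e W ≫ E.D W = 0 := by
  rw [e, Category.assoc, cu_D, Limits.comp_zero]

theorem br_ca (q c : R) (W : C) : E.br q c W ≫ E.ca 1 W = (q - c * δ) • E.ca 1 W := by
  simp [br, D_ca, e_ca, sub_smul, mul_smul]

variable {E} {q q' c c' : R} (h : IsBraidCoeff δ u a b q q' c c')
include h

/-- The product lies in the span of 1, D and e. The coefficient of D vanishes by `bigon`, that of e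
by `circle`, and that of 1 is q q'. -/
theorem br_br (W : C) : E.br q c W ≫ E.br q' c' W = 𝟙 _ := by
  simp only [br, Preadditive.comp_sub, Preadditive.sub_comp, Linear.comp_smul, Linear.smul_comp,
    Category.comp_id, Category.id_comp, D_sq, D_e, e_D, e_sq, h.bigon]
  have h1 := h.inv
  have h2 := h.circle
  match_scalars
  · linear_combination h1
  · ring
  · linear_combination -h2

/-- A quarter turn swaps 1 and e and sends D to D + a₀(e - 1), since b₀ = a₀. The new coefficients
are a₀ - c = q' on 1 and q - a₀ = -c' on e. -/
theorem rotL_br (W : C) : E.rotL (E.br q c) W = E.br q' c' W := by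
  have e1 := E.rotL_one W
  have e2 := E.rotL_D W
  have e3 := E.rotL_e W
  simp only [rotL, CategoryTheory.Functor.map_id, Category.id_comp] at e1 e2 e3
  have h1 := h.left
  have h2 := h.right
  simp only [rotL, br, Functor.map_sub, Functor.map_smul, Preadditive.comp_sub,
    Preadditive.sub_comp, Linear.comp_smul, Linear.smul_comp, CategoryTheory.Functor.map_id,
    Category.id_comp, e1, e2, e3, D', h.cupcap]
  match_scalars
  · linear_combination -h2
  · ring
  · linear_combination h1

theorem rotR_br (W : C) : E.rotR (E.br q c) W = E.br q' c' W := by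
  have e1 := E.rotR_one W
  have e2 := E.rotR_D W
  have e3 := E.rotR_e W
  simp only [rotR, CategoryTheory.Functor.map_id, Category.id_comp] at e1 e2 e3
  have h1 := h.left
  have h2 := h.right
  simp only [rotR, br, Functor.map_sub, Functor.map_smul, Preadditive.comp_sub,
    Preadditive.sub_comp, Linear.comp_smul, Linear.smul_comp, CategoryTheory.Functor.map_id,
    Category.id_comp, e1, e2, e3, D', h.cupcap]
  match_scalars
  · linear_combination -h2
  · ring
  · linear_combination h1

/-- Sliding one crossing through the cup rotates it into the inverse crossing, which cancels the
other. The next three lemmas use the same argument for the remaining cup and cap moves. -/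
theorem map_cu_br (W : C) : 1 ◂ (E.cu 1 W) ≫ E.br q c _ ≫ 1 ◂ (E.br q c W) = E.cu 1 _ := by
  rw [← Category.assoc, map_cu_slide, Category.assoc, ← Functor.map_comp, rotR_br h,
    br_br h.symm]
  simp

theorem cu_br (W : C) : E.cu 1 _ ≫ 1 ◂ (E.br q c W) ≫ E.br q c _ = 1 ◂ (E.cu 1 W) := by
  rw [← Category.assoc, cu_slide (E.isNat_br q c), Category.assoc, rotL_br h, br_br h.symm]
  simp

theorem br_map_ca (W : C) : E.br q c _ ≫ 1 ◂ (E.br q c W) ≫ E.ca 1 _ = 1 ◂ (E.ca 1 W) := by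
  rw [ca_slide (E.isNat_br q c), ← Category.assoc, rotR_br h, br_br h]
  simp

theorem map_br_ca (W : C) : 1 ◂ (E.br q c W) ≫ E.br q c _ ≫ 1 ◂ (E.ca 1 W) = E.ca 1 _ := by
  rw [map_ca_slide, ← Functor.map_comp_assoc, rotL_br h, br_br h]
  simp

/-- A slide replaces the crossing by its inverse against the cap. There D dies and e contributes δ,
so the inverse crossing acts as the scalar q' - c'δ; a snake remains. -/
theorem curl (W : C) :
    1 ◂ (E.cu 1 W) ≫ E.br q c _ ≫ 1 ◂ (E.ca 1 W) = (q' - c' * δ) • 𝟙 _ := by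
  rw [← Category.assoc, map_cu_slide, Category.assoc, ← Functor.map_comp, rotR_br h, br_ca,
    Functor.map_smul, Linear.comp_smul, E.snakeL]

/-- Inside the endomorphisms of three strands, the slides of D and the relation `ladder_three` are
exactly the input of `yangBaxter_of_ladder`. -/
theorem yangBaxter (W : C) :
    E.br q c _ ≫ 1 ◂ (E.br q c W) ≫ E.br q c _ =
      1 ◂ (E.br q c W) ≫ E.br q c _ ≫ 1 ◂ (E.br q c W) := by
  have he12 : E.e ((E.A 1).obj W) ≫ 1 ◂ (E.e W) = E.ca 1 _ ≫ 1 ◂ (E.cu 1 W) := by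
    simp only [e, Functor.map_comp, Category.assoc, E.snakeL_assoc]
  have he21 : 1 ◂ (E.e W) ≫ E.e ((E.A 1).obj W) = 1 ◂ (E.ca 1 W) ≫ E.cu 1 _ := by
    simp only [e, Functor.map_comp, Category.assoc, E.snakeR_assoc]
  have hD (V : C) : E.D' V = E.D V + a 0 • E.e V - a 0 • 𝟙 _ := by rw [D', h.cupcap]
  have s₁ : 1 ◂ (E.D W) ≫ E.e _ = E.D' _ ≫ 1 ◂ (E.e W) ≫ E.e _ := by
    rw [he21, e, ← Category.assoc, ca_slide E.isNat_D, rotR_D, Category.assoc]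
  have s₂ : E.D _ ≫ 1 ◂ (E.e W) = 1 ◂ (E.D' W) ≫ E.e _ ≫ 1 ◂ (E.e W) := by
    rw [he12, e, Functor.map_comp, ← Category.assoc, map_ca_slide, rotL_D, Category.assoc]
  have s₃ : 1 ◂ (E.e W) ≫ E.D _ = 1 ◂ (E.e W) ≫ E.e _ ≫ 1 ◂ (E.D' W) := by
    rw [← Category.assoc, he21, e, Functor.map_comp, Category.assoc, map_cu_slide, rotR_D,
      Category.assoc]
  have s₄ : E.e _ ≫ 1 ◂ (E.D W) = E.e _ ≫ 1 ◂ (E.e W) ≫ E.D' _ := by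
    rw [← Category.assoc, he12, e, Category.assoc, cu_slide E.isNat_D, rotL_D, Category.assoc]
  have h121 : E.e _ ≫ 1 ◂ (E.e W) ≫ E.e _ = E.e _ := by
    rw [he21, e, Category.assoc, E.snakeL_assoc]
  have h212 : 1 ◂ (E.e W) ≫ E.e _ ≫ 1 ◂ (E.e W) = 1 ◂ (E.e W) := by
    rw [he12, e, Functor.map_comp, Category.assoc, E.snakeR_assoc]
  have hl := E.ladder_three W
  simp only [hD, Functor.map_add, Functor.map_sub, Functor.map_smul,
    CategoryTheory.Functor.map_id] at s₁ s₂ s₃ s₄ hl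
  -- Multiplication in `End` is composition in the opposite order, which is why the one-sided
  -- relations are supplied in mirrored form.
  have key := yangBaxter_of_ladder (R := R)
    (B := End ((E.A 1).obj ((E.A 1).obj ((E.A 1).obj W))))
    (D₁ := E.D _) (D₂ := 1 ◂ (E.D W)) (e₁ := E.e _) (e₂ := 1 ◂ (E.e W))
    (q := q) (q' := q') (a := a 0) (a' := a 1) (b := b 1) (c := c) (c' := c') (t := u 1) (δ := δ)
    (E.D_sq _)
    ((Functor.map_comp _ _ _).symm.trans ((congrArg _ (E.D_sq W)).trans (Functor.map_smul _ _ _)))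
    (E.e_D _) (E.D_e _)
    ((Functor.map_comp _ _ _).symm.trans ((congrArg _ (E.e_D W)).trans (Functor.map_zero _ _ _)))
    ((Functor.map_comp _ _ _).symm.trans ((congrArg _ (E.D_e W)).trans (Functor.map_zero _ _ _)))
    (E.e_sq _)
    ((Functor.map_comp _ _ _).symm.trans ((congrArg _ (E.e_sq W)).trans (Functor.map_smul _ _ _)))
    h121 h212 s₁ s₂ (s₃.trans (Category.assoc _ _ _).symm)
    (s₄.trans (Category.assoc _ _ _).symm)
    (by simp only [End.mul_def, End.one_def]; exact hl)
    h.inv h.bigon h.ladder h.left.symm (by rw [← h.right]; ring) h.mul h.circle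
  simp only [End.mul_def, End.one_def] at key
  simpa only [br, Functor.map_sub, Functor.map_smul, CategoryTheory.Functor.map_id] using key

end WebAction

namespace WebAction

variable {R : Type*} [CommRing R] {C : Type*} [Category C] [Preadditive C] [Linear R C]
  {δ : R} {u a b : ℕ → R} (E : WebAction R C δ u a b)

local notation:max k:max " ◂ " f:max => CategoryTheory.Functor.map (WebAction.A E k) f

/-! ### Exploding strands -/

/-- The action of `k` strands labelled `1`. -/
def T : ℕ → C ⥤ C
  | 0 => 𝟭 C
  | k + 1 => T k ⋙ E.A 1

/-- Merging `k` strands labelled `1`. -/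
def P : ∀ (k : ℕ) (W : C), (E.T k).obj W ⟶ (E.A k).obj W
  | 0, W => (E.z W).inv
  | k + 1, W => 1 ◂ (P k W) ≫ E.mL k W

/-- Splitting a strand labelled `k` into `k` strands labelled `1`. -/
def I : ∀ (k : ℕ) (W : C), (E.A k).obj W ⟶ (E.T k).obj W
  | 0, W => (E.z W).hom
  | k + 1, W => E.sL k W ≫ 1 ◂ (I k W)

theorem T_obj_zero (W : C) : (E.T 0).obj W = W := rfl

theorem T_obj_succ (k : ℕ) (W : C) : (E.T (k + 1)).obj W = (E.A 1).obj ((E.T k).obj W) := rfl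

theorem P_zero (W : C) : E.P 0 W = (E.z W).inv := rfl

theorem I_zero (W : C) : E.I 0 W = (E.z W).hom := rfl

theorem P_succ (k : ℕ) (W : C) : E.P (k + 1) W = 1 ◂ (E.P k W) ≫ E.mL k W := rfl

theorem I_succ (k : ℕ) (W : C) : E.I (k + 1) W = E.sL k W ≫ 1 ◂ (E.I k W) := rfl

theorem P_one (W : C) : E.P 1 W = 𝟙 ((E.A 1).obj W) := by
  rw [P_succ, P_zero, E.mL_zero]
  have h : (E.A 1).map (E.z W).inv ≫ (E.A 1).map (E.z W).hom = 𝟙 ((E.A 1).obj W) := by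
    rw [← Functor.map_comp, Iso.inv_hom_id, CategoryTheory.Functor.map_id]
  exact h

theorem I_one (W : C) : E.I 1 W = 𝟙 ((E.A 1).obj W) := by
  rw [I_succ, I_zero, sL_zero]
  have h : (E.A 1).map (E.z W).inv ≫ (E.A 1).map (E.z W).hom = 𝟙 ((E.A 1).obj W) := by
    rw [← Functor.map_comp, Iso.inv_hom_id, CategoryTheory.Functor.map_id]
  exact h

theorem T_map_succ (k : ℕ) {W V : C} (f : W ⟶ V) :
    (E.T (k + 1)).map f = 1 ◂ ((E.T k).map f) := rfl

theorem P_nat (k : ℕ) {W V : C} (f : W ⟶ V) : (E.T k).map f ≫ E.P k V = E.P k W ≫ k ◂ f := by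
  induction k with
  | zero => exact E.z_inv_nat f
  | succ k ih =>
    dsimp only [T_obj_succ, T_map_succ, P_succ]
    rw [← Functor.map_comp_assoc, ih, Category.assoc, ← E.mL_nat, Functor.map_comp_assoc]

theorem P_nat_assoc (k : ℕ) {W V Z : C} (f : W ⟶ V) (h : (E.A k).obj V ⟶ Z) :
    (E.T k).map f ≫ E.P k V ≫ h = E.P k W ≫ k ◂ f ≫ h := by
  simpa only [Category.assoc] using eq_whisker (E.P_nat k f) h

theorem I_nat (k : ℕ) {W V : C} (f : W ⟶ V) : k ◂ f ≫ E.I k V = E.I k W ≫ (E.T k).map f := by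
  induction k with
  | zero => exact E.z_nat f
  | succ k ih =>
    dsimp only [T_obj_succ, T_map_succ, I_succ]
    rw [Category.assoc, ← Functor.map_comp, ← ih, Functor.map_comp, ← E.sL_nat_assoc]

/-- Splitting completely and merging again is a chain of bigons, hence a product of units; v is its
inverse. It does not depend on W, so the identity can be inserted naturally. -/
theorem id_eq_I_P (hu : ∀ k, IsUnit (u k)) (k : ℕ) :
    ∃ v : R, ∀ W, 𝟙 ((E.A k).obj W) = v • (E.I k W ≫ E.P k W) := by
  induction k with
  | zero => exact ⟨1, fun W => by rw [one_smul]; exact (E.z W).hom_inv_id.symm⟩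
  | succ k ih =>
    obtain ⟨v, hv⟩ := ih
    obtain ⟨w, hw⟩ := (hu k).exists_left_inv
    refine ⟨w * v, fun W => ?_⟩
    dsimp only [T_obj_succ, I_succ, P_succ]
    have h : v • 1 ◂ (E.I k W ≫ E.P k W) = 𝟙 _ := by
      rw [← Functor.map_smul, ← hv, CategoryTheory.Functor.map_id]
    have h' : (w * v) • (E.sL k W ≫ 1 ◂ (E.I k W ≫ E.P k W) ≫ E.mL k W) =
        w • (E.sL k W ≫ (v • 1 ◂ (E.I k W ≫ E.P k W)) ≫ E.mL k W) := by
      rw [mul_smul, Linear.smul_comp, Linear.comp_smul]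
    rw [Category.assoc, ← Functor.map_comp_assoc, h', h, Category.id_comp, bigon, smul_smul, hw,
      one_smul]

/-! ### Generation by crossings, cups and caps -/

/-- A class of morphisms between standard objects that contains the cups, the caps and the braiding
of strands labelled `1` and is closed under linear combinations and composition. -/
structure IsStdClass (q c : R) (O : C → Prop) (S : ∀ {X Y : C}, (X ⟶ Y) → Prop) : Prop where
  obj {W : C} : O W → O ((E.A 1).obj W)
  id {W : C} : O W → S (𝟙 W)
  comp {X Y Z : C} {f : X ⟶ Y} {g : Y ⟶ Z} : S f → S g → S (f ≫ g)
  add {X Y : C} {f g : X ⟶ Y} : S f → S g → S (f + g)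
  smul {X Y : C} (r : R) {f : X ⟶ Y} : S f → S (r • f)
  map {X Y : C} {f : X ⟶ Y} : S f → S (1 ◂ f)
  cu {W : C} : O W → S (E.cu 1 W)
  ca {W : C} : O W → S (E.ca 1 W)
  br {W : C} : O W → S (E.br q c W)

namespace IsStdClass

variable {E} {q c : R} {O : C → Prop} {S : ∀ {X Y : C}, (X ⟶ Y) → Prop}
  (h : E.IsStdClass q c O S)
include h

theorem sub {X Y : C} {f g : X ⟶ Y} (hf : S f) (hg : S g) : S (f - g) := by
  have : f - g = f + (-1 : R) • g := by rw [neg_smul, one_smul, sub_eq_add_neg]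
  rw [this]
  exact h.add hf (h.smul _ hg)

theorem e {W : C} (hW : O W) : S (E.e W) := h.comp (h.ca hW) (h.cu hW)

/-- Solving the definition of the crossing for the dumbbell. -/
theorem D {W : C} (hW : O W) : S (E.D W) := by
  have : E.D W = q • 𝟙 _ - E.br q c W - c • E.e W := by rw [WebAction.br]; abel
  rw [this]
  exact h.sub (h.sub (h.smul _ (h.id (h.obj (h.obj hW)))) (h.br hW)) (h.smul _ (h.e hW))

theorem D' {W : C} (hW : O W) : S (E.D' W) :=
  h.sub (h.add (h.D hW) (h.smul _ (h.e hW))) (h.smul _ (h.id (h.obj (h.obj hW))))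

theorem obj_T (k : ℕ) {W : C} (hW : O W) : O ((E.T k).obj W) := by
  induction k with
  | zero => exact hW
  | succ k ih => exact h.obj ih

theorem map_T (k : ℕ) {X Y : C} {f : X ⟶ Y} (hf : S f) : S ((E.T k).map f) := by
  induction k with
  | zero => exact hf
  | succ k ih => exact h.map ih

variable (hu : ∀ k, IsUnit (u k))
include hu

/-- The projector onto a strand labelled `k` is standard. -/
theorem P_I (k : ℕ) {W : C} (hW : O W) : S (E.P k W ≫ E.I k W) := by
  induction k with
  | zero =>
    dsimp only [T_obj_zero, P_zero, I_zero]
    rw [Iso.inv_hom_id]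
    exact h.id hW
  | succ k ih =>
    -- One strand is separated because the ladder relation starts at k = 1; for j + 2 strands it is
    -- used with k = j + 1.
    obtain _ | j := k
    · have : E.P 1 W ≫ E.I 1 W = 𝟙 _ := by
        dsimp only [T_obj_zero, T_obj_succ, P_succ, I_succ, P_zero, I_zero]
        simp only [mL_zero, sL_zero, ← Functor.map_comp,
          Iso.inv_hom_id, CategoryTheory.Functor.map_id, Category.id_comp]
      rw [this]
      exact h.id (h.obj hW)
    · obtain ⟨v, hv⟩ := E.id_eq_I_P hu j
      have hX : E.IsNat (fun V => E.D' V - a j • E.e V) := fun f => by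
        simp only [Preadditive.comp_sub, Preadditive.sub_comp, Linear.comp_smul, Linear.smul_comp,
          IsNat.eq E.isNat_e, ← rotR_D, IsNat.eq (E.isNat_rotR E.isNat_D)]
      have key : E.P (j + 2) W ≫ E.I (j + 2) W =
          v • (1 ◂ (E.P (j + 1) W ≫ E.I (j + 1) W) ≫ (E.D' _ - a j • E.e _) ≫
            1 ◂ (E.P (j + 1) W ≫ E.I (j + 1) W)) + b j • 1 ◂ (E.P (j + 1) W ≫ E.I (j + 1) W) := by
        -- The rung involves only two strands, so by naturality the strand labelled j beside it can
        -- be exploded. Its split and merge complete the adjacent vertices to full merges and splits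
        -- of j + 1 strands.
        have hs : E.D' ((E.A j).obj W) - a j • E.e _ =
            v • (1 ◂ (1 ◂ (E.I j W)) ≫ (E.D' _ - a j • E.e _) ≫ 1 ◂ (1 ◂ (E.P j W))) := by
          rw [hX.eq_assoc, ← Functor.map_comp, ← Functor.map_comp, ← Linear.comp_smul,
            ← Functor.map_smul, ← Functor.map_smul, ← hv]
          simp
        rw [P_succ (k := j + 1), I_succ (k := j + 1)]
        dsimp only [T_obj_succ]
        rw [Category.assoc, ← Category.assoc (E.mL _ _), mL_sL, rotR_D, hs]
        dsimp only [T_obj_succ, P_succ, I_succ]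
        simp only [Functor.map_comp, Category.assoc, Preadditive.add_comp,
          Preadditive.comp_add, Linear.comp_smul, Linear.smul_comp,
          Category.id_comp]
        rfl
      rw [key]
      exact h.add (h.smul _ (h.comp (h.map ih) (h.comp (h.sub (h.D' (h.obj_T j hW))
        (h.smul _ (h.e (h.obj_T j hW)))) (h.map ih)))) (h.smul _ (h.map ih))

omit hu in
/-- Regrouping strands labelled `1`. -/
theorem exists_regroup (k : ℕ) {W : C} (hW : O W) :
    ∃ (θ : (E.T k).obj ((E.A 1).obj W) ≅ (E.T (k + 1)).obj W), S θ.hom ∧ S θ.inv ∧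
      E.P k _ ≫ E.mR k W = θ.hom ≫ E.P (k + 1) W := by
  induction k with
  | zero =>
    refine ⟨Iso.refl _, h.id (h.obj hW), h.id (h.obj hW), ?_⟩
    dsimp only [T_obj_zero, T_obj_succ, P_succ, P_zero, Iso.refl]
    simp only [mL_zero, mR_zero, ← Functor.map_comp, Iso.inv_hom_id,
      CategoryTheory.Functor.map_id, Category.id_comp]
  | succ k ih =>
    obtain ⟨θ, h1, h2, h3⟩ := ih
    refine ⟨(E.A 1).mapIso θ, h.map h1, h.map h2, ?_⟩
    rw [P_succ]
    dsimp only [T_obj_succ]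
    rw [Category.assoc, ← E.assoc, ← Functor.map_comp_assoc, h3, P_succ (k := k + 1),
      Functor.map_comp_assoc]
    rfl

theorem P_mR_I (k : ℕ) {W : C} (hW : O W) : S (E.P k _ ≫ E.mR k W ≫ E.I (k + 1) W) := by
  obtain ⟨θ, h1, h2, h3⟩ := h.exists_regroup k hW
  rw [← Category.assoc, h3, Category.assoc]
  exact h.comp h1 (h.P_I hu _ hW)

theorem P_mL_I (k : ℕ) {W : C} (hW : O W) :
    S (1 ◂ (E.P k W) ≫ E.mL k W ≫ E.I (k + 1) W) := by
  rw [← Category.assoc, ← P_succ]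
  exact h.P_I hu _ hW

/-- The factor labelled 1 is regrouped as well, trivially since `P 1` is an identity. Quantifying
over p bridges source and target objects that agree only by unfolding `T`. -/
theorem P_P_mR_I (k : ℕ) {W : C} (hW : O W) :
    S (E.P k _ ≫ k ◂ (E.P 1 W) ≫ E.mR k W ≫ E.I (k + 1) W) := by
  have h1 : ∀ p : (E.A 1).obj W ⟶ (E.A 1).obj W, p = 𝟙 _ →
      S (E.P k _ ≫ k ◂ p ≫ E.mR k W ≫ E.I (k + 1) W) := by
    rintro _ rfl
    rw [CategoryTheory.Functor.map_id, Category.id_comp]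
    exact h.P_mR_I hu k hW
  exact h1 _ (E.P_one W)

theorem P_P_mL_I (k : ℕ) {W : C} (hW : O W) :
    S (E.P 1 _ ≫ 1 ◂ (E.P k W) ≫ E.mL k W ≫ E.I (k + 1) W) := by
  have h1 : ∀ p : (E.A 1).obj ((E.T k).obj W) ⟶ (E.A 1).obj ((E.T k).obj W), p = 𝟙 _ →
      S (p ≫ 1 ◂ (E.P k W) ≫ E.mL k W ≫ E.I (k + 1) W) := by
    rintro _ rfl
    rw [Category.id_comp]
    exact h.P_mL_I hu k hW
  exact h1 _ (E.P_one _)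

/-- Splitting the left leg of a cup labelled k + 1 turns it into a cup labelled 1 around a cup
labelled k, followed by a merge on the right. Exploding the two legs of the inner cup gives the
inductive case, and the merge becomes an exploded vertex. -/
theorem cu_I (k : ℕ) {W : C} (hW : O W) : S (E.cu k W ≫ k ◂ (E.I k W) ≫ E.I k _) := by
  induction k generalizing W with
  | zero =>
    have : E.cu 0 W ≫ 0 ◂ (E.I 0 W) ≫ E.I 0 _ = 𝟙 W := by
      dsimp only [T_obj_zero, I_zero]
      simp only [cu_zero', Category.assoc, ← Functor.map_comp_assoc, Iso.inv_hom_id,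
        CategoryTheory.Functor.map_id, Category.id_comp]
    rw [this]
    exact h.id hW
  | succ k ih =>
    obtain ⟨v, hv⟩ := E.id_eq_I_P hu k
    -- An arbitrary g on the right leg keeps the split there from being unfolded together with the
    -- left one.
    have key {V : C} (g : (E.A (k + 1)).obj W ⟶ V) :
        E.cu (k + 1) W ≫ (k + 1) ◂ g ≫ E.I (k + 1) V =
        E.cu 1 W ≫ (v • 1 ◂ ((E.cu k _ ≫ k ◂ (E.I k _) ≫ E.I k _) ≫
          (E.T k).map (E.P k _ ≫ E.mR k W ≫ g))) := by
      have hs : E.mR k W = v • (E.I k _ ≫ E.P k _ ≫ E.mR k W) := by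
        rw [← Category.assoc, ← Linear.smul_comp, ← hv, Category.id_comp]
      dsimp only [I_succ, T_obj_succ]
      rw [E.sL_nat_assoc, ← Category.assoc, cu_sL]
      conv_lhs => rw [hs]
      simp only [Functor.map_smul, Functor.map_comp, Linear.comp_smul, Linear.smul_comp,
        Category.assoc]
      simp only [← Functor.map_comp]
      simp only [← E.I_nat]
      simp only [Functor.map_comp, Category.assoc]
    rw [key]
    exact h.comp (h.cu hW) (h.smul _ (h.map (h.comp (ih (h.obj hW))
      (h.map_T k (h.P_mR_I hu k hW)))))

/-- The right leg is first regrouped so that its last vertex is a right merge. `map_mR_ca` moves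
this vertex to a left split, turning the cap into nested caps labelled k and 1; exploding the
strands labelled k leaves a projector and the inductive case. -/
theorem P_ca (k : ℕ) {W : C} (hW : O W) : S (E.P k _ ≫ k ◂ (E.P k W) ≫ E.ca k W) := by
  induction k generalizing W with
  | zero =>
    have : E.P 0 _ ≫ 0 ◂ (E.P 0 W) ≫ E.ca 0 W = 𝟙 W := by
      rw [ca_zero, E.z_nat_assoc]
      dsimp only [T_obj_zero, P_zero]
      simp
    rw [this]
    exact h.id hW
  | succ k ih =>
    obtain ⟨v, hv⟩ := E.id_eq_I_P hu k
    obtain ⟨θ, h1, h2, h3⟩ := h.exists_regroup k hW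
    obtain ⟨g, hg⟩ : ∃ g : (E.T (k + 1)).obj _ ⟶ (E.A 1).obj ((E.T k).obj _),
      g = E.P (k + 1) ((E.T k).obj ((E.A 1).obj W)) ≫ E.I (k + 1) _ := ⟨_, rfl⟩
    have hgS : S g := hg ▸ h.P_I hu _ (h.obj_T k (h.obj hW))
    have hs {V X : C} (p : V ⟶ (E.A (k + 1)).obj X) :
        p ≫ E.sL k X = v • (p ≫ E.sL k X ≫ 1 ◂ (E.I k X) ≫ 1 ◂ (E.P k X)) := by
      rw [← Functor.map_comp, ← Linear.comp_smul, ← Linear.comp_smul, ← Functor.map_smul, ← hv,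
        CategoryTheory.Functor.map_id, Category.comp_id]
    have hg' : g ≫ 1 ◂ (E.P k _) =
        E.P (k + 1) _ ≫ E.sL k _ ≫ 1 ◂ (E.I k _) ≫ 1 ◂ (E.P k _) := by
      subst hg
      exact (Category.assoc _ _ _).trans (congrArg _ (Category.assoc _ _ _))
    have key : E.P (k + 1) _ ≫ (k + 1) ◂ (E.P (k + 1) W) ≫ E.ca (k + 1) W =
        (E.T (k + 1)).map θ.inv ≫ g ≫
          (v • 1 ◂ (E.P k _ ≫ k ◂ (E.P k _) ≫ E.ca k _)) ≫ E.ca 1 W := by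
      have h4 : E.P (k + 1) W = θ.inv ≫ E.P k _ ≫ E.mR k W := by rw [h3, Iso.inv_hom_id_assoc]
      rw [h4, Functor.map_comp, Functor.map_comp, Category.assoc, Category.assoc,
        ← E.P_nat_assoc, E.map_mR_ca, E.sL_nat_assoc, ← Category.assoc (E.P (k + 1) _), hs, ← hg']
      simp only [Functor.map_comp, Category.assoc, Linear.smul_comp, Linear.comp_smul]
    rw [key]
    exact h.comp (h.map_T _ h2) (h.comp hgS
      (h.comp (h.smul _ (h.map (ih (h.obj hW)))) (h.ca hW)))

end IsStdClass

end WebAction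

/-! ### Web data acting by tensor products on the left -/

section Act

variable {C : Type*} [Category C] [MonoidalCategory C]

/-- The action of a morphism `X ⊗ Y ⟶ X' ⊗ Y'`. -/
def act₂₂ {X Y X' Y' : C} (f : X ⊗ Y ⟶ X' ⊗ Y') (W : C) : X ⊗ Y ⊗ W ⟶ X' ⊗ Y' ⊗ W :=
  (α_ _ _ _).inv ≫ f ▷ W ≫ (α_ _ _ _).hom

/-- The action of a morphism `X ⊗ Y ⟶ Z`. -/
def act₂₁ {X Y Z : C} (f : X ⊗ Y ⟶ Z) (W : C) : X ⊗ Y ⊗ W ⟶ Z ⊗ W :=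
  (α_ _ _ _).inv ≫ f ▷ W

/-- The action of a morphism `Z ⟶ X ⊗ Y`. -/
def act₁₂ {X Y Z : C} (f : Z ⟶ X ⊗ Y) (W : C) : Z ⊗ W ⟶ X ⊗ Y ⊗ W :=
  f ▷ W ≫ (α_ _ _ _).hom

/-- The action of a morphism `𝟙 ⟶ X ⊗ Y`. -/
def act₀₂ {X Y : C} (f : 𝟙_ C ⟶ X ⊗ Y) (W : C) : W ⟶ X ⊗ Y ⊗ W :=
  (λ_ W).inv ≫ f ▷ W ≫ (α_ _ _ _).hom

/-- The action of a morphism `X ⊗ Y ⟶ 𝟙`. -/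
def act₂₀ {X Y : C} (f : X ⊗ Y ⟶ 𝟙_ C) (W : C) : X ⊗ Y ⊗ W ⟶ W :=
  (α_ _ _ _).inv ≫ f ▷ W ≫ (λ_ W).hom

theorem act₂₁_nat {X Y Z : C} (f : X ⊗ Y ⟶ Z) {W V : C} (g : W ⟶ V) :
    X ◁ Y ◁ g ≫ act₂₁ f V = act₂₁ f W ≫ Z ◁ g := by
  simp [act₂₁, ← whisker_exchange]

theorem act₁₂_nat {X Y Z : C} (f : Z ⟶ X ⊗ Y) {W V : C} (g : W ⟶ V) :
    Z ◁ g ≫ act₁₂ f V = act₁₂ f W ≫ X ◁ Y ◁ g := by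
  simp [act₁₂, whisker_exchange_assoc]

theorem act₀₂_nat {X Y : C} (f : 𝟙_ C ⟶ X ⊗ Y) {W V : C} (g : W ⟶ V) :
    g ≫ act₀₂ f V = act₀₂ f W ≫ X ◁ Y ◁ g := by
  have := whisker_exchange_assoc f g (α_ X Y V).hom
  simp only [act₀₂, Category.assoc]
  rw [leftUnitor_inv_naturality_assoc, this]
  simp

theorem act₂₀_nat {X Y : C} (f : X ⊗ Y ⟶ 𝟙_ C) {W V : C} (g : W ⟶ V) :
    X ◁ Y ◁ g ≫ act₂₀ f V = act₂₀ f W ≫ g := by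
  simp only [act₂₀, Category.assoc]
  rw [← leftUnitor_naturality, ← whisker_exchange_assoc]
  simp

/-- The acting form is the original diagram whiskered by W up to coherence; the later translations
of rotations and closures rest on the same fact. -/
theorem snakeLeft_act {X : C} {cup : 𝟙_ C ⟶ X ⊗ X} {cap : X ⊗ X ⟶ 𝟙_ C}
    (h : snakeLeft cup cap = 𝟙 X) (W : C) : act₀₂ cup (X ⊗ W) ≫ X ◁ act₂₀ cap W = 𝟙 _ := by
  have : act₀₂ cup (X ⊗ W) ≫ X ◁ act₂₀ cap W = snakeLeft cup cap ▷ W := by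
    simp only [act₀₂, act₂₀, snakeLeft]
    monoidal
  rw [this, h, id_whiskerRight]

theorem snakeRight_act {X : C} {cup : 𝟙_ C ⟶ X ⊗ X} {cap : X ⊗ X ⟶ 𝟙_ C}
    (h : snakeRight cup cap = 𝟙 X) (W : C) : X ◁ act₀₂ cup W ≫ act₂₀ cap (X ⊗ W) = 𝟙 _ := by
  have : X ◁ act₀₂ cup W ≫ act₂₀ cap (X ⊗ W) = snakeRight cup cap ▷ W := by
    simp only [act₀₂, act₂₀, snakeRight]
    monoidal
  rw [this, h, id_whiskerRight]

theorem rotLeft_act {X Y Z : C} (cupX : 𝟙_ C ⟶ X ⊗ X) (cupY : 𝟙_ C ⟶ Y ⊗ Y) (capZ : Z ⊗ Z ⟶ 𝟙_ C)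
    (f : X ⊗ Y ⟶ Z) (W : C) : act₁₂ (rotLeft cupX cupY capZ f) W =
      act₀₂ cupY _ ≫ Y ◁ act₀₂ cupX _ ≫ Y ◁ X ◁ act₂₁ f _ ≫ Y ◁ X ◁ act₂₀ capZ W := by
  simp only [act₀₂, act₂₀, act₂₁, act₁₂, rotLeft]
  monoidal

theorem rotRight_act {X Y Z : C} (cupX : 𝟙_ C ⟶ X ⊗ X) (cupY : 𝟙_ C ⟶ Y ⊗ Y)
    (capZ : Z ⊗ Z ⟶ 𝟙_ C) (f : X ⊗ Y ⟶ Z) (W : C) : act₁₂ (rotRight cupX cupY capZ f) W =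
      Z ◁ act₀₂ cupX W ≫ Z ◁ X ◁ act₀₂ cupY _ ≫ Z ◁ act₂₁ f _ ≫ act₂₀ capZ _ := by
  simp only [act₀₂, act₂₀, act₂₁, act₁₂, rotRight]
  monoidal

theorem closeRight_act {X : C} (cup : 𝟙_ C ⟶ X ⊗ X) (cap : X ⊗ X ⟶ 𝟙_ C)
    (f : X ⊗ X ⟶ X ⊗ X) (W : C) :
    closeRight cup cap f ▷ W = X ◁ act₀₂ cup W ≫ act₂₂ f _ ≫ X ◁ act₂₀ cap W := by
  simp only [act₀₂, act₂₀, act₂₂, closeRight]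
  monoidal

theorem act₀₂_act₂₀ {X Y : C} (f : 𝟙_ C ⟶ X ⊗ Y) (g : X ⊗ Y ⟶ 𝟙_ C) (W : C) :
    act₀₂ f W ≫ act₂₀ g W = (λ_ W).inv ≫ (f ≫ g) ▷ W ≫ (λ_ W).hom := by
  simp [act₀₂, act₂₀]

theorem act₁₂_act₂₁ {X Y Z Z' : C} (f : Z ⟶ X ⊗ Y) (g : X ⊗ Y ⟶ Z') (W : C) :
    act₁₂ f W ≫ act₂₁ g W = (f ≫ g) ▷ W := by
  simp [act₁₂, act₂₁]

theorem act₁₂_act₂₀ {X Y Z : C} (f : Z ⟶ X ⊗ Y) (g : X ⊗ Y ⟶ 𝟙_ C) (W : C) :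
    act₁₂ f W ≫ act₂₀ g W = (f ≫ g) ▷ W ≫ (λ_ W).hom := by
  simp [act₁₂, act₂₀]

theorem act₂₁_act₁₂ {X Y X' Y' Z : C} (f : X ⊗ Y ⟶ Z) (g : Z ⟶ X' ⊗ Y') (W : C) :
    act₂₁ f W ≫ act₁₂ g W = act₂₂ (f ≫ g) W := by
  simp [act₁₂, act₂₁, act₂₂]

theorem act₂₀_act₀₂ {X Y X' Y' : C} (f : X ⊗ Y ⟶ 𝟙_ C) (g : 𝟙_ C ⟶ X' ⊗ Y') (W : C) :
    act₂₀ f W ≫ act₀₂ g W = act₂₂ (f ≫ g) W := by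
  simp [act₂₀, act₀₂, act₂₂]

theorem act₂₂_comp {X Y X' Y' X'' Y'' : C} (f : X ⊗ Y ⟶ X' ⊗ Y') (g : X' ⊗ Y' ⟶ X'' ⊗ Y'')
    (W : C) : act₂₂ (f ≫ g) W = act₂₂ f W ≫ act₂₂ g W := by
  simp [act₂₂]

theorem act₂₁_assoc {X Y Z A B V : C} (f : Y ⊗ Z ⟶ A) (g : X ⊗ A ⟶ V) (f' : X ⊗ Y ⟶ B)
    (g' : B ⊗ Z ⟶ V) (h : X ◁ f ≫ g = (α_ X Y Z).inv ≫ f' ▷ Z ≫ g') (W : C) :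
    X ◁ act₂₁ f W ≫ act₂₁ g W = act₂₁ f' _ ≫ act₂₁ g' W := by
  have h1 : X ◁ act₂₁ f W ≫ act₂₁ g W =
      X ◁ (α_ _ _ _).inv ≫ (α_ _ _ _).inv ≫ (X ◁ f ≫ g) ▷ W := by
    simp [act₂₁]
  rw [h1, h]
  simp [act₂₁]

namespace WebData

variable (D : WebData C)

theorem barUp_act (k : ℕ) (W : C) : act₂₂ (D.barUp k) W =
    act₀₂ (D.cup 1) _ ≫ D.obj 1 ◁ act₂₁ (D.mergeL k) _ ≫ D.obj 1 ◁ act₁₂ (D.splitL k) _ ≫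
      D.obj 1 ◁ D.obj 1 ◁ act₂₀ (D.cap k) W := by
  simp only [act₀₂, act₂₀, act₂₁, act₁₂, act₂₂, barUp]
  monoidal

theorem barDown_act (j : ℕ) (W : C) : act₂₂ (D.barDown j) W =
    act₁₂ (D.splitL j) _ ≫ D.obj 1 ◁ D.obj j ◁ act₁₂ (D.splitR j) W ≫
      D.obj 1 ◁ act₂₀ (D.cap j) _ := by
  simp only [act₂₀, act₁₂, act₂₂, barDown, MonoidalCategory.tensorHom_def]
  monoidal

end WebData

section Linear

variable [Preadditive C] [MonoidalPreadditive C]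

theorem act₂₂_add {X Y X' Y' : C} (f g : X ⊗ Y ⟶ X' ⊗ Y') (W : C) :
    act₂₂ (f + g) W = act₂₂ f W + act₂₂ g W := by
  simp [act₂₂]

theorem act₂₂_sub {X Y X' Y' : C} (f g : X ⊗ Y ⟶ X' ⊗ Y') (W : C) :
    act₂₂ (f - g) W = act₂₂ f W - act₂₂ g W := by
  have h : (f - g) ▷ W = f ▷ W - g ▷ W := (tensorRight W).map_sub
  simp [act₂₂, h]

theorem act₂₂_smul {R : Type*} [CommRing R] [Linear R C] [MonoidalLinear R C] {X Y X' Y' : C}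
    (r : R) (f : X ⊗ Y ⟶ X' ⊗ Y') (W : C) : act₂₂ (r • f) W = r • act₂₂ f W := by
  simp [act₂₂]

end Linear

end Act

/-! ### The web category as a web action -/

section WebAction

variable (R : Type u) [CommRing R] [Algebra QRing R] (m : ℕ)

/-- The web category acting on itself by tensoring on the left. -/
def webAction : WebAction R (Web R m) (algebraMap QRing R (circleCoeff m))
    (fun k => algebraMap QRing R (bigonCoeff (k + 1)))
    (fun j => algebraMap QRing R (ladderCoeff m (j + 1)))
    (fun j => algebraMap QRing R (cupcapCoeff m (j + 1))) where
  A k := tensorLeft ((web R m).obj k)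
  additive k := inferInstance
  linear k := inferInstance
  z W := λ_ W
  z_nat f := leftUnitor_naturality f
  cu k W := act₀₂ ((web R m).cup k) W
  cu_nat k _ _ f := act₀₂_nat _ f
  ca k W := act₂₀ ((web R m).cap k) W
  ca_nat k _ _ f := act₂₀_nat _ f
  mL k W := act₂₁ ((web R m).mergeL k) W
  mL_nat k _ _ f := act₂₁_nat _ f
  mR k W := act₂₁ ((web R m).mergeR k) W
  mR_nat k _ _ f := act₂₁_nat _ f
  sL k W := act₁₂ ((web R m).splitL k) W
  sL_nat k _ _ f := act₁₂_nat _ f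
  sR k W := act₁₂ ((web R m).splitR k) W
  sR_nat k _ _ f := act₁₂_nat _ f
  cu_zero W := by
    have h : (web R m).cup 0 = (λ_ (𝟙_ (Web R m))).inv := Quot.sound (.rel _ _ WebRel.erase_cup)
    rw [h]
    exact (by simp [act₀₂] : act₀₂ (λ_ (𝟙_ (Web R m))).inv W = (λ_ W).inv ≫ (λ_ _).inv)
  ca_zero W := by
    have h : (web R m).cap 0 = (λ_ (𝟙_ (Web R m))).hom := Quot.sound (.rel _ _ WebRel.erase_cap)
    rw [h]
    exact (by simp [act₂₀] : act₂₀ (λ_ (𝟙_ (Web R m))).hom W = (λ_ _).hom ≫ (λ_ W).hom)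
  mL_zero W := by
    have h : (web R m).mergeL 0 = (ρ_ ((web R m).obj 1)).hom :=
      Quot.sound (.rel _ _ WebRel.erase_mergeL)
    rw [h]
    exact (by simp [act₂₁] :
      act₂₁ (ρ_ ((web R m).obj 1)).hom W = (web R m).obj 1 ◁ (λ_ W).hom)
  mR_zero W := by
    have h : (web R m).mergeR 0 = (λ_ ((web R m).obj 1)).hom :=
      Quot.sound (.rel _ _ WebRel.erase_mergeR)
    rw [h]
    exact (by simp [act₂₁] : act₂₁ (λ_ ((web R m).obj 1)).hom W = (λ_ _).hom)
  snakeL k W := by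
    have h : snakeLeft ((web R m).cup k) ((web R m).cap k) = 𝟙 _ :=
      Quot.sound (.rel _ _ (WebRel.snakeLeft k))
    exact snakeLeft_act h W
  snakeR k W := by
    have h : snakeRight ((web R m).cup k) ((web R m).cap k) = 𝟙 _ :=
      Quot.sound (.rel _ _ (WebRel.snakeRight k))
    exact snakeRight_act h W
  sL_left k W := rotLeft_act _ _ _ _ W
  sL_right k W := by
    -- The split is by definition a left rotation; the pivotal relation also makes it a right one.
    have h : (web R m).splitL k = rotRight ((web R m).cup k) ((web R m).cup 1)
      ((web R m).cap (k + 1)) ((web R m).mergeR k) := Quot.sound (.rel _ _ (WebRel.pivotalR k))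
    rw [h]
    exact rotRight_act _ _ _ _ W
  sR_left k W := rotLeft_act _ _ _ _ W
  sR_right k W := by
    have h : (web R m).splitR k = rotRight ((web R m).cup 1) ((web R m).cup k)
      ((web R m).cap (k + 1)) ((web R m).mergeL k) := Quot.sound (.rel _ _ (WebRel.pivotalL k))
    rw [h]
    exact rotRight_act _ _ _ _ W
  circle W := by
    have h : (web R m).cup 1 ≫ (web R m).cap 1 = algebraMap QRing R (circleCoeff m) • 𝟙 _ :=
      Quot.sound (.rel _ _ WebRel.circle)
    rw [act₀₂_act₂₀, h]
    simp
  lollipop W := by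
    have h : (web R m).splitL 1 ≫ (web R m).cap 1 = 0 := Quot.sound (.rel _ _ WebRel.lollipop)
    rw [act₁₂_act₂₀, h]
    simp
  bigon k W := by
    have h : (web R m).splitL k ≫ (web R m).mergeL k =
      algebraMap QRing R (bigonCoeff (k + 1)) • 𝟙 _ := Quot.sound (.rel _ _ (WebRel.bigon k))
    rw [act₁₂_act₂₁, h]
    simp
  assoc k W := act₂₁_assoc _ _ _ _ (Quot.sound (.rel _ _ (WebRel.assoc k))) W
  exchange j W := by
    have h : (web R m).barUp (j + 1) = (web R m).barDown j ≫ (web R m).dumbbell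
          - algebraMap QRing R (ladderCoeff m (j + 1)) • (web R m).barDown j
          + algebraMap QRing R (cupcapCoeff m (j + 1)) •
              ((web R m).cap (j + 1) ≫ (web R m).cup 1) :=
      Quot.sound (.rel _ _ (WebRel.exchange j))
    have h' := congrArg (act₂₂ · W) h
    simp only [act₂₂_add, act₂₂_sub, act₂₂_smul, act₂₂_comp, WebData.dumbbell,
      WebData.barUp_act, WebData.barDown_act] at h'
    rw [← act₂₁_act₁₂, ← act₂₀_act₀₂] at h'
    exact h'

theorem webAction_br (W : Web R m) :
    (webAction R m).br (algebraMap QRing R ↑(qq ^ (2 : ℤ))) (algebraMap QRing R (braidCoeff m)) W =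
      act₂₂ (webBraiding R m) W := by
  rw [webBraiding, act₂₂_sub, act₂₂_sub, act₂₂_smul, act₂₂_smul, WebData.dumbbell,
    ← act₂₁_act₁₂, ← act₂₀_act₀₂]
  have : act₂₂ (𝟙 ((web R m).obj 1 ⊗ (web R m).obj 1)) W = 𝟙 _ := by simp [act₂₂]
  rw [this]
  rfl

end WebAction

/-! ### The coefficients -/

section Coefficients

theorem val_qDbl (n : ℤ) : (qDbl n : QRing) = ↑(qq ^ n) + ↑(qq ^ (-n)) := rfl

/-- The coefficient of the cup-cap in the inverse of the braiding. -/
noncomputable def braidCoeff' (m : ℕ) : QRing :=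
  -(↑(qDbl ((m : ℤ) - 2))⁻¹ * skeinCoeff * ↑(qq ^ ((m : ℤ) - 2)))

theorem qq_zpow_mul (a b : ℤ) : (↑(qq ^ a) : QRing) * ↑(qq ^ b) = ↑(qq ^ (a + b)) := by
  rw [zpow_add, Units.val_mul]

theorem qDbl_mul_qDbl (a b : ℤ) : (qDbl a : QRing) * qDbl b = qDbl (a + b) + qDbl (a - b) := by
  simp only [val_qDbl, add_mul, mul_add, qq_zpow_mul]
  ring_nf

theorem skeinCoeff_mul_skeinCoeff : skeinCoeff * skeinCoeff = (qDbl 4 : QRing) - 2 := by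
  simp only [skeinCoeff, val_qDbl, sub_mul, mul_sub, qq_zpow_mul]
  norm_num
  ring

theorem qInt_mul_skeinCoeff (n : ℕ) :
    qInt n * skeinCoeff = (↑(qq ^ (n : ℤ)) - ↑(qq ^ (-(n : ℤ)))) * qDbl 1 := by
  have h : skeinCoeff = ((qq : QRing) - ↑qq⁻¹) * qDbl 1 := by
    have h1 : (qq : QRing) = ↑(qq ^ (1 : ℤ)) := by simp
    have h2 : (↑qq⁻¹ : QRing) = ↑(qq ^ (-1 : ℤ)) := by simp
    simp only [h1, h2, val_qDbl, sub_mul, mul_add, qq_zpow_mul, skeinCoeff]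
    norm_num
  rw [h, ← mul_assoc, qInt_mul]

/-- Since q - q⁻¹ vanishes at q = 1, it cannot be inverted in 𝔸. The circle value is therefore
handled through its product with q² - q⁻², where the quantum integer takes closed form. -/
theorem circleCoeff_mul_skeinCoeff (m : ℕ) : circleCoeff m * skeinCoeff =
    (↑(qq ^ (m : ℤ)) - ↑(qq ^ (-(m : ℤ)))) * qDbl (m - 2) := by
  rw [circleCoeff, mul_right_comm, mul_assoc (qDbl _ : QRing), qInt_mul_skeinCoeff]
  rw [← mul_assoc, Units.mul_inv_cancel_right, mul_comm]

/-- Multiplying [n + 1] by qⁿ gives a polynomial whose value at q = 1 is n + 1, nonzero in ℂ. -/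
theorem isUnit_qInt {n : ℕ} (hn : n ≠ 0) : IsUnit (qInt n) := by
  obtain ⟨n, rfl⟩ := Nat.exists_eq_succ_of_ne_zero hn
  have h : (↑(qq ^ (n : ℤ)) : QRing) * qInt (n + 1) =
      algebraMap (Polynomial ℂ) QRing (∑ i ∈ Finset.range (n + 1), Polynomial.X ^ (2 * (n - i))) := by
    rw [qInt, Finset.mul_sum, map_sum]
    refine Finset.sum_congr rfl fun i hi => ?_
    have hi' : i ≤ n := by simpa [Nat.lt_succ_iff] using hi
    have e : (n : ℤ) + (((n + 1 : ℕ) : ℤ) - 1 - 2 * i) = ((2 * (n - i) : ℕ) : ℤ) := by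
      push_cast [hi']; ring
    rw [qq_zpow_mul, e, zpow_natCast, map_pow, Units.val_pow_eq_pow_val]
    rfl
  have hu : IsUnit ((↑(qq ^ (n : ℤ)) : QRing) * qInt (n + 1)) := by
    rw [h]
    refine isUnit_of_eval ?_
    simp only [Polynomial.eval_finsetSum, Polynomial.eval_pow, Polynomial.eval_X, one_pow,
      Finset.sum_const, Finset.card_range, nsmul_eq_mul, mul_one]
    exact_mod_cast Nat.succ_ne_zero n
  exact (IsUnit.mul_iff.1 hu).2

theorem isUnit_bigonCoeff {k : ℕ} (hk : k ≠ 0) : IsUnit (bigonCoeff k) :=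
  (isUnit_qInt (by omega)).mul (Units.isUnit _)

/-- Indices are shifted: entries 0 and 1 of the coefficient sequences belong to k = 1 and k = 2.
With {n} = qⁿ + q⁻ⁿ, the required values are a₀ = {m-4}/{m-2}, a₁ = {m-6}/{m-4}, b₁ = {m-6}/{m-2}.
-/
theorem isBraidCoeff_qq (m : ℕ) : IsBraidCoeff (circleCoeff m) (fun k => bigonCoeff (k + 1))
    (fun j => ladderCoeff m (j + 1)) (fun j => cupcapCoeff m (j + 1))
    (↑(qq ^ (2 : ℤ)) : QRing) (↑(qq ^ (-2 : ℤ))) (braidCoeff m) (braidCoeff' m) := by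
  have e1 : (m : ℤ) - 2 * ((0 + 1 : ℕ) : ℤ) = m - 2 := by norm_num
  have e2 : (m : ℤ) - 2 - 2 = m - 4 := by ring
  have e3 : (m : ℤ) - 2 * ((1 + 1 : ℕ) : ℤ) = m - 4 := by norm_num
  have e4 : (m : ℤ) - 4 - 2 = m - 6 := by ring
  have hb : bigonCoeff (1 + 1) = (↑(qq ^ (2 : ℤ)) : QRing) + ↑(qq ^ (-2 : ℤ)) := by
    rw [bigonCoeff, Units.mul_inv_eq_iff_eq_mul]
    simp only [val_qDbl, qInt, Finset.sum_range_succ, Finset.sum_range_zero, add_mul, mul_add,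
      qq_zpow_mul]
    norm_num
    ring
  have ha0 : ladderCoeff m (0 + 1) = qDbl (m - 4) * ↑(qDbl (m - 2))⁻¹ := by
    rw [ladderCoeff, e1, e2]
  have ha1 : ladderCoeff m (1 + 1) = qDbl (m - 6) * ↑(qDbl (m - 4))⁻¹ := by
    rw [ladderCoeff, e3, e4]
  have hb1 : cupcapCoeff m (1 + 1) = qDbl (m - 6) * ↑(qDbl (m - 2))⁻¹ := by
    rw [cupcapCoeff, e3, e4]
  have h1 : (↑(qDbl (m - 2))⁻¹ : QRing) * qDbl (m - 2) = 1 := Units.inv_mul _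
  have h2 : (↑(qDbl (m - 4))⁻¹ : QRing) * qDbl (m - 4) = 1 := Units.inv_mul _
  refine ⟨?_, hb, ?_, ?_, ?_, ?_, ?_, ?_⟩
  · rw [qq_zpow_mul]; simp
  · simp [cupcapCoeff, ladderCoeff]
  · show cupcapCoeff m (1 + 1) - ladderCoeff m (0 + 1) * bigonCoeff (1 + 1) = -1
    -- The product formula {m-4}{2} = {m-2} + {m-6}.
    have h := qDbl_mul_qDbl (m - 4) 2
    rw [show (m : ℤ) - 4 + 2 = m - 2 by ring, e4] at h
    rw [hb1, ha0, hb, ← val_qDbl]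
    linear_combination (-(↑(qDbl (m - 2))⁻¹ : QRing)) * h - h1
  · show ladderCoeff m (0 + 1) - braidCoeff m = _
    have h : (qDbl (m - 4) : QRing) - skeinCoeff * ↑(qq ^ (2 - (m : ℤ))) =
        ↑(qq ^ (-2 : ℤ)) * qDbl (m - 2) := by
      simp only [skeinCoeff, val_qDbl, sub_mul, mul_add, qq_zpow_mul]
      ring_nf
    rw [ha0, braidCoeff]
    linear_combination (↑(qDbl (m - 2))⁻¹ : QRing) * h + (↑(qq ^ (-2 : ℤ)) : QRing) * h1
  · show ladderCoeff m (0 + 1) - braidCoeff' m = _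
    have h : (qDbl (m - 4) : QRing) + skeinCoeff * ↑(qq ^ ((m : ℤ) - 2)) =
        ↑(qq ^ (2 : ℤ)) * qDbl (m - 2) := by
      simp only [skeinCoeff, val_qDbl, sub_mul, mul_add, qq_zpow_mul]
      ring_nf
    rw [ha0, braidCoeff']
    linear_combination (↑(qDbl (m - 2))⁻¹ : QRing) * h + (↑(qq ^ (2 : ℤ)) : QRing) * h1
  · show braidCoeff m * braidCoeff' m =
      ladderCoeff m (0 + 1) * (ladderCoeff m (0 + 1) - ladderCoeff m (1 + 1))
    -- Both sides equal -(q² - q⁻²)²/{m-2}², because {m-4}² - {m-2}{m-6} = 2 - {4}.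
    have h3 := qDbl_mul_qDbl (m - 4) (m - 4)
    have h4 := qDbl_mul_qDbl (m - 2) (m - 6)
    have h5 : (qDbl (0 : ℤ) : QRing) = 2 := by simp [val_qDbl]; norm_num
    have h6 : (↑(qq ^ (2 - (m : ℤ))) : QRing) * ↑(qq ^ ((m : ℤ) - 2)) = 1 := by
      rw [qq_zpow_mul]; simp
    rw [sub_self, h5] at h3
    rw [show (m : ℤ) - 2 + (m - 6) = m - 4 + (m - 4) by ring,
      show (m : ℤ) - 2 - (m - 6) = 4 by ring] at h4
    have h7 := skeinCoeff_mul_skeinCoeff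
    rw [ha0, ha1, braidCoeff, braidCoeff']
    set n : QRing := ↑(qDbl (m - 2))⁻¹
    linear_combination (-(n ^ 2) * skeinCoeff * skeinCoeff) * h6 - n ^ 2 * h7 - n ^ 2 * h3
      + n ^ 2 * h4 + n * (qDbl (m - 6) : QRing) * h2 - n * (qDbl (m - 6) : QRing) * h1
  · have h3 : (↑(qq ^ (2 : ℤ)) : QRing) * ↑(qq ^ ((m : ℤ) - 2)) = ↑(qq ^ (m : ℤ)) := by
      rw [qq_zpow_mul]; ring_nf
    have h4 : (↑(qq ^ (-2 : ℤ)) : QRing) * ↑(qq ^ (2 - (m : ℤ))) = ↑(qq ^ (-(m : ℤ))) := by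
      rw [qq_zpow_mul]; ring_nf
    have h6 : (↑(qq ^ (2 - (m : ℤ))) : QRing) * ↑(qq ^ ((m : ℤ) - 2)) = 1 := by
      rw [qq_zpow_mul]; simp
    rw [braidCoeff, braidCoeff']
    set n : QRing := ↑(qDbl (m - 2))⁻¹
    linear_combination (-(n * skeinCoeff)) * h3 + n * skeinCoeff * h4
      + n ^ 2 * skeinCoeff * circleCoeff_mul_skeinCoeff m + n ^ 2 * skeinCoeff ^ 2 * circleCoeff m * h6
      + n * skeinCoeff * (↑(qq ^ (m : ℤ)) - ↑(qq ^ (-(m : ℤ)))) * h1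

theorem IsBraidCoeff.map {R S : Type*} [CommRing R] [CommRing S] (φ : R →+* S) {δ : R}
    {u a b : ℕ → R} {q q' c c' : R} (h : IsBraidCoeff δ u a b q q' c c') :
    IsBraidCoeff (φ δ) (fun k => φ (u k)) (fun k => φ (a k)) (fun k => φ (b k))
      (φ q) (φ q') (φ c) (φ c') where
  inv := by rw [← map_mul, h.inv, map_one]
  bigon := by rw [h.bigon, map_add]
  cupcap := by rw [h.cupcap]
  ladder := by rw [← map_mul, ← map_sub, h.ladder, map_neg, map_one]
  left := by rw [← map_sub, h.left]
  right := by rw [← map_sub, h.right]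
  mul := by rw [← map_mul, h.mul, map_mul, map_sub]
  circle := by rw [← map_mul, ← map_mul, ← map_add, h.circle, map_mul, map_mul]

theorem isBraidCoeff (R : Type*) [CommRing R] [Algebra QRing R] (m : ℕ) :
    IsBraidCoeff (algebraMap QRing R (circleCoeff m))
      (fun k => algebraMap QRing R (bigonCoeff (k + 1)))
      (fun j => algebraMap QRing R (ladderCoeff m (j + 1)))
      (fun j => algebraMap QRing R (cupcapCoeff m (j + 1)))
      (algebraMap QRing R ↑(qq ^ (2 : ℤ))) (algebraMap QRing R ↑(qq ^ (-2 : ℤ)))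
      (algebraMap QRing R (braidCoeff m)) (algebraMap QRing R (braidCoeff' m)) :=
  (isBraidCoeff_qq m).map (algebraMap QRing R)

theorem curl_coeff (m : ℕ) :
    (↑(qq ^ (-2 : ℤ)) : QRing) - braidCoeff' m * circleCoeff m = ↑(qq ^ (2 * (m : ℤ) - 2)) := by
  have h1 : (↑(qDbl (m - 2))⁻¹ : QRing) * qDbl (m - 2) = 1 := Units.inv_mul _
  have h3 : (↑(qq ^ (m : ℤ)) : QRing) * ↑(qq ^ ((m : ℤ) - 2)) = ↑(qq ^ (2 * (m : ℤ) - 2)) := by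
    rw [qq_zpow_mul]; ring_nf
  have h4 : (↑(qq ^ (-(m : ℤ))) : QRing) * ↑(qq ^ ((m : ℤ) - 2)) = ↑(qq ^ (-2 : ℤ)) := by
    rw [qq_zpow_mul]; ring_nf
  rw [braidCoeff']
  set n : QRing := ↑(qDbl (m - 2))⁻¹
  linear_combination n * (↑(qq ^ ((m : ℤ) - 2)) : QRing) * circleCoeff_mul_skeinCoeff m + h3 - h4
    + (↑(qq ^ ((m : ℤ) - 2)) : QRing) * (↑(qq ^ (m : ℤ)) - ↑(qq ^ (-(m : ℤ)))) * h1

theorem skeinCoeff_eq (m : ℕ) : skeinCoeff = braidCoeff m - braidCoeff' m := by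
  have h := isBraidCoeff_qq m
  rw [skeinCoeff]
  linear_combination h.left - h.right

end Coefficients

/-! ### Regrouping strands -/

section Regroup

variable {C : Type*} [Category C] [MonoidalCategory C]

/-- A class of objects and a class of morphisms, closed under composition and linear
combinations. -/
structure IsLinearClass (R : Type*) [CommRing R] [Preadditive C] [Linear R C] (O : C → Prop)
    (S : ∀ {X Y : C}, (X ⟶ Y) → Prop) : Prop where
  id {W : C} : O W → S (𝟙 W)
  comp {X Y Z : C} {f : X ⟶ Y} {g : Y ⟶ Z} : S f → S g → S (f ≫ g)
  zero {X Y : C} : O X → O Y → S (0 : X ⟶ Y)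
  add {X Y : C} {f g : X ⟶ Y} : S f → S g → S (f + g)
  smul {X Y : C} (r : R) {f : X ⟶ Y} : S f → S (r • f)

/-- A functor `F` and natural maps that exhibit `X ⊗ W`, up to a scalar, as a retract of `F W`,
compatible with a class of objects and of morphisms. -/
structure Regroup (R : Type*) [CommRing R] [Preadditive C] [Linear R C] (O : C → Prop)
    (S : ∀ {X Y : C}, (X ⟶ Y) → Prop) (X : C) where
  F : C ⥤ C
  s (W : C) : X ⊗ W ⟶ F.obj W
  p (W : C) : F.obj W ⟶ X ⊗ W
  s_nat {W V : C} (f : W ⟶ V) : X ◁ f ≫ s V = s W ≫ F.map f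
  id_eq : ∃ v : R, ∀ W, 𝟙 (X ⊗ W) = v • (s W ≫ p W)
  obj {W : C} : O W → O (F.obj W)
  map {W V : C} {f : W ⟶ V} : S f → S (F.map f)
  idem {W : C} : O W → S (p W ≫ s W)

namespace Regroup

variable {R : Type*} [CommRing R] [Preadditive C] [Linear R C] {O : C → Prop}
  {S : ∀ {X Y : C}, (X ⟶ Y) → Prop}

/-- Morphisms `f` such that `f ▷ W` is in the class after regrouping. -/
def Sees {X Y : C} (ρ : Regroup R O S X) (σ : Regroup R O S Y) (f : X ⟶ Y) : Prop :=
  ∀ W : C, O W → S (ρ.p W ≫ f ▷ W ≫ σ.s W)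

/-- The trivial regrouping of the unit. -/
def unit (h : IsLinearClass R O S) : Regroup R O S (𝟙_ C) where
  F := 𝟭 C
  s W := (λ_ W).hom
  p W := (λ_ W).inv
  s_nat f := leftUnitor_naturality f
  id_eq := ⟨1, fun W => by simp⟩
  obj hW := hW
  map hf := hf
  idem {W} hW := by rw [Iso.inv_hom_id]; exact h.id hW

variable {X Y Z X' Y' : C} {ρ : Regroup R O S X} {σ : Regroup R O S Y} {τ : Regroup R O S Z}
  {ρ' : Regroup R O S X'} {σ' : Regroup R O S Y'}

theorem sees_id : ρ.Sees ρ (𝟙 X) := fun W hW => by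
  simpa using ρ.idem hW

/-- The identity of the intermediate object, written as a multiple of `s ≫ p`, is inserted between f
and g. -/
theorem Sees.comp (h : IsLinearClass R O S) {f : X ⟶ Y} {g : Y ⟶ Z} (hf : ρ.Sees σ f)
    (hg : σ.Sees τ g) : ρ.Sees τ (f ≫ g) := fun W hW => by
  obtain ⟨v, hv⟩ := σ.id_eq
  have h1 : ρ.p W ≫ (f ≫ g) ▷ W ≫ τ.s W = ρ.p W ≫ f ▷ W ≫ 𝟙 _ ≫ g ▷ W ≫ τ.s W := by simp
  have h2 : ρ.p W ≫ (f ≫ g) ▷ W ≫ τ.s W =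
      v • ((ρ.p W ≫ f ▷ W ≫ σ.s W) ≫ (σ.p W ≫ g ▷ W ≫ τ.s W)) := by
    rw [h1, hv]
    simp
  rw [h2]
  exact h.smul _ (h.comp (hf W hW) (hg W hW))

/-- Acting on the unit recovers f, provided the outer regrouping maps are in the class. For standard
objects they are. -/
theorem Sees.mem (h : IsLinearClass R O S) {f : X ⟶ Y} (hf : ρ.Sees σ f) (hO : O (𝟙_ C))
    (hX : S ((ρ_ X).inv ≫ ρ.s _)) (hY : S (σ.p _ ≫ (ρ_ Y).hom)) : S f := by
  obtain ⟨v, hv⟩ := ρ.id_eq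
  obtain ⟨w, hw⟩ := σ.id_eq
  have h2 : f = (ρ_ X).inv ≫ 𝟙 _ ≫ f ▷ 𝟙_ _ ≫ 𝟙 _ ≫ (ρ_ Y).hom := by simp
  have h3 : f = (w * v) • (((ρ_ X).inv ≫ ρ.s _) ≫ (ρ.p _ ≫ f ▷ 𝟙_ _ ≫ σ.s _) ≫
      (σ.p _ ≫ (ρ_ Y).hom)) := by
    refine h2.trans ?_
    rw [hv, hw]
    simp [mul_smul]
  rw [h3]
  exact h.smul _ (h.comp hX (h.comp (hf _ hO) hY))

variable [MonoidalPreadditive C]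

theorem Sees.add (h : IsLinearClass R O S) {f g : X ⟶ Y} (hf : ρ.Sees σ f) (hg : ρ.Sees σ g) :
    ρ.Sees σ (f + g) := fun W hW => by
  simpa using h.add (hf W hW) (hg W hW)

theorem sees_zero (h : IsLinearClass R O S) : ρ.Sees σ 0 := fun W hW => by
  simpa using h.zero (ρ.obj hW) (σ.obj hW)

variable [MonoidalLinear R C]

theorem Sees.smul (h : IsLinearClass R O S) (r : R) {f : X ⟶ Y} (hf : ρ.Sees σ f) :
    ρ.Sees σ (r • f) := fun W hW => by
  simpa using h.smul r (hf W hW)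

/-- Regrouping a tensor product. -/
def tensor (h : IsLinearClass R O S) (ρ : Regroup R O S X)
    (σ : Regroup R O S Y) : Regroup R O S (X ⊗ Y) where
  F := σ.F ⋙ ρ.F
  s W := (α_ _ _ _).hom ≫ X ◁ σ.s W ≫ ρ.s _
  p W := ρ.p _ ≫ X ◁ σ.p W ≫ (α_ _ _ _).inv
  s_nat f := by
    have h1 := congrArg (X ◁ ·) (σ.s_nat f)
    simp only [MonoidalCategory.whiskerLeft_comp] at h1
    simp [reassoc_of% h1, ← ρ.s_nat]
  id_eq := by
    obtain ⟨v, hv⟩ := ρ.id_eq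
    obtain ⟨w, hw⟩ := σ.id_eq
    refine ⟨w * v, fun W => ?_⟩
    have h1 : 𝟙 ((X ⊗ Y) ⊗ W) = (α_ _ _ _).hom ≫ X ◁ 𝟙 (Y ⊗ W) ≫ (α_ _ _ _).inv := by simp
    have h2 : X ◁ (σ.s W ≫ σ.p W) = X ◁ σ.s W ≫ 𝟙 _ ≫ X ◁ σ.p W := by simp
    rw [h1, hw W, MonoidalLinear.whiskerLeft_smul, h2, hv]
    simp [mul_smul]
  obj hW := ρ.obj (σ.obj hW)
  map hf := ρ.map (σ.map hf)
  idem {W} hW := by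
    have h1 : (ρ.p (σ.F.obj W) ≫ X ◁ σ.p W ≫ (α_ X Y W).inv) ≫
        (α_ X Y W).hom ≫ X ◁ σ.s W ≫ ρ.s (σ.F.obj W) =
        (ρ.p _ ≫ ρ.s _) ≫ ρ.F.map (σ.p W ≫ σ.s W) := by
      simp only [Category.assoc, Iso.inv_hom_id_assoc]
      rw [← ρ.s_nat, MonoidalCategory.whiskerLeft_comp, Category.assoc]
    rw [h1]
    exact h.comp (ρ.idem (σ.obj hW)) (ρ.map (σ.idem hW))

/-- Naturality of `s` pushes the regrouped g through the functor of the first factor, which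
separates the two morphisms. -/
theorem Sees.tensor (h : IsLinearClass R O S) {f : X ⟶ Y} {g : X' ⟶ Y'} (hf : ρ.Sees σ f)
    (hg : ρ'.Sees σ' g) : (ρ.tensor h ρ').Sees (σ.tensor h σ') (f ⊗ₘ g) := fun W hW => by
  have h1 : (ρ.tensor h ρ').p W ≫ (f ⊗ₘ g) ▷ W ≫ (σ.tensor h σ').s W =
      (ρ.p _ ≫ f ▷ _ ≫ σ.s _) ≫ σ.F.map (ρ'.p W ≫ g ▷ W ≫ σ'.s W) := by
    have h2 : ρ.p (ρ'.F.obj W) ≫ f ▷ ρ'.F.obj W ≫ Y ◁ (ρ'.p W ≫ g ▷ W ≫ σ'.s W) ≫ σ.s _ =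
        ρ.p (ρ'.F.obj W) ≫ X ◁ (ρ'.p W ≫ g ▷ W ≫ σ'.s W) ≫ f ▷ _ ≫ σ.s _ := by
      rw [whisker_exchange_assoc]
    simp only [Category.assoc]
    rw [← σ.s_nat, h2]
    show (ρ.p (ρ'.F.obj W) ≫ X ◁ ρ'.p W ≫ (α_ X X' W).inv) ≫ (f ⊗ₘ g) ▷ W ≫
      (α_ Y Y' W).hom ≫ Y ◁ σ'.s W ≫ σ.s (σ'.F.obj W) = _
    rw [MonoidalCategory.tensorHom_def']
    simp [whisker_exchange_assoc]
  rw [h1]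
  exact h.comp (hf _ (ρ'.obj hW)) (σ.map (hg W hW))

theorem sees_of_act₀₂ (h : IsLinearClass R O S) {f : 𝟙_ C ⟶ X ⊗ Y}
    (hf : ∀ {W : C}, O W → S (act₀₂ f W ≫ X ◁ σ.s W ≫ ρ.s _)) :
    (unit h).Sees (ρ.tensor h σ) f := fun W hW => by
  have h1 : act₀₂ f W ≫ X ◁ σ.s W ≫ ρ.s _ =
      (λ_ W).inv ≫ f ▷ W ≫ (α_ _ _ W).hom ≫ X ◁ σ.s W ≫ ρ.s _ := by simp [act₀₂]
  exact h1 ▸ hf hW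

theorem sees_of_act₂₀ (h : IsLinearClass R O S) {f : X ⊗ Y ⟶ 𝟙_ C}
    (hf : ∀ {W : C}, O W → S (ρ.p _ ≫ X ◁ σ.p W ≫ act₂₀ f W)) :
    (ρ.tensor h σ).Sees (unit h) f := fun W hW => by
  have h1 : ρ.p _ ≫ X ◁ σ.p W ≫ act₂₀ f W =
      (ρ.p _ ≫ X ◁ σ.p W ≫ (α_ _ _ W).inv) ≫ f ▷ W ≫ (λ_ W).hom := by simp [act₂₀]
  exact h1 ▸ hf hW

theorem sees_of_act₂₁ (h : IsLinearClass R O S) {f : X ⊗ Y ⟶ Z}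
    (hf : ∀ {W : C}, O W → S (ρ.p _ ≫ X ◁ σ.p W ≫ act₂₁ f W ≫ τ.s W)) :
    (ρ.tensor h σ).Sees τ f := fun W hW => by
  have h1 : ρ.p _ ≫ X ◁ σ.p W ≫ act₂₁ f W ≫ τ.s W =
      (ρ.p _ ≫ X ◁ σ.p W ≫ (α_ _ _ W).inv) ≫ f ▷ W ≫ τ.s W := by simp [act₂₁]
  exact h1 ▸ hf hW

/-- Both bracketings regroup into the same composite functor, so the associator is absorbed into `s`
and only `p ≫ s` remains. The unitors behave likewise. -/
theorem sees_associator_hom (h : IsLinearClass R O S) :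
    ((ρ.tensor h σ).tensor h τ).Sees (ρ.tensor h (σ.tensor h τ)) (α_ X Y Z).hom := fun W hW => by
  have h1 : (α_ X Y Z).hom ▷ W ≫ (ρ.tensor h (σ.tensor h τ)).s W =
    ((ρ.tensor h σ).tensor h τ).s W := by
    show (α_ X Y Z).hom ▷ W ≫ (α_ X (Y ⊗ Z) W).hom ≫
        X ◁ ((α_ Y Z W).hom ≫ Y ◁ τ.s W ≫ σ.s _) ≫ ρ.s (σ.F.obj (τ.F.obj W)) =
      (α_ (X ⊗ Y) Z W).hom ≫ (X ⊗ Y) ◁ τ.s W ≫ (α_ X Y _).hom ≫ X ◁ σ.s _ ≫ ρ.s _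
    simp
  rw [h1]
  exact ((ρ.tensor h σ).tensor h τ).idem hW

theorem sees_associator_inv (h : IsLinearClass R O S) :
    (ρ.tensor h (σ.tensor h τ)).Sees ((ρ.tensor h σ).tensor h τ) (α_ X Y Z).inv := fun W hW => by
  have h1 : (α_ X Y Z).inv ▷ W ≫ ((ρ.tensor h σ).tensor h τ).s W =
    (ρ.tensor h (σ.tensor h τ)).s W := by
    show (α_ X Y Z).inv ▷ W ≫ (α_ (X ⊗ Y) Z W).hom ≫ (X ⊗ Y) ◁ τ.s W ≫ (α_ X Y _).hom ≫
        X ◁ σ.s _ ≫ ρ.s _ =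
      (α_ X (Y ⊗ Z) W).hom ≫ X ◁ ((α_ Y Z W).hom ≫ Y ◁ τ.s W ≫ σ.s _) ≫
        ρ.s (σ.F.obj (τ.F.obj W))
    simp
  rw [h1]
  exact (ρ.tensor h (σ.tensor h τ)).idem hW

theorem sees_leftUnitor_hom (h : IsLinearClass R O S) :
    ((unit h).tensor h ρ).Sees ρ (λ_ X).hom := fun W hW => by
  have h1 : (λ_ X).hom ▷ W ≫ ρ.s W = ((unit h).tensor h ρ).s W := by
    show (λ_ X).hom ▷ W ≫ ρ.s W = (α_ _ X W).hom ≫ 𝟙_ C ◁ ρ.s W ≫ (λ_ _).hom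
    simp
  rw [h1]
  exact ((unit h).tensor h ρ).idem hW

theorem sees_leftUnitor_inv (h : IsLinearClass R O S) :
    ρ.Sees ((unit h).tensor h ρ) (λ_ X).inv := fun W hW => by
  have h1 : (λ_ X).inv ▷ W ≫ ((unit h).tensor h ρ).s W = ρ.s W := by
    show (λ_ X).inv ▷ W ≫ (α_ _ X W).hom ≫ 𝟙_ C ◁ ρ.s W ≫ (λ_ _).hom = ρ.s W
    simp
  rw [h1]
  exact ρ.idem hW

theorem sees_rightUnitor_hom (h : IsLinearClass R O S) :
    (ρ.tensor h (unit h)).Sees ρ (ρ_ X).hom := fun W hW => by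
  have h1 : (ρ_ X).hom ▷ W ≫ ρ.s W = (ρ.tensor h (unit h)).s W := by
    show (ρ_ X).hom ▷ W ≫ ρ.s W = (α_ X _ W).hom ≫ X ◁ (λ_ W).hom ≫ ρ.s W
    simp
  rw [h1]
  exact (ρ.tensor h (unit h)).idem hW

theorem sees_rightUnitor_inv (h : IsLinearClass R O S) :
    ρ.Sees (ρ.tensor h (unit h)) (ρ_ X).inv := fun W hW => by
  have h1 : (ρ_ X).inv ▷ W ≫ (ρ.tensor h (unit h)).s W = ρ.s W := by
    show (ρ_ X).inv ▷ W ≫ (α_ X _ W).hom ≫ X ◁ (λ_ W).hom ≫ ρ.s W = ρ.s W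
    simp
  rw [h1]
  exact ρ.idem hW

end Regroup

end Regroup

/-! ### Every morphism between standard objects is generated by the crossing, cup and cap -/

section Full

variable (R : Type u) [CommRing R] [Algebra QRing R] (m : ℕ)

namespace IsBraidWeb

variable {R m}

theorem whiskerLeft {X Y Z : Web R m} (hX : IsStd R m X) {f : Y ⟶ Z} (hf : IsBraidWeb R m Y Z f) :
    IsBraidWeb R m _ _ (X ◁ f) := by
  rw [← id_tensorHom]
  exact .tensor _ _ (.id _ hX) hf

theorem whiskerRight {Y Z W : Web R m} {f : Y ⟶ Z} (hf : IsBraidWeb R m Y Z f) (hW : IsStd R m W) :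
    IsBraidWeb R m _ _ (f ▷ W) := by
  rw [← tensorHom_id]
  exact .tensor _ _ hf (.id _ hW)

theorem isStd {X Y : Web R m} {f : X ⟶ Y} (hf : IsBraidWeb R m X Y f) :
    IsStd R m X ∧ IsStd R m Y := by
  induction hf with
  | braiding => exact ⟨.tensor _ _ .one .one, .tensor _ _ .one .one⟩
  | cup => exact ⟨.unit, .tensor _ _ .one .one⟩
  | cap => exact ⟨.tensor _ _ .one .one, .unit⟩
  | id X hX => exact ⟨hX, hX⟩
  | associator_hom X Y Z hX hY hZ =>
    exact ⟨.tensor _ _ (.tensor _ _ hX hY) hZ, .tensor _ _ hX (.tensor _ _ hY hZ)⟩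
  | associator_inv X Y Z hX hY hZ =>
    exact ⟨.tensor _ _ hX (.tensor _ _ hY hZ), .tensor _ _ (.tensor _ _ hX hY) hZ⟩
  | leftUnitor_hom X hX => exact ⟨.tensor _ _ .unit hX, hX⟩
  | leftUnitor_inv X hX => exact ⟨hX, .tensor _ _ .unit hX⟩
  | rightUnitor_hom X hX => exact ⟨.tensor _ _ hX .unit, hX⟩
  | rightUnitor_inv X hX => exact ⟨hX, .tensor _ _ hX .unit⟩
  | comp f g _ _ hf hg => exact ⟨hf.1, hg.2⟩
  | tensor f g _ _ hf hg => exact ⟨.tensor _ _ hf.1 hg.1, .tensor _ _ hf.2 hg.2⟩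
  | zero X Y hX hY => exact ⟨hX, hY⟩
  | add f g _ _ hf _ => exact hf
  | smul r f _ hf => exact hf

end IsBraidWeb

theorem isStdClass : (webAction R m).IsStdClass (algebraMap QRing R ↑(qq ^ (2 : ℤ)))
    (algebraMap QRing R (braidCoeff m)) (IsStd R m) (fun {X Y} f => IsBraidWeb R m X Y f) where
  obj hW := .tensor _ _ .one hW
  id hW := .id _ hW
  comp hf hg := .comp _ _ hf hg
  add hf hg := .add _ _ hf hg
  smul r _ hf := .smul r _ hf
  map hf := .whiskerLeft .one hf
  cu hW := .comp _ _ (.leftUnitor_inv _ hW)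
    (.comp _ _ (.whiskerRight .cup hW) (.associator_hom _ _ _ .one .one hW))
  ca hW := .comp _ _ (.associator_inv _ _ _ .one .one hW)
    (.comp _ _ (.whiskerRight .cap hW) (.leftUnitor_hom _ hW))
  br {W} hW := by
    rw [webAction_br]
    exact .comp _ _ (.associator_inv _ _ _ .one .one hW)
      (.comp _ _ (.whiskerRight .braiding hW) (.associator_hom _ _ _ .one .one hW))

theorem isUnit_map_bigonCoeff (k : ℕ) : IsUnit (algebraMap QRing R (bigonCoeff (k + 1))) :=
  (isUnit_bigonCoeff k.succ_ne_zero).map _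

theorem isLinearClass : IsLinearClass R (IsStd R m) (fun {X Y} f => IsBraidWeb R m X Y f) where
  id hW := .id _ hW
  comp hf hg := .comp _ _ hf hg
  zero hX hY := .zero _ _ hX hY
  add hf hg := .add _ _ hf hg
  smul r _ hf := .smul r _ hf

/-- The regrouping that splits a strand into strands labelled `1`. -/
noncomputable def regroupLabel (k : ℕ) : Regroup R (IsStd R m)
    (fun {X Y} f => IsBraidWeb R m X Y f) ((web R m).obj k) where
  F := (webAction R m).T k
  s W := (webAction R m).I k W
  p W := (webAction R m).P k W
  s_nat f := (webAction R m).I_nat k f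
  id_eq := (webAction R m).id_eq_I_P (isUnit_map_bigonCoeff R) k
  obj hW := (isStdClass R m).obj_T k hW
  map hf := (isStdClass R m).map_T k hf
  idem hW := (isStdClass R m).P_I (isUnit_map_bigonCoeff R) k hW

/-- The regrouping that splits all strands into strands labelled `1`. -/
noncomputable def regroup : ∀ X : TensorWord ℕ+, Regroup R (IsStd R m)
    (fun {X Y} f => IsBraidWeb R m X Y f) (X : Web R m)
  | .unit => .unit (isLinearClass R m)
  | .of ⟨k + 1, _⟩ => regroupLabel R m (k + 1)
  | .tensor X Y => .tensor (isLinearClass R m) (regroup X) (regroup Y)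

/-- Exploding a strand labelled 0 into no strands is the trivial regrouping of the unit, so
generators with k = 0 need no separate treatment. -/
theorem regroup_label (k : ℕ) : regroup R m (label k) = regroupLabel R m k := by
  cases k <;> rfl

theorem sees_gen {X Y : TensorWord ℕ+} (g : WebGen X Y) :
    (regroup R m X).Sees (regroup R m Y) (Quot.mk _ (.gen g)) := by
  have h := isLinearClass R m
  have hu := isUnit_map_bigonCoeff R
  cases g with
  | cup k =>
    have h1 : (Regroup.unit h).Sees ((regroupLabel R m k).tensor h (regroupLabel R m k))
        ((web R m).cup k) := Regroup.sees_of_act₀₂ h fun hW => (isStdClass R m).cu_I hu k hW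
    rw [← regroup_label] at h1
    exact h1
  | cap k =>
    have h1 : ((regroupLabel R m k).tensor h (regroupLabel R m k)).Sees (Regroup.unit h)
        ((web R m).cap k) := Regroup.sees_of_act₂₀ h fun hW => (isStdClass R m).P_ca hu k hW
    rw [← regroup_label] at h1
    exact h1
  | mergeL k =>
    have h1 : ((regroupLabel R m 1).tensor h (regroupLabel R m k)).Sees (regroupLabel R m (k + 1))
        ((web R m).mergeL k) :=
      Regroup.sees_of_act₂₁ h fun hW => (isStdClass R m).P_P_mL_I hu k hW
    rw [← regroup_label, ← regroup_label, ← regroup_label] at h1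
    exact h1
  | mergeR k =>
    have h1 : ((regroupLabel R m k).tensor h (regroupLabel R m 1)).Sees (regroupLabel R m (k + 1))
        ((web R m).mergeR k) :=
      Regroup.sees_of_act₂₁ h fun hW => (isStdClass R m).P_P_mR_I hu k hW
    rw [← regroup_label, ← regroup_label, ← regroup_label] at h1
    exact h1

/-- Regrouped morphisms lie in the braiding web category. -/
theorem sees_mk {X Y : TensorWord ℕ+} (f : MorTerm R WebGen X Y) :
    (regroup R m X).Sees (regroup R m Y) (Quot.mk _ f) := by
  have h := isLinearClass R m
  induction f with
  | gen g => exact sees_gen R m g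
  | id X => exact Regroup.sees_id
  | comp f g hf hg => exact hf.comp h hg
  | tens f g hf hg => exact hf.tensor h hg
  | assocHom X Y Z => exact Regroup.sees_associator_hom h
  | assocInv X Y Z => exact Regroup.sees_associator_inv h
  | leftHom X => exact Regroup.sees_leftUnitor_hom h
  | leftInv X => exact Regroup.sees_leftUnitor_inv h
  | rightHom X => exact Regroup.sees_rightUnitor_hom h
  | rightInv X => exact Regroup.sees_rightUnitor_inv h
  | zero X Y => exact Regroup.sees_zero h
  | add f g hf hg => exact hf.add h hg
  | smul r f hf => exact hf.smul h r

variable {R m}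

/-- On strands labelled 1 nothing is split, so only structure isomorphisms occur. -/
theorem isBraidWeb_s {X : Web R m} (hX : IsStd R m X) {W : Web R m} (hW : IsStd R m W) :
    IsBraidWeb R m _ _ ((regroup R m X).s W) := by
  induction hX generalizing W with
  | unit => exact .leftUnitor_hom _ hW
  | one =>
    have h : IsBraidWeb R m _ _ ((webAction R m).I 1 W) := by
      rw [WebAction.I_one]
      exact .id _ (.tensor _ _ .one hW)
    exact h
  | tensor X Y hX hY ihX ihY =>
    exact .comp _ _ (.associator_hom _ _ _ hX hY hW) (.comp _ _ (.whiskerLeft hX (ihY hW))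
      (ihX ((regroup R m Y).obj hW)))

theorem isBraidWeb_p {X : Web R m} (hX : IsStd R m X) {W : Web R m} (hW : IsStd R m W) :
    IsBraidWeb R m _ _ ((regroup R m X).p W) := by
  induction hX generalizing W with
  | unit => exact .leftUnitor_inv _ hW
  | one =>
    have h : IsBraidWeb R m _ _ ((webAction R m).P 1 W) := by
      rw [WebAction.P_one]
      exact .id _ (.tensor _ _ .one hW)
    exact h
  | tensor X Y hX hY ihX ihY =>
    exact .comp _ _ (ihX ((regroup R m Y).obj hW)) (.comp _ _ (.whiskerLeft hX (ihY hW))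
      (.associator_inv _ _ _ hX hY hW))

/-- Every morphism between tensor products of the object `1` is a combination of braidings, cups
and caps. -/
theorem isBraidWeb_of_isStd {X Y : Web R m} (hX : IsStd R m X) (hY : IsStd R m Y) (f : X ⟶ Y) :
    IsBraidWeb R m X Y f := by
  induction f using Quot.ind with
  | mk f =>
    exact Regroup.Sees.mem (isLinearClass R m) (sees_mk R m f) .unit
      (.comp _ _ (.rightUnitor_inv _ hX) (isBraidWeb_s hX .unit))
      (.comp _ _ (isBraidWeb_p hY .unit) (.rightUnitor_hom _ hY))

end Full

/-! ### Constructing half braidings -/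

section HalfBraiding

variable {C : Type*} [Category C] [MonoidalCategory C]

/-- A family of isomorphisms `x ⊗ U ≅ U ⊗ x` compatible with the tensor product, without
naturality. -/
structure IsMonoidalFamily {x : C} (β : ∀ U : C, x ⊗ U ≅ U ⊗ x) : Prop where
  unit : (β (𝟙_ C)).hom = (ρ_ x).hom ≫ (λ_ x).inv
  tensor (U V : C) : (β (U ⊗ V)).hom =
    (α_ _ _ _).inv ≫ (β U).hom ▷ V ≫ (α_ _ _ _).hom ≫ U ◁ (β V).hom ≫ (α_ _ _ _).inv

/-- Naturality of a family of isomorphisms `x ⊗ U ≅ U ⊗ x` with respect to one morphism. -/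
def NaturalAt {x : C} (β : ∀ U : C, x ⊗ U ≅ U ⊗ x) {U V : C} (f : U ⟶ V) : Prop :=
  x ◁ f ≫ (β V).hom = (β U).hom ≫ f ▷ x

namespace NaturalAt

variable {x : C} {β : ∀ U : C, x ⊗ U ≅ U ⊗ x}

theorem id (U : C) : NaturalAt β (𝟙 U) := by simp [NaturalAt]

theorem comp {U V W : C} {f : U ⟶ V} {g : V ⟶ W} (hf : NaturalAt β f) (hg : NaturalAt β g) :
    NaturalAt β (f ≫ g) := by
  unfold NaturalAt at *
  rw [MonoidalCategory.whiskerLeft_comp, Category.assoc, hg, reassoc_of% hf, comp_whiskerRight]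

theorem inv {U V : C} {f : U ≅ V} (hf : NaturalAt β f.hom) : NaturalAt β f.inv := by
  unfold NaturalAt at *
  rw [← cancel_epi (x ◁ f.hom), whiskerLeft_hom_inv_assoc, reassoc_of% hf, hom_inv_whiskerRight,
    Category.comp_id]

theorem tensor (h : IsMonoidalFamily β) {U V U' V' : C} {f : U ⟶ V} {g : U' ⟶ V'}
    (hf : NaturalAt β f) (hg : NaturalAt β g) : NaturalAt β (f ⊗ₘ g) := by
  unfold NaturalAt at *
  rw [h.tensor, h.tensor]
  calc
    _ = 𝟙 _ ⊗≫ (x ◁ f ≫ (β V).hom) ▷ U' ⊗≫ V ◁ (x ◁ g ≫ (β V').hom) ⊗≫ 𝟙 _ := by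
      have := whisker_exchange (β V).hom g
      rw [MonoidalCategory.tensorHom_def]
      calc
        _ = 𝟙 _ ⊗≫ (x ◁ f) ▷ U' ⊗≫ ((x ⊗ V) ◁ g ≫ (β V).hom ▷ V') ⊗≫ V ◁ (β V').hom ⊗≫ 𝟙 _ := by
          monoidal
        _ = _ := by
          rw [this]
          monoidal
    _ = 𝟙 _ ⊗≫ (β U).hom ▷ U' ⊗≫ (f ▷ (x ⊗ U') ≫ V ◁ (β U').hom) ⊗≫ V ◁ g ▷ x ⊗≫ 𝟙 _ := by
      rw [hf, hg]
      monoidal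
    _ = _ := by
      rw [← whisker_exchange, MonoidalCategory.tensorHom_def]
      monoidal

theorem associator (h : IsMonoidalFamily β) (U V W : C) : NaturalAt β (α_ U V W).hom := by
  unfold NaturalAt
  simp only [h.tensor]
  monoidal

theorem leftUnitor (h : IsMonoidalFamily β) (U : C) : NaturalAt β (λ_ U).hom := by
  unfold NaturalAt
  rw [h.tensor, h.unit]
  monoidal

theorem rightUnitor (h : IsMonoidalFamily β) (U : C) : NaturalAt β (ρ_ U).hom := by
  unfold NaturalAt
  rw [h.tensor, h.unit]
  monoidal

section Linear

variable [Preadditive C] [MonoidalPreadditive C]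

theorem zero (U V : C) : NaturalAt β (0 : U ⟶ V) := by simp [NaturalAt]

theorem add {U V : C} {f g : U ⟶ V} (hf : NaturalAt β f) (hg : NaturalAt β g) :
    NaturalAt β (f + g) := by
  unfold NaturalAt at *
  simp [hf, hg]

theorem smul {R : Type*} [CommRing R] [Linear R C] [MonoidalLinear R C] {U V : C} (r : R)
    {f : U ⟶ V} (hf : NaturalAt β f) : NaturalAt β (r • f) := by
  unfold NaturalAt at *
  simp [hf]

end Linear

/-- At x ⊗ x the family is two successive crossings and at the unit it is trivial. Naturality is
thus the acting identity `hc` up to coherence. -/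
theorem cup (h : IsMonoidalFamily β) {cup : 𝟙_ C ⟶ x ⊗ x}
    (hc : x ◁ act₀₂ cup (𝟙_ C) ≫ act₂₂ (β x).hom _ ≫ x ◁ act₂₂ (β x).hom (𝟙_ C) = act₀₂ cup _) :
    NaturalAt β cup := by
  unfold NaturalAt
  rw [h.tensor, h.unit]
  calc
    _ = 𝟙 _ ⊗≫ (x ◁ act₀₂ cup (𝟙_ C) ≫ act₂₂ (β x).hom _ ≫ x ◁ act₂₂ (β x).hom (𝟙_ C)) ⊗≫ 𝟙 _ := by
      simp only [act₀₂, act₂₂]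
      monoidal
    _ = _ := by
      rw [hc]
      simp only [act₀₂]
      monoidal

theorem cap (h : IsMonoidalFamily β) {cap : x ⊗ x ⟶ 𝟙_ C}
    (hc : act₂₂ (β x).hom _ ≫ x ◁ act₂₂ (β x).hom (𝟙_ C) ≫ act₂₀ cap _ = x ◁ act₂₀ cap (𝟙_ C)) :
    NaturalAt β cap := by
  unfold NaturalAt
  rw [h.tensor, h.unit]
  calc
    _ = 𝟙 _ ⊗≫ (x ◁ act₂₀ cap (𝟙_ C)) ⊗≫ 𝟙 _ := by
      simp only [act₂₀]
      monoidal
    _ = _ := by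
      rw [← hc]
      simp only [act₂₀, act₂₂]
      monoidal

theorem self (h : IsMonoidalFamily β)
    (hc : act₂₂ (β x).hom _ ≫ x ◁ act₂₂ (β x).hom (𝟙_ C) ≫ act₂₂ (β x).hom _ =
      x ◁ act₂₂ (β x).hom (𝟙_ C) ≫ act₂₂ (β x).hom _ ≫ x ◁ act₂₂ (β x).hom (𝟙_ C)) :
    NaturalAt β (β x).hom := by
  unfold NaturalAt
  rw [h.tensor]
  calc
    _ = 𝟙 _ ⊗≫ (x ◁ act₂₂ (β x).hom (𝟙_ C) ≫ act₂₂ (β x).hom _ ≫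
        x ◁ act₂₂ (β x).hom (𝟙_ C)) ⊗≫ 𝟙 _ := by
      simp only [act₂₂]
      monoidal
    _ = _ := by
      rw [← hc]
      simp only [act₂₂]
      monoidal

end NaturalAt

/-- Half braidings on all objects, compatible with the tensor product, but without naturality in
the object that carries them. -/
structure IsMonoidalHalfBraiding (b : ∀ X : C, HalfBraiding X) : Prop where
  unit (U : C) : ((b (𝟙_ C)).β U).hom = (λ_ U).hom ≫ (ρ_ U).inv
  tensor (X Y U : C) : ((b (X ⊗ Y)).β U).hom =
    (α_ _ _ _).hom ≫ X ◁ ((b Y).β U).hom ≫ (α_ _ _ _).inv ≫ ((b X).β U).hom ▷ Y ≫ (α_ _ _ _).hom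
  unit_right (X : C) : ((b X).β (𝟙_ C)).hom = (ρ_ X).hom ≫ (λ_ X).inv

/-- Naturality of half braidings in the object that carries them, for one morphism and with
respect to one object. -/
def NaturalLeftAt (b : ∀ X : C, HalfBraiding X) {X Y : C} (f : X ⟶ Y) (U : C) : Prop :=
  f ▷ U ≫ ((b Y).β U).hom = ((b X).β U).hom ≫ U ◁ f

namespace NaturalLeftAt

variable {b : ∀ X : C, HalfBraiding X} {U : C}

theorem id (X : C) : NaturalLeftAt b (𝟙 X) U := by simp [NaturalLeftAt]

theorem comp {X Y Z : C} {f : X ⟶ Y} {g : Y ⟶ Z} (hf : NaturalLeftAt b f U)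
    (hg : NaturalLeftAt b g U) : NaturalLeftAt b (f ≫ g) U := by
  unfold NaturalLeftAt at *
  rw [comp_whiskerRight, Category.assoc, hg, reassoc_of% hf, MonoidalCategory.whiskerLeft_comp]

theorem inv {X Y : C} {f : X ≅ Y} (hf : NaturalLeftAt b f.hom U) : NaturalLeftAt b f.inv U := by
  unfold NaturalLeftAt at *
  rw [← cancel_epi (f.hom ▷ U), hom_inv_whiskerRight_assoc, reassoc_of% hf, whiskerLeft_hom_inv,
    Category.comp_id]

theorem tensor (h : IsMonoidalHalfBraiding b) {X Y X' Y' : C} {f : X ⟶ Y} {g : X' ⟶ Y'}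
    (hf : NaturalLeftAt b f U) (hg : NaturalLeftAt b g U) : NaturalLeftAt b (f ⊗ₘ g) U := by
  unfold NaturalLeftAt at *
  rw [h.tensor, h.tensor]
  calc
    _ = 𝟙 _ ⊗≫ X ◁ (g ▷ U ≫ ((b Y').β U).hom) ⊗≫ (f ▷ U ≫ ((b Y).β U).hom) ▷ Y' ⊗≫ 𝟙 _ := by
      have := whisker_exchange f ((b Y').β U).hom
      rw [MonoidalCategory.tensorHom_def']
      calc
        _ = 𝟙 _ ⊗≫ X ◁ g ▷ U ⊗≫ (f ▷ (Y' ⊗ U) ≫ Y ◁ ((b Y').β U).hom) ⊗≫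
            ((b Y).β U).hom ▷ Y' ⊗≫ 𝟙 _ := by
          monoidal
        _ = _ := by
          rw [← this]
          monoidal
    _ = 𝟙 _ ⊗≫ X ◁ ((b X').β U).hom ⊗≫ ((X ⊗ U) ◁ g ≫ ((b X).β U).hom ▷ Y') ⊗≫
        U ◁ f ▷ Y' ⊗≫ 𝟙 _ := by
      rw [hf, hg]
      monoidal
    _ = _ := by
      rw [whisker_exchange, MonoidalCategory.tensorHom_def']
      monoidal

theorem associator (h : IsMonoidalHalfBraiding b) (X Y Z : C) :
    NaturalLeftAt b (α_ X Y Z).hom U := by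
  unfold NaturalLeftAt
  simp only [h.tensor]
  monoidal

theorem leftUnitor (h : IsMonoidalHalfBraiding b) (X : C) : NaturalLeftAt b (λ_ X).hom U := by
  unfold NaturalLeftAt
  rw [h.tensor, h.unit]
  monoidal

theorem rightUnitor (h : IsMonoidalHalfBraiding b) (X : C) : NaturalLeftAt b (ρ_ X).hom U := by
  unfold NaturalLeftAt
  rw [h.tensor, h.unit]
  monoidal

/-- A half braiding at U ⊗ V is composed of those at U and V, so naturality for generating objects
is enough. -/
theorem tensor_right {X Y : C} {f : X ⟶ Y} {V : C} (hU : NaturalLeftAt b f U)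
    (hV : NaturalLeftAt b f V) : NaturalLeftAt b f (U ⊗ V) := by
  unfold NaturalLeftAt at *
  rw [HalfBraiding.monoidal, HalfBraiding.monoidal]
  calc
    _ = 𝟙 _ ⊗≫ (f ▷ U ≫ ((b Y).β U).hom) ▷ V ⊗≫ U ◁ ((b Y).β V).hom ⊗≫ 𝟙 _ := by monoidal
    _ = 𝟙 _ ⊗≫ ((b X).β U).hom ▷ V ⊗≫ U ◁ (f ▷ V ≫ ((b Y).β V).hom) ⊗≫ 𝟙 _ := by
      rw [hU]
      monoidal
    _ = _ := by
      rw [hV]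
      monoidal

theorem unit_right (h : IsMonoidalHalfBraiding b) {X Y : C} (f : X ⟶ Y) :
    NaturalLeftAt b f (𝟙_ C) := by
  unfold NaturalLeftAt
  rw [h.unit_right, h.unit_right]
  monoidal

section Linear

variable [Preadditive C] [MonoidalPreadditive C]

theorem zero (X Y : C) : NaturalLeftAt b (0 : X ⟶ Y) U := by simp [NaturalLeftAt]

theorem add {X Y : C} {f g : X ⟶ Y} (hf : NaturalLeftAt b f U) (hg : NaturalLeftAt b g U) :
    NaturalLeftAt b (f + g) U := by
  unfold NaturalLeftAt at *
  simp [hf, hg]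

theorem smul {R : Type*} [CommRing R] [Linear R C] [MonoidalLinear R C] {X Y : C} (r : R)
    {f : X ⟶ Y} (hf : NaturalLeftAt b f U) : NaturalLeftAt b (r • f) U := by
  unfold NaturalLeftAt at *
  simp [hf]

end Linear

theorem cup (h : IsMonoidalHalfBraiding b) {x : C} {cup : 𝟙_ C ⟶ x ⊗ x}
    (hc : act₀₂ cup _ ≫ x ◁ act₂₂ ((b x).β x).hom (𝟙_ C) ≫ act₂₂ ((b x).β x).hom _ =
      x ◁ act₀₂ cup (𝟙_ C)) : NaturalLeftAt b cup x := by
  unfold NaturalLeftAt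
  rw [h.tensor, h.unit]
  calc
    _ = 𝟙 _ ⊗≫ (act₀₂ cup _ ≫ x ◁ act₂₂ ((b x).β x).hom (𝟙_ C) ≫ act₂₂ ((b x).β x).hom _) ⊗≫
        𝟙 _ := by
      simp only [act₀₂, act₂₂]
      monoidal
    _ = _ := by
      rw [hc]
      simp only [act₀₂]
      monoidal

theorem cap (h : IsMonoidalHalfBraiding b) {x : C} {cap : x ⊗ x ⟶ 𝟙_ C}
    (hc : x ◁ act₂₂ ((b x).β x).hom (𝟙_ C) ≫ act₂₂ ((b x).β x).hom _ ≫ x ◁ act₂₀ cap (𝟙_ C) =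
      act₂₀ cap _) : NaturalLeftAt b cap x := by
  unfold NaturalLeftAt
  rw [h.tensor, h.unit]
  calc
    _ = 𝟙 _ ⊗≫ act₂₀ cap (x ⊗ 𝟙_ C) ⊗≫ 𝟙 _ := by
      simp only [act₂₀]
      monoidal
    _ = _ := by
      rw [← hc]
      simp only [act₂₀, act₂₂]
      monoidal

theorem self (h : IsMonoidalHalfBraiding b) {x : C}
    (hc : act₂₂ ((b x).β x).hom _ ≫ x ◁ act₂₂ ((b x).β x).hom (𝟙_ C) ≫ act₂₂ ((b x).β x).hom _ =
      x ◁ act₂₂ ((b x).β x).hom (𝟙_ C) ≫ act₂₂ ((b x).β x).hom _ ≫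
        x ◁ act₂₂ ((b x).β x).hom (𝟙_ C)) : NaturalLeftAt b ((b x).β x).hom x := by
  unfold NaturalLeftAt
  rw [h.tensor]
  calc
    _ = 𝟙 _ ⊗≫ (act₂₂ ((b x).β x).hom _ ≫ x ◁ act₂₂ ((b x).β x).hom (𝟙_ C) ≫
        act₂₂ ((b x).β x).hom _) ⊗≫ 𝟙 _ := by
      simp only [act₂₂]
      monoidal
    _ = _ := by
      rw [hc]
      simp only [act₂₂]
      monoidal

end NaturalLeftAt

theorem tensor_unit_right {X Y : C} {f : X ⊗ 𝟙_ C ⟶ 𝟙_ C ⊗ X} {g : Y ⊗ 𝟙_ C ⟶ 𝟙_ C ⊗ Y}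
    (hf : f = (ρ_ X).hom ≫ (λ_ X).inv) (hg : g = (ρ_ Y).hom ≫ (λ_ Y).inv) :
    (α_ _ _ _).hom ≫ X ◁ g ≫ (α_ _ _ _).inv ≫ f ▷ Y ≫ (α_ _ _ _).hom =
      (ρ_ (X ⊗ Y)).hom ≫ (λ_ (X ⊗ Y)).inv := by
  rw [hf, hg]
  monoidal

/-- Natural half braidings on all objects form a braiding. -/
abbrev braidedOfHalfBraiding (b : ∀ X : C, HalfBraiding X) (h : IsMonoidalHalfBraiding b)
    (hn : ∀ {X Y : C} (f : X ⟶ Y) (U : C), NaturalLeftAt b f U) : BraidedCategory C where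
  braiding X Y := (b X).β Y
  braiding_naturality_right X _ _ f := (b X).naturality f
  braiding_naturality_left f Z := hn f Z
  hexagon_forward X Y Z := by simp
  hexagon_reverse X Y Z := by simp [h.tensor]

theorem act₂₂_unit_injective {X Y X' Y' : C} {f g : X ⊗ Y ⟶ X' ⊗ Y'}
    (h : act₂₂ f (𝟙_ C) = act₂₂ g (𝟙_ C)) : f = g := by
  have e (f : X ⊗ Y ⟶ X' ⊗ Y') : f = 𝟙 _ ⊗≫ act₂₂ f (𝟙_ C) ⊗≫ 𝟙 _ := by
    simp only [act₂₂]
    monoidal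
  rw [e f, e g, h]

end HalfBraiding

/-! ### The braiding of the standard web category -/

section StdWeb

variable (R : Type u) [CommRing R] [Algebra QRing R] (m : ℕ)

/-- Words in the letter `1`. -/
def IsOneWord : TensorWord ℕ+ → Prop
  | .unit => True
  | .of n => n = 1
  | .tensor X Y => IsOneWord X ∧ IsOneWord Y

variable {R m}

theorem IsStd.isOneWord {X : Web R m} (h : IsStd R m X) : IsOneWord X := by
  induction h with
  | unit => trivial
  | one => exact rfl
  | tensor X Y _ _ hX hY => exact ⟨hX, hY⟩

theorem isStd_of_isOneWord : ∀ {X : TensorWord ℕ+}, IsOneWord X → IsStd R m X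
  | .unit, _ => .unit
  | .of _, rfl => .one
  | .tensor _ _, h => .tensor _ _ (isStd_of_isOneWord h.1) (isStd_of_isOneWord h.2)

theorem isStd_tensor_left {X Y : TensorWord ℕ+} (h : IsStd R m (X.tensor Y)) : IsStd R m X :=
  isStd_of_isOneWord h.isOneWord.1

theorem isStd_tensor_right {X Y : TensorWord ℕ+} (h : IsStd R m (X.tensor Y)) : IsStd R m Y :=
  isStd_of_isOneWord h.isOneWord.2

theorem not_isStd_of {k : ℕ} {hk : 0 < k + 2} (h : IsStd R m (.of ⟨k + 2, hk⟩)) : False := by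
  have h1 : (⟨k + 2, hk⟩ : ℕ+) = 1 := h.isOneWord
  have h2 : k + 2 = 1 := congrArg PNat.val h1
  omega

/-- Recursion on the objects of the standard web category. -/
def stdRecWord {M : StdWeb R m → Sort*} (unit : M (𝟙_ _)) (one : M (stdOne R m))
    (tensor : ∀ X Y, M X → M Y → M (X ⊗ Y)) :
    ∀ (X : TensorWord ℕ+) (h : IsStd R m X), M ⟨X, h⟩
  | .unit, _ => unit
  | .of ⟨1, _⟩, _ => one
  | .of ⟨_ + 2, _⟩, h => (not_isStd_of h).elim
  | .tensor X Y, h => tensor ⟨X, isStd_tensor_left h⟩ ⟨Y, isStd_tensor_right h⟩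
      (stdRecWord unit one tensor X _) (stdRecWord unit one tensor Y _)

/-- Recursion on the objects of the standard web category. -/
def stdRec {M : StdWeb R m → Sort*} (unit : M (𝟙_ _)) (one : M (stdOne R m))
    (tensor : ∀ X Y, M X → M Y → M (X ⊗ Y)) (X : StdWeb R m) : M X :=
  stdRecWord unit one tensor X.1 X.2

/-- The generators of the morphisms of the standard web category. -/
theorem stdWeb_hom_induction {P : ∀ {X Y : StdWeb R m}, (X ⟶ Y) → Prop}
    (braiding : P (stdBraiding R m)) (cup : P (stdCup R m)) (cap : P (stdCap R m))
    (id : ∀ X, P (𝟙 X)) (associator : ∀ X Y Z, P (α_ X Y Z).hom)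
    (associator_inv : ∀ X Y Z, P (α_ X Y Z).inv) (leftUnitor : ∀ X, P (λ_ X).hom)
    (leftUnitor_inv : ∀ X, P (λ_ X).inv) (rightUnitor : ∀ X, P (ρ_ X).hom)
    (rightUnitor_inv : ∀ X, P (ρ_ X).inv)
    (comp : ∀ {X Y Z} (f : X ⟶ Y) (g : Y ⟶ Z), P f → P g → P (f ≫ g))
    (tensor : ∀ {X Y X' Y'} (f : X ⟶ Y) (g : X' ⟶ Y'), P f → P g → P (f ⊗ₘ g))
    (zero : ∀ X Y, P (0 : X ⟶ Y)) (add : ∀ {X Y} (f g : X ⟶ Y), P f → P g → P (f + g))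
    (smul : ∀ {X Y} (r : R) (f : X ⟶ Y), P f → P (r • f)) {X Y : StdWeb R m} (f : X ⟶ Y) : P f := by
  -- The induction runs in the ambient web category. It closes up in the full subcategory because
  -- intermediate objects of generated composites are standard.
  have key : ∀ {X Y : Web R m} {f : X ⟶ Y}, IsBraidWeb R m X Y f →
      ∀ (hX : IsStd R m X) (hY : IsStd R m Y),
        P (ObjectProperty.homMk f : (⟨X, hX⟩ : StdWeb R m) ⟶ ⟨Y, hY⟩) := by
    intro X Y f hf
    induction hf with
    | braiding => exact fun _ _ => braiding
    | cup => exact fun _ _ => cup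
    | cap => exact fun _ _ => cap
    | id X hX => exact fun _ _ => id ⟨X, hX⟩
    | associator_hom X Y Z hX hY hZ => exact fun _ _ => associator ⟨X, hX⟩ ⟨Y, hY⟩ ⟨Z, hZ⟩
    | associator_inv X Y Z hX hY hZ =>
      exact fun _ _ => associator_inv ⟨X, hX⟩ ⟨Y, hY⟩ ⟨Z, hZ⟩
    | leftUnitor_hom X hX => exact fun _ _ => leftUnitor ⟨X, hX⟩
    | leftUnitor_inv X hX =>
      exact fun _ _ => leftUnitor_inv ⟨X, hX⟩
    | rightUnitor_hom X hX => exact fun _ _ => rightUnitor ⟨X, hX⟩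
    | rightUnitor_inv X hX =>
      exact fun _ _ => rightUnitor_inv ⟨X, hX⟩
    | comp f g hf hg ihf ihg =>
      exact fun hX hZ => comp _ _ (ihf hX hf.isStd.2) (ihg hf.isStd.2 hZ)
    | tensor f g hf hg ihf ihg =>
      exact fun _ _ => tensor _ _ (ihf hf.isStd.1 hf.isStd.2) (ihg hg.isStd.1 hg.isStd.2)
    | zero X Y hX hY => exact fun hX hY => zero ⟨X, hX⟩ ⟨Y, hY⟩
    | add f g hf hg ihf ihg => exact fun hX hY => add _ _ (ihf hX hY) (ihg hX hY)
    | smul r f hf ihf => exact fun hX hY => smul r _ (ihf hX hY)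
  exact key (isBraidWeb_of_isStd X.2 Y.2 f.hom) X.2 Y.2

variable (R m)

/-- The inverse of the braiding. -/
noncomputable def webBraidingInv :
    (web R m).obj 1 ⊗ (web R m).obj 1 ⟶ (web R m).obj 1 ⊗ (web R m).obj 1 :=
  algebraMap QRing R ↑(qq ^ (-2 : ℤ)) • 𝟙 _ - (web R m).dumbbell
    - algebraMap QRing R (braidCoeff' m) • ((web R m).cap 1 ≫ (web R m).cup 1)

theorem webAction_br_inv (W : Web R m) :
    (webAction R m).br (algebraMap QRing R ↑(qq ^ (-2 : ℤ)))
      (algebraMap QRing R (braidCoeff' m)) W = act₂₂ (webBraidingInv R m) W := by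
  rw [webBraidingInv, act₂₂_sub, act₂₂_sub, act₂₂_smul, act₂₂_smul, WebData.dumbbell,
    ← act₂₁_act₁₂, ← act₂₀_act₀₂]
  have : act₂₂ (𝟙 ((web R m).obj 1 ⊗ (web R m).obj 1)) W = 𝟙 _ := by simp [act₂₂]
  rw [this]
  rfl

theorem webBraiding_hom_inv : webBraiding R m ≫ webBraidingInv R m = 𝟙 _ := by
  refine act₂₂_unit_injective ?_
  have h := WebAction.br_br (E := webAction R m) (isBraidCoeff R m) (𝟙_ _)
  rw [webAction_br, webAction_br_inv] at h
  have : act₂₂ (𝟙 ((web R m).obj 1 ⊗ (web R m).obj 1)) (𝟙_ _) = 𝟙 _ := by simp [act₂₂]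
  rw [this, act₂₂_comp]
  exact h

theorem webBraiding_inv_hom : webBraidingInv R m ≫ webBraiding R m = 𝟙 _ := by
  refine act₂₂_unit_injective ?_
  have h := WebAction.br_br (E := webAction R m) (isBraidCoeff R m).symm (𝟙_ _)
  rw [webAction_br, webAction_br_inv] at h
  have : act₂₂ (𝟙 ((web R m).obj 1 ⊗ (web R m).obj 1)) (𝟙_ _) = 𝟙 _ := by simp [act₂₂]
  rw [this, act₂₂_comp]
  exact h

/-- The braiding of the object `1` with itself, as an isomorphism. -/
noncomputable def stdBraidingIso : stdOne R m ⊗ stdOne R m ≅ stdOne R m ⊗ stdOne R m where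
  hom := stdBraiding R m
  inv := ObjectProperty.homMk (webBraidingInv R m)
  hom_inv_id := ObjectProperty.hom_ext _ (webBraiding_hom_inv R m)
  inv_hom_id := ObjectProperty.hom_ext _ (webBraiding_inv_hom R m)

/-- The braidings of the object `1` with all objects. -/
noncomputable def oneBraiding (U : StdWeb R m) : stdOne R m ⊗ U ≅ U ⊗ stdOne R m :=
  stdRec (M := fun U => stdOne R m ⊗ U ≅ U ⊗ stdOne R m)
    (ρ_ _ ≪≫ (λ_ _).symm) (stdBraidingIso R m)
    (fun U V hU hV => (α_ _ _ _).symm ≪≫ whiskerRightIso hU V ≪≫ α_ _ _ _ ≪≫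
      whiskerLeftIso U hV ≪≫ (α_ _ _ _).symm) U

theorem isMonoidalFamily_oneBraiding : IsMonoidalFamily (oneBraiding R m) where
  unit := rfl
  tensor _ _ := rfl

/-- Generation leaves three cases: the Yang–Baxter equation for the crossing, and moving a strand
past a cup or a cap. -/
theorem oneBraiding_natural {U V : StdWeb R m} (f : U ⟶ V) : NaturalAt (oneBraiding R m) f := by
  have h := isMonoidalFamily_oneBraiding R m
  have hc := isBraidCoeff R m
  refine stdWeb_hom_induction (P := fun {U V} f => NaturalAt (oneBraiding R m) f)
    ?_ ?_ ?_ .id (.associator h) (fun _ _ _ => .inv (.associator h _ _ _)) (.leftUnitor h)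
    (fun _ => .inv (.leftUnitor h _)) (.rightUnitor h) (fun _ => .inv (.rightUnitor h _))
    (fun _ _ => .comp) (fun _ _ => .tensor h) .zero (fun _ _ => .add) (fun r _ => .smul r) f
  · have h1 := WebAction.yangBaxter (E := webAction R m) hc (𝟙_ _)
    simp only [webAction_br] at h1
    exact NaturalAt.self h (ObjectProperty.hom_ext _ h1)
  · have h1 := WebAction.map_cu_br (E := webAction R m) hc (𝟙_ _)
    simp only [webAction_br] at h1
    exact NaturalAt.cup h (ObjectProperty.hom_ext _ h1)
  · have h1 := WebAction.br_map_ca (E := webAction R m) hc (𝟙_ _)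
    simp only [webAction_br] at h1
    exact NaturalAt.cap h (ObjectProperty.hom_ext _ h1)

/-- Half braidings on all objects of the standard web category. -/
noncomputable def stdHalfBraiding (X : StdWeb R m) : HalfBraiding X :=
  -- The unit and tensor products carry the half braidings of the Drinfeld centre, so only the
  -- object 1 requires new data.
  stdRec (M := fun X => HalfBraiding X) (Center.tensorUnit : Center (StdWeb R m)).2
    { β := oneBraiding R m
      monoidal := (isMonoidalFamily_oneBraiding R m).tensor
      naturality := oneBraiding_natural R m }
    (fun X Y hX hY => (Center.tensorObj ⟨X, hX⟩ ⟨Y, hY⟩).2) X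

theorem isMonoidalHalfBraiding_std : IsMonoidalHalfBraiding (stdHalfBraiding R m) where
  unit _ := rfl
  tensor _ _ _ := rfl
  unit_right X := by
    have h : (λ_ (𝟙_ (StdWeb R m))).hom ≫ (ρ_ _).inv = (ρ_ _).hom ≫ (λ_ _).inv := by monoidal
    exact stdRec (M := fun X => ((stdHalfBraiding R m X).β (𝟙_ _)).hom = (ρ_ X).hom ≫ (λ_ X).inv)
      h rfl (fun X Y hX hY => tensor_unit_right hX hY) X

/-- Induction on U reduces to the object 1 and generation reduces f to the crossing, cup and cap.
The cup and cap now need the moves from the other side, `cu_br` and `map_br_ca`. -/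
theorem naturalLeftAt_std {X Y : StdWeb R m} (f : X ⟶ Y) (U : StdWeb R m) :
    NaturalLeftAt (stdHalfBraiding R m) f U := by
  have h := isMonoidalHalfBraiding_std R m
  have hc := isBraidCoeff R m
  revert X Y
  refine stdRec (M := fun U => ∀ {X Y : StdWeb R m} (f : X ⟶ Y),
    NaturalLeftAt (stdHalfBraiding R m) f U) (fun f => .unit_right h f) (fun f => ?_)
    (fun U V hU hV _ _ f => .tensor_right (hU f) (hV f)) U
  refine stdWeb_hom_induction (P := fun f => NaturalLeftAt (stdHalfBraiding R m) f (stdOne R m))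
    ?_ ?_ ?_ .id (.associator h) (fun _ _ _ => .inv (.associator h _ _ _)) (.leftUnitor h)
    (fun _ => .inv (.leftUnitor h _)) (.rightUnitor h) (fun _ => .inv (.rightUnitor h _))
    (fun _ _ => .comp) (fun _ _ => .tensor h) .zero (fun _ _ => .add) (fun r _ => .smul r) f
  · have h1 := WebAction.yangBaxter (E := webAction R m) hc (𝟙_ _)
    simp only [webAction_br] at h1
    exact NaturalLeftAt.self h (ObjectProperty.hom_ext _ h1)
  · have h1 := WebAction.cu_br (E := webAction R m) hc (𝟙_ _)
    simp only [webAction_br] at h1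
    exact NaturalLeftAt.cup h (ObjectProperty.hom_ext _ h1)
  · have h1 := WebAction.map_br_ca (E := webAction R m) hc (𝟙_ _)
    simp only [webAction_br] at h1
    exact NaturalLeftAt.cap h (ObjectProperty.hom_ext _ h1)

/-- The braided structure of the standard web category. -/
noncomputable abbrev stdBraided : BraidedCategory (StdWeb R m) :=
  braidedOfHalfBraiding (stdHalfBraiding R m) (isMonoidalHalfBraiding_std R m)
    (naturalLeftAt_std R m)

end StdWeb

/-! ### Functors out of presented categories -/

section Presented

variable {R : Type u} [CommRing R] {G : Type} {gen : TensorWord G → TensorWord G → Type}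
  {D : Type*} [Category D] [MonoidalCategory D]

/-- The value of a word. -/
def wordValue (o : G → D) : TensorWord G → D
  | .unit => 𝟙_ D
  | .of x => o x
  | .tensor X Y => wordValue o X ⊗ wordValue o Y

variable [Preadditive D] [Linear R D]

/-- The value of a term. -/
def termValue {o : G → D} (φ : ∀ {X Y}, gen X Y → (wordValue o X ⟶ wordValue o Y)) :
    ∀ {X Y : TensorWord G}, MorTerm R gen X Y → (wordValue o X ⟶ wordValue o Y)
  | _, _, .gen g => φ g
  | _, _, .id _ => 𝟙 _
  | _, _, .comp f g => termValue φ f ≫ termValue φ g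
  | _, _, .tens f g => termValue φ f ⊗ₘ termValue φ g
  | _, _, .assocHom _ _ _ => (α_ _ _ _).hom
  | _, _, .assocInv _ _ _ => (α_ _ _ _).inv
  | _, _, .leftHom _ => (λ_ _).hom
  | _, _, .leftInv _ => (λ_ _).inv
  | _, _, .rightHom _ => (ρ_ _).hom
  | _, _, .rightInv _ => (ρ_ _).inv
  | _, _, .zero _ _ => 0
  | _, _, .add f g => termValue φ f + termValue φ g
  | _, _, .smul r f => r • termValue φ f

variable [MonoidalPreadditive D] [MonoidalLinear R D]
  {rel : ∀ X Y : TensorWord G, MorTerm R gen X Y → MorTerm R gen X Y → Prop}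

theorem tensorHom_smul {X Y X' Y' : D} (f : X ⟶ Y) (r : R) (g : X' ⟶ Y') :
    f ⊗ₘ r • g = r • (f ⊗ₘ g) := by
  simp [MonoidalCategory.tensorHom_def]

theorem smul_tensorHom {X Y X' Y' : D} (r : R) (f : X ⟶ Y) (g : X' ⟶ Y') :
    (r • f) ⊗ₘ g = r • (f ⊗ₘ g) := by
  simp [MonoidalCategory.tensorHom_def]

theorem termValue_eq {o : G → D} (φ : ∀ {X Y}, gen X Y → (wordValue o X ⟶ wordValue o Y))
    (hφ : ∀ {X Y} {f g : MorTerm R gen X Y}, rel X Y f g → termValue φ f = termValue φ g)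
    {X Y : TensorWord G} {f g : MorTerm R gen X Y} (h : MorRel R gen rel X Y f g) :
    termValue φ f = termValue φ g := by
  induction h with
  | rel f g h => exact hφ h
  | refl f => rfl
  | symm f g _ h => exact h.symm
  | trans f g h _ _ h1 h2 => exact h1.trans h2
  | add_assoc f g h => exact add_assoc _ _ _
  | add_comm f g => exact add_comm _ _
  | tens_add f g h => exact MonoidalPreadditive.tensor_add _ _ _
  | add_tens f g h => exact MonoidalPreadditive.add_tensor _ _ _
  | tens_smul f r g => exact tensorHom_smul _ r _
  | smul_tens r f g => exact smul_tensorHom r _ _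
  | _ => simp_all [termValue, add_smul, mul_smul, wordValue]

/-- The functor on a presented category given by the values of the generators. -/
def presentedFunctor {o : G → D} (φ : ∀ {X Y}, gen X Y → (wordValue o X ⟶ wordValue o Y))
    (hφ : ∀ {X Y} {f g : MorTerm R gen X Y}, rel X Y f g → termValue φ f = termValue φ g) :
    Presented R gen rel ⥤ D where
  obj X := wordValue o X
  map f := Quot.lift (termValue φ) (fun _ _ h => termValue_eq φ hφ h) f
  map_id _ := rfl
  map_comp := by rintro _ _ _ ⟨f⟩ ⟨g⟩; rfl

variable {o : G → D} (φ : ∀ {X Y}, gen X Y → (wordValue o X ⟶ wordValue o Y))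
  (hφ : ∀ {X Y} {f g : MorTerm R gen X Y}, rel X Y f g → termValue φ f = termValue φ g)

/-- Words are evaluated factor by factor, so the comparison isomorphisms can be identities. -/
instance presentedFunctorMonoidal : (presentedFunctor φ hφ).Monoidal :=
  Functor.CoreMonoidal.toMonoidal
    { εIso := Iso.refl _
      μIso := fun _ _ => Iso.refl _
      μIso_hom_natural_left := by
        rintro X Y ⟨f⟩ Z
        exact (Category.comp_id _).trans
          ((tensorHom_id _ _).symm.trans (Category.id_comp _).symm)
      μIso_hom_natural_right := by
        rintro X Y Z ⟨f⟩
        exact (Category.comp_id _).trans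
          ((id_tensorHom _ _).symm.trans (Category.id_comp _).symm)
      associativity X Y Z := by
        have h : 𝟙 (wordValue o X ⊗ wordValue o Y) ▷ wordValue o Z ≫
            𝟙 ((wordValue o X ⊗ wordValue o Y) ⊗ wordValue o Z) ≫ (α_ _ _ _).hom =
              (α_ _ _ _).hom ≫ wordValue o X ◁ 𝟙 (wordValue o Y ⊗ wordValue o Z) ≫ 𝟙 _ := by
          simp
        exact h
      left_unitality X := by
        have h : (λ_ (wordValue o X)).hom =
            𝟙 (𝟙_ D) ▷ wordValue o X ≫ 𝟙 (𝟙_ D ⊗ wordValue o X) ≫ (λ_ (wordValue o X)).hom := by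
          simp
        exact h
      right_unitality X := by
        have h : (ρ_ (wordValue o X)).hom =
            wordValue o X ◁ 𝟙 (𝟙_ D) ≫ 𝟙 (wordValue o X ⊗ 𝟙_ D) ≫ (ρ_ (wordValue o X)).hom := by
          simp
        exact h }

instance presentedFunctor_additive : (presentedFunctor φ hφ).Additive where
  map_add := by rintro _ _ ⟨f⟩ ⟨g⟩; rfl

instance presentedFunctor_linear : (presentedFunctor φ hφ).Linear R where
  map_smul := by rintro _ _ ⟨f⟩ r; rfl


theorem presentedFunctor_map_tensor {X Y X' Y' : Presented R gen rel} (f : X ⟶ Y) (g : X' ⟶ Y') :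
    (presentedFunctor φ hφ).map (f ⊗ₘ g) = (presentedFunctor φ hφ).map f ⊗ₘ (presentedFunctor φ hφ).map g := by
  obtain ⟨f⟩ := f
  obtain ⟨g⟩ := g
  rfl

end Presented

/-! ### The functor from the BMW category -/

section BMWFunctor

variable (R : Type u) [CommRing R] [Algebra QRing R] (m : ℕ)

attribute [local instance] stdBraided

/-- The values of the generators of the BMW category. -/
noncomputable def bmwGenValue : ∀ {X Y : TensorWord Unit}, BMWGen X Y →
    (wordValue (fun _ => stdOne R m) X ⟶ wordValue (fun _ => stdOne R m) Y)
  | _, _, .cup => stdCup R m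
  | _, _, .cap => stdCap R m
  | _, _, .braid _ _ => (β_ _ _).hom
  | _, _, .braidInv _ _ => (β_ _ _).inv

/-- The functor from the free category on the generators of the BMW category. -/
noncomputable abbrev freeBMWFunctor : FreeMon R BMWGen ⥤ StdWeb R m :=
  presentedFunctor (R := R) (bmwGenValue R m) (fun h => h.elim)

theorem closeRight_unit_right {C : Type*} [Category C] [MonoidalCategory C] {X : C} {f g : X ⟶ X}
    (h : f ▷ 𝟙_ C = g ▷ 𝟙_ C) : f = g := by
  have e (f : X ⟶ X) : f = (ρ_ X).inv ≫ f ▷ 𝟙_ C ≫ (ρ_ X).hom := by simp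
  rw [e f, e g, h]

theorem web_circle : (web R m).cup 1 ≫ (web R m).cap 1 =
    algebraMap QRing R (circleCoeff m) • 𝟙 _ := Quot.sound (.rel _ _ WebRel.circle)

theorem web_snakeLeft : snakeLeft ((web R m).cup 1) ((web R m).cap 1) = 𝟙 _ :=
  Quot.sound (.rel _ _ (WebRel.snakeLeft 1))

theorem web_snakeRight : snakeRight ((web R m).cup 1) ((web R m).cap 1) = 𝟙 _ :=
  Quot.sound (.rel _ _ (WebRel.snakeRight 1))

/-- The dumbbells cancel, and the coefficients of 1 and of the cap-cup agree up to sign because c -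
c' = q² - q⁻². -/
theorem web_skein : webBraiding R m - webBraidingInv R m =
    algebraMap QRing R skeinCoeff • (𝟙 _ - (web R m).cap 1 ≫ (web R m).cup 1) := by
  have h1 : algebraMap QRing R ↑(qq ^ (2 : ℤ)) - algebraMap QRing R ↑(qq ^ (-2 : ℤ)) =
    algebraMap QRing R skeinCoeff := by rw [skeinCoeff, map_sub]
  have h2 : algebraMap QRing R (braidCoeff m) - algebraMap QRing R (braidCoeff' m) =
    algebraMap QRing R skeinCoeff := by rw [skeinCoeff_eq m, map_sub]
  rw [smul_sub, webBraiding, webBraidingInv]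
  nth_rw 1 [← h1]
  rw [← h2, sub_smul, sub_smul]
  abel

theorem web_curl : closeRight ((web R m).cup 1) ((web R m).cap 1) (webBraiding R m) =
    algebraMap QRing R ↑(qq ^ (2 * (m : ℤ) - 2)) • 𝟙 _ := by
  refine closeRight_unit_right ?_
  have h := WebAction.curl (E := webAction R m) (isBraidCoeff R m) (𝟙_ _)
  rw [webAction_br] at h
  rw [closeRight_act, MonoidalLinear.smul_whiskerRight, id_whiskerRight, ← curl_coeff, map_sub,
    map_mul]
  exact h

/-- The braided axioms hold in the target by construction, self-duality and dimension are web
relations, and the skein and curl relations come from the computed coefficients. -/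
theorem bmwRel_eq {X Y : FreeMon R BMWGen} {f g : X ⟶ Y} (h : BMWRel R m X Y f g) :
    (freeBMWFunctor R m).map f = (freeBMWFunctor R m).map g := by
  cases h with
  | braid_hom_inv X Y => exact (β_ _ _).hom_inv_id
  | braid_inv_hom X Y => exact (β_ _ _).inv_hom_id
  | natural_right X f =>
    obtain ⟨f⟩ := f
    have h {A B C : StdWeb R m} (g : B ⟶ C) :
        (𝟙 A ⊗ₘ g) ≫ (β_ A C).hom = (β_ A B).hom ≫ (g ⊗ₘ 𝟙 A) := by
      rw [id_tensorHom, tensorHom_id, BraidedCategory.braiding_naturality_right]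
    exact h _
  | natural_left f Z =>
    obtain ⟨f⟩ := f
    have h {A B C : StdWeb R m} (g : A ⟶ B) :
        (g ⊗ₘ 𝟙 C) ≫ (β_ B C).hom = (β_ A C).hom ≫ (𝟙 C ⊗ₘ g) := by
      rw [id_tensorHom, tensorHom_id, BraidedCategory.braiding_naturality_left]
    exact h _
  | hexagon_forward X Y Z =>
    have h (A B C : StdWeb R m) : (α_ A B C).hom ≫ (β_ A (B ⊗ C)).hom ≫ (α_ B C A).hom =
        ((β_ A B).hom ⊗ₘ 𝟙 C) ≫ (α_ B A C).hom ≫ (𝟙 B ⊗ₘ (β_ A C).hom) := by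
      rw [id_tensorHom, tensorHom_id, BraidedCategory.hexagon_forward]
    exact h _ _ _
  | hexagon_reverse X Y Z =>
    have h (A B C : StdWeb R m) : (α_ A B C).inv ≫ (β_ (A ⊗ B) C).hom ≫ (α_ C A B).inv =
        (𝟙 A ⊗ₘ (β_ B C).hom) ≫ (α_ A C B).inv ≫ ((β_ A C).hom ⊗ₘ 𝟙 B) := by
      rw [id_tensorHom, tensorHom_id, BraidedCategory.hexagon_reverse]
    exact h _ _ _
  | snakeLeft => exact ObjectProperty.hom_ext _ (web_snakeLeft R m)
  | snakeRight => exact ObjectProperty.hom_ext _ (web_snakeRight R m)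
  | dimension => exact ObjectProperty.hom_ext _ (web_circle R m)
  | skein =>
    -- Subtraction of terms is encoded as adding a multiple by -1, and evaluation produces that
    -- form.
    have h : webBraiding R m + (-1 : R) • webBraidingInv R m = algebraMap QRing R skeinCoeff •
        (𝟙 _ + (-1 : R) • ((web R m).cap 1 ≫ (web R m).cup 1)) := by
      rw [neg_one_smul, neg_one_smul, ← sub_eq_add_neg, ← sub_eq_add_neg, web_skein]
    exact ObjectProperty.hom_ext _ h
  | curl => exact ObjectProperty.hom_ext _ (web_curl R m)

end BMWFunctor

/-! ### Conjugating structure morphisms by isomorphisms -/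

section Conjugation

variable {C : Type*} [Category C] [MonoidalCategory C] {X Y Z X' Y' Z' : C}

theorem conj_associator_hom (e : X ≅ X') (f : Y ≅ Y') (g : Z ≅ Z') :
    (α_ X Y Z).hom = ((e ⊗ᵢ f) ⊗ᵢ g).hom ≫ (α_ X' Y' Z').hom ≫ (e ⊗ᵢ (f ⊗ᵢ g)).inv := by
  rw [← Category.assoc, Iso.eq_comp_inv]
  exact (associator_naturality e.hom f.hom g.hom).symm

theorem conj_associator_inv (e : X ≅ X') (f : Y ≅ Y') (g : Z ≅ Z') :
    (α_ X Y Z).inv = (e ⊗ᵢ (f ⊗ᵢ g)).hom ≫ (α_ X' Y' Z').inv ≫ ((e ⊗ᵢ f) ⊗ᵢ g).inv := by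
  rw [← Category.assoc, Iso.eq_comp_inv]
  exact (associator_inv_naturality e.hom f.hom g.hom).symm

theorem conj_leftUnitor_hom (e : X ≅ X') :
    (λ_ X).hom = (Iso.refl (𝟙_ C) ⊗ᵢ e).hom ≫ (λ_ X').hom ≫ e.inv := by simp

theorem conj_leftUnitor_inv (e : X ≅ X') :
    (λ_ X).inv = e.hom ≫ (λ_ X').inv ≫ (Iso.refl (𝟙_ C) ⊗ᵢ e).inv := by simp

theorem conj_rightUnitor_hom (e : X ≅ X') :
    (ρ_ X).hom = (e ⊗ᵢ Iso.refl (𝟙_ C)).hom ≫ (ρ_ X').hom ≫ e.inv := by simp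

theorem conj_rightUnitor_inv (e : X ≅ X') :
    (ρ_ X).inv = e.hom ≫ (ρ_ X').inv ≫ (e ⊗ᵢ Iso.refl (𝟙_ C)).inv := by simp

theorem conj_tensor {W W' : C} (e : X ≅ X') (f : Y ≅ Y') (g : Z ≅ Z') (h : W ≅ W')
    (a : X' ⟶ Z') (b : Y' ⟶ W') : (e.hom ≫ a ≫ g.inv) ⊗ₘ (f.hom ≫ b ≫ h.inv) =
      (e ⊗ᵢ f).hom ≫ (a ⊗ₘ b) ≫ (g ⊗ᵢ h).inv := by
  simp

end Conjugation

/-! ### The functor on the BMW category and its fullness -/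

section BMWFunctor

variable (R : Type u) [CommRing R] [Algebra QRing R] (m : ℕ)

attribute [local instance] stdBraided

theorem bmwRel_mk {X Y : TensorWord Unit} {f g : MorTerm R BMWGen X Y}
    (h : BMWRel R m X Y (Presented.mk _ f) (Presented.mk _ g)) :
    termValue (bmwGenValue R m) f = termValue (bmwGenValue R m) g := bmwRel_eq R m h

/-- The functor from the BMW category to the standard web category. -/
noncomputable def bmwFunctor : BMW R m ⥤ StdWeb R m :=
  presentedFunctor (R := R) (bmwGenValue R m) (bmwRel_mk R m)

noncomputable instance : (bmwFunctor R m).Monoidal :=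
  presentedFunctorMonoidal (bmwGenValue R m) (bmwRel_mk R m)

instance : (bmwFunctor R m).Additive :=
  presentedFunctor_additive (bmwGenValue R m) (bmwRel_mk R m)

instance : (bmwFunctor R m).Linear R :=
  presentedFunctor_linear (bmwGenValue R m) (bmwRel_mk R m)

noncomputable instance : (bmwFunctor R m).Braided where
  braided X Y := by
    have h (A B : StdWeb R m) : 𝟙 (A ⊗ B) ≫ (β_ A B).hom = (β_ A B).hom ≫ 𝟙 (B ⊗ A) := by
      rw [Category.id_comp, Category.comp_id]
    exact h _ _

theorem bmwFunctor_obj_surjective : Function.Surjective (bmwFunctor R m).obj := fun A =>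
  stdRec (M := fun A => ∃ X, (bmwFunctor R m).obj X = A) ⟨𝟙_ (BMW R m), rfl⟩ ⟨bmwBullet R m, rfl⟩
    (fun _ _ ⟨X, hX⟩ ⟨Y, hY⟩ => ⟨X ⊗ Y, congrArg₂ (fun A B : StdWeb R m => A ⊗ B) hX hY⟩) A

/-- A word in the generating object of the BMW category for each object. -/
def bmwWord (A : StdWeb R m) : BMW R m :=
  stdRec (M := fun _ => BMW R m) (𝟙_ _) (bmwBullet R m) (fun _ _ X Y => X ⊗ Y) A

/-- The value of the word of an object. -/
noncomputable def bmwWordIso (A : StdWeb R m) : (bmwFunctor R m).obj (bmwWord R m A) ≅ A :=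
  stdRec (M := fun A => (bmwFunctor R m).obj (bmwWord R m A) ≅ A) (Iso.refl _) (Iso.refl _)
    (fun _ _ e e' => e ⊗ᵢ e') A

/-- An isomorphism lying over the chosen comparison replaces an equality of words, so no transport
along object equalities is needed. It extends fullness from the chosen words to all objects. -/
theorem exists_bmwWordIso (X : BMW R m) :
    ∃ ψ : bmwWord R m ((bmwFunctor R m).obj X) ≅ X,
      (bmwFunctor R m).map ψ.hom = (bmwWordIso R m _).hom := by
  induction X with
  | unit => exact ⟨Iso.refl _, rfl⟩
  | of x => exact ⟨Iso.refl _, rfl⟩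
  | tensor X Y hX hY =>
    obtain ⟨ψ, hψ⟩ := hX
    obtain ⟨χ, hχ⟩ := hY
    have h : (bmwFunctor R m).map (ψ.hom ⊗ₘ χ.hom) =
        (bmwWordIso R m _).hom ⊗ₘ (bmwWordIso R m _).hom := by
      exact (presentedFunctor_map_tensor _ _ ψ.hom χ.hom).trans (congrArg₂ (· ⊗ₘ ·) hψ hχ)
    exact ⟨ψ ⊗ᵢ χ, h⟩

/-- Each generator of the standard web category has an evident preimage, and the morphisms with a
preimage are closed under all operations. -/
theorem exists_map_eq {A B : StdWeb R m} (f : A ⟶ B) :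
    ∃ g : bmwWord R m A ⟶ bmwWord R m B,
      (bmwFunctor R m).map g = (bmwWordIso R m A).hom ≫ f ≫ (bmwWordIso R m B).inv := by
  have h1 : 𝟙 (stdOne R m) ⊗ₘ 𝟙 (stdOne R m) = 𝟙 _ := id_tensorHom_id _ _
  refine stdWeb_hom_induction (P := fun {A B} f => ∃ g : bmwWord R m A ⟶ bmwWord R m B,
    (bmwFunctor R m).map g = (bmwWordIso R m A).hom ≫ f ≫ (bmwWordIso R m B).inv)
    ⟨(β_ (bmwBullet R m) (bmwBullet R m)).hom, ?_⟩ ⟨bmwCup R _, ?_⟩ ⟨bmwCap R _, ?_⟩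
    (fun A => ⟨𝟙 _, ?_⟩) (fun A B C => ⟨(α_ _ _ _).hom, ?_⟩) (fun A B C => ⟨(α_ _ _ _).inv, ?_⟩)
    (fun A => ⟨(λ_ _).hom, ?_⟩) (fun A => ⟨(λ_ _).inv, ?_⟩)
    (fun A => ⟨(ρ_ _).hom, ?_⟩) (fun A => ⟨(ρ_ _).inv, ?_⟩)
    ?_ ?_ (fun A B => ⟨0, ?_⟩) ?_ ?_ f
  · have h : stdBraiding R m = (𝟙 (stdOne R m) ⊗ₘ 𝟙 (stdOne R m)) ≫ stdBraiding R m ≫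
        (𝟙 (stdOne R m) ⊗ₘ 𝟙 (stdOne R m)) := by
      rw [h1, Category.comp_id, Category.id_comp]
    exact h
  · have h : stdCup R m = 𝟙 _ ≫ stdCup R m ≫ (𝟙 (stdOne R m) ⊗ₘ 𝟙 (stdOne R m)) := by
      rw [h1, Category.comp_id, Category.id_comp]
    exact h
  · have h : stdCap R m = (𝟙 (stdOne R m) ⊗ₘ 𝟙 (stdOne R m)) ≫ stdCap R m ≫ 𝟙 _ := by
      rw [h1, Category.comp_id, Category.id_comp]
    exact h
  · simp
  · exact conj_associator_hom _ _ _
  · exact conj_associator_inv _ _ _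
  · exact conj_leftUnitor_hom _
  · exact conj_leftUnitor_inv _
  · exact conj_rightUnitor_hom _
  · exact conj_rightUnitor_inv _
  · rintro A B C f f' ⟨g, hg⟩ ⟨g', hg'⟩
    exact ⟨g ≫ g', by simp [hg, hg']⟩
  · rintro A B A' B' f f' ⟨g, hg⟩ ⟨g', hg'⟩
    refine ⟨g ⊗ₘ g', ?_⟩
    refine (presentedFunctor_map_tensor _ _ g g').trans ((congrArg₂ (· ⊗ₘ ·) hg hg').trans ?_)
    exact conj_tensor _ _ _ _ f f'
  · simp
  · rintro A B f f' ⟨g, hg⟩ ⟨g', hg'⟩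
    exact ⟨g + g', by simp [Functor.map_add, hg, hg']⟩
  · rintro A B r f ⟨g, hg⟩
    exact ⟨r • g, by simp [Functor.map_smul, hg]⟩

instance : (bmwFunctor R m).Full where
  map_surjective {X Y} f := by
    obtain ⟨ψ, hψ⟩ := exists_bmwWordIso R m X
    obtain ⟨χ, hχ⟩ := exists_bmwWordIso R m Y
    obtain ⟨g, hg⟩ := exists_map_eq R m f
    refine ⟨ψ.inv ≫ g ≫ χ.hom, ?_⟩
    rw [Functor.map_comp, Functor.map_comp, hg, hχ, ← Functor.mapIso_inv, Iso.inv_comp_eq,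
      Functor.mapIso_hom, hψ]
    simp

end BMWFunctor

theorem proposition2 (R : Type u) [CommRing R] [Algebra QRing R] (m : ℕ) (hm : 1 ≤ m) :
    (∀ (X Y : Web R m) (f : X ⟶ Y), IsBraidWeb R m X Y f ↔ IsStd R m X ∧ IsStd R m Y) ∧
    ∃ (_ : BraidedCategory (StdWeb R m)) (F : BMW R m ⥤ StdWeb R m) (_ : F.Braided)
      (h : F.obj (bmwBullet R m) = stdOne R m),
      (β_ (stdOne R m) (stdOne R m)).hom = stdBraiding R m ∧
      Functor.LaxMonoidal.ε F ≫ F.map (bmwCup R _) ≫ Functor.OplaxMonoidal.δ F _ _ ≫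
        (eqToHom h ⊗ₘ eqToHom h) = stdCup R m ∧
      Functor.LaxMonoidal.μ F _ _ ≫ F.map (bmwCap R _) =
        (eqToHom h ⊗ₘ eqToHom h) ≫ stdCap R m ≫ Functor.LaxMonoidal.ε F ∧
      F.Additive ∧ F.Linear R ∧ F.Full ∧ Function.Surjective F.obj := by
  refine ⟨fun X Y f => ⟨IsBraidWeb.isStd, fun h => isBraidWeb_of_isStd h.1 h.2 f⟩,
    stdBraided R m, bmwFunctor R m, inferInstance, rfl, rfl, ?_, ?_, inferInstance, inferInstance,
    inferInstance, bmwFunctor_obj_surjective R m⟩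
  -- The comparison maps of the functor are identities by definition, so the compatibility with the
  -- cup unfolds to this.
  · have h : 𝟙 _ ≫ stdCup R m ≫ 𝟙 _ ≫ (𝟙 (stdOne R m) ⊗ₘ 𝟙 (stdOne R m)) = stdCup R m := by simp
    exact h
  · have h : 𝟙 _ ≫ stdCap R m = (𝟙 (stdOne R m) ⊗ₘ 𝟙 (stdOne R m)) ≫ stdCap R m ≫ 𝟙 _ := by
      simp
    exact h
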